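/- Let $n\ge 2$ and let $N$ be a smooth manifold (Hausdorff, $\sigma$-compact, without boundary) of dimension $n+1$ with a projective structure $[\nabla]$, i.e. an equivalence class of smooth torsion-free affine connections under $\nabla'_XY=\nabla_XY+p(X)Y+p(Y)X$, $p$ a 1-form. For $w\in\mathbb R$ let $\mathcal E(w)=|\Lambda^{n+1}T^*N|^{-w/(n+2)}$ (for oriented $N$ this is $(\Lambda^{n+1}T^*N)^{-w/(n+2)}$); sections of $\mathcal E(w)$ are called densities of weight $w$, and a projective scale is a smooth positive section of $\mathcal E(1)$. Fix a connection $\nabla\in[\nabla]$ that preserves some projective scale, and let $P_{ij}=\frac1n\mathrm{Ric}_{ij}$ with $\mathrm{Ric}_{jl}=R_{ij}{}^i{}_l$ and $(\nabla_i\nabla_j-\nabla_j\nabla_i)X^k=R_{ij}{}^k{}_lX^l$. (The operator $\mathcal J$ and the tensor $g_{ij}$ below do not depend on the choice of this $\nabla$.) Let $\Omega\subset N$ be a relatively compact domain with smooth boundary $M=\partial\Omega$ that is strictly convex: for some connection in $[\nabla]$ and some defining function $\rho$ of $\Omega$ (negative in $\Omega$), the Hessian $\nabla_i\nabla_j\rho$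 is positive definite on $TM$. For a density $\boldsymbol r$ of weight $2$ put $$\mathcal J[\boldsymbol r]=\det\begin{pmatrix}2\boldsymbol r&\nabla_j\boldsymbol r\\ \nabla_i\boldsymbol r&\nabla_i\nabla_j\boldsymbol r+2\boldsymbol rP_{ij}\end{pmatrix},$$ a function on $N$: the determinant of the components in any frame $e$, the density-valued entries being evaluated on $e$. Let $\boldsymbol r\in\mathcal E(2)$ be a Fefferman defining density of $\Omega$: $\boldsymbol r$ is smooth, $\Omega=\{\boldsymbol r<0\}$, the differential of $\boldsymbol r$ does not vanish on $M$, and near $M$ $$\mathcal J[\boldsymbol r]=-1+O(\boldsymbol r^\infty)\ \ (n\text{ odd}),\qquad \mathcal J[\boldsymbol r]=-1+\mathcal O\,\boldsymbol r^{n/2+1}\ \ (n\text{ even})$$ with $\mathcal O$ a smooth density of weight $-n-2$; here $O(\boldsymbol r^\infty)$ means that for every $m\ge 0$ the term equals $K_m\boldsymbol r^m$ near $M$ with $K_m$ a smooth density of weight $-2m$. Let $g$ be a smooth Riemannian metric on $\Omega$ that near $M$ is the Blaschke metric $$g_{ij}=\frac{\nabla_i\nabla_j\boldsymbol r}{-2\boldsymbol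 r}+\frac{\nabla_i\boldsymbol r\,\nabla_j\boldsymbol r}{4\boldsymbol r^2}-P_{ij}.$$ For a projective scale $\tau$ put $u=-\tau^{-1}(-2\boldsymbol r)^{1/2}$ on $\Omega$. Then for every projective scale $\tau$ the volume $\mathrm{Vol}(\{u<-\varepsilon\})$ with respect to $g$ is finite for every $\varepsilon>0$, and as $\varepsilon\to0^+$, with real constants $c_{-n+2j}$, $V$, $L$, $$\mathrm{Vol}(\{u<-\varepsilon\})=\sum_{j=0}^{\lceil n/2\rceil-1}c_{-n+2j}\,\varepsilon^{-n+2j}+\begin{cases}V+o(1)&(n\text{ odd}),\\ L\log\frac1\varepsilon+V+o(1)&(n\text{ even}).\end{cases}$$ Moreover, for given $\boldsymbol r$ and $g$, the constant $V$ is independent of $\tau$ when $n$ is odd, and $L$ is independent of $\tau$ when $n$ is even. -/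

import Mathlib

open Set Filter Topology Bundle MeasureTheory
open scoped Manifold ContDiff ENNReal

noncomputable section

/-- The model space `ℝ^{n+1}` of an `(n+1)`-dimensional manifold. -/
abbrev ModelE (n : ℕ) : Type := EuclideanSpace ℝ (Fin (n + 1))

section ProjectiveGeometry

variable {n : ℕ} {N : Type*} [TopologicalSpace N] [ChartedSpace (ModelE n) N]
  [IsManifold 𝓘(ℝ, ModelE n) ∞ N]

/-! ### Coordinate fields -/

/-- The vector field with constant coefficients `v` in the preferred chart at `c`
(meaningful on the domain of that chart). At the point `c` itself its value is `v`,
since `T_c N` is identified with the model space through that same chart. -/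
def coordField (c : N) (v : ModelE n) (y : N) : TangentSpace 𝓘(ℝ, ModelE n) y :=
  (trivializationAt (ModelE n) (TangentSpace 𝓘(ℝ, ModelE n)) c).symmL ℝ y v

/-- The coordinate frame `∂_1, …, ∂_{n+1}` of the preferred chart at `c`, at the point `y`. -/
def coordFrame (c : N) (y : N) (i : Fin (n + 1)) : TangentSpace 𝓘(ℝ, ModelE n) y :=
  coordField c (EuclideanSpace.single i 1) y

/-- The components of `X ∈ T_y N` in the coordinate frame of the preferred chart at `c`. -/
def coordComp (c : N) (y : N) (X : TangentSpace 𝓘(ℝ, ModelE n) y) : ModelE n :=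
  (trivializationAt (ModelE n) (TangentSpace 𝓘(ℝ, ModelE n)) c).continuousLinearMapAt ℝ y X

/-! ### Projective densities -/

variable (n N) in
/-- A (not necessarily continuous) section of the projective density bundle
`ℰ(w) = |Λ^{n+1} T*N|^{-w/(n+2)}`: it assigns to each frame `e` of `T_x N` a number, with
`f(A e) = |det A|^{-w/(n+2)} f(e)`. On an oriented manifold this bundle is the same as
`(Λ^{n+1} T*N)^{-w/(n+2)}`. -/
structure ProjDensity (w : ℝ) where
  toFun : (x : N) → (Fin (n + 1) → TangentSpace 𝓘(ℝ, ModelE n) x) → ℝ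
  map_frame : ∀ (x : N) (e : Fin (n + 1) → TangentSpace 𝓘(ℝ, ModelE n) x)
    (A : TangentSpace 𝓘(ℝ, ModelE n) x →ₗ[ℝ] TangentSpace 𝓘(ℝ, ModelE n) x),
    LinearIndependent ℝ e → LinearMap.det A ≠ 0 →
      toFun x (fun i => A (e i)) = |LinearMap.det A| ^ (-w / ((n : ℝ) + 2)) * toFun x e

namespace ProjDensity

variable {w : ℝ}

/-- The function representing a density in the coordinate frame of the chart at `c`. -/
def rep (f : ProjDensity n N w) (c : N) (y : N) : ℝ := f.toFun y (coordFrame c y)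

/-- The value of a density at `x` in the coordinate frame of the chart at `x`. -/
def val (f : ProjDensity n N w) (x : N) : ℝ := f.rep x x

/-- The density is a smooth section over the set `U`. -/
def SmoothOn (f : ProjDensity n N w) (U : Set N) : Prop :=
  ∀ c : N, ContMDiffOn 𝓘(ℝ, ModelE n) 𝓘(ℝ, ℝ) ∞ (f.rep c) (U ∩ (chartAt (ModelE n) c).source)

end ProjDensity

/-- A projective scale: a smooth positive section of `ℰ(1)`. -/
def IsProjectiveScale (τ : ProjDensity n N 1) : Prop :=
  τ.SmoothOn univ ∧
    ∀ (x : N) (e : Fin (n + 1) → TangentSpace 𝓘(ℝ, ModelE n) x),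
      LinearIndependent ℝ e → 0 < τ.toFun x e

/-! ### Connections -/

variable (n N) in
/-- Affine connections on `N`; `D Y x v` is `(∇_v Y)(x)`. -/
abbrev AffineConn : Type _ :=
  CovariantDerivative 𝓘(ℝ, ModelE n) (ModelE n) (TangentSpace 𝓘(ℝ, ModelE n) : N → Type _)

/-- The vector field `X` is differentiable at `x`. -/
def VFDiffAt (X : (x : N) → TangentSpace 𝓘(ℝ, ModelE n) x) (x : N) : Prop :=
  MDifferentiableAt 𝓘(ℝ, ModelE n) (𝓘(ℝ, ModelE n).prod 𝓘(ℝ, ModelE n))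
    (fun y => (⟨y, X y⟩ : TangentBundle 𝓘(ℝ, ModelE n) N)) x

/-- Smooth torsion-free affine connections. -/
def IsSmoothTorsionFree (D : AffineConn n N) : Prop :=
  CovariantDerivative.ContMDiffCovariantDerivative D ∞ ∧
    ∀ (X Y : (x : N) → TangentSpace 𝓘(ℝ, ModelE n) x) (x : N),
      VFDiffAt X x → VFDiffAt Y x →
        D Y x (X x) - D X x (Y x) = VectorField.mlieBracket 𝓘(ℝ, ModelE n) X Y x

/-- Projective equivalence: there is a 1-form `p` with
`∇'_v X = ∇_v X + p(v) X + p(X) v`. -/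
def ProjectivelyEquivalent (D D' : AffineConn n N) : Prop :=
  ∃ p : (x : N) → TangentSpace 𝓘(ℝ, ModelE n) x →ₗ[ℝ] ℝ,
    ∀ (X : (x : N) → TangentSpace 𝓘(ℝ, ModelE n) x) (x : N), VFDiffAt X x →
      ∀ v : TangentSpace 𝓘(ℝ, ModelE n) x, D' X x v = D X x v + p x v • X x + p x (X x) • v

variable (n N) in
/-- A projective structure `[∇]` on `N`: a projective equivalence class of smooth torsion-free
affine connections. -/
structure ProjectiveStructure where
  carrier : Set (AffineConn n N)
  isClass : ∃ D₀ : AffineConn n N, IsSmoothTorsionFree D₀ ∧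
    carrier = {D | IsSmoothTorsionFree D ∧ ProjectivelyEquivalent D₀ D}

/-- The trace `Σ_i e^i(∇_v e_i)` of the connection form in the coordinate frame at `c`. -/
def connTrace (D : AffineConn n N) (c y : N) (v : TangentSpace 𝓘(ℝ, ModelE n) y) : ℝ :=
  ∑ i, coordComp c y (D (fun z => coordFrame c z i) y v) i

/-- The covariant derivative `∇_v f` of a density of weight `w` for the connection induced on
`ℰ(w)`, expressed in the coordinate frame at `c`. -/
def densDeriv (D : AffineConn n N) {w : ℝ} (f : ProjDensity n N w) (c y : N)
    (v : TangentSpace 𝓘(ℝ, ModelE n) y) : ℝ :=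
  mvfderiv 𝓘(ℝ, ModelE n) (f.rep c) y v
    + w / ((n : ℝ) + 2) * connTrace D c y v * f.rep c y

/-- The second covariant derivative `v^i w^j ∇_i ∇_j f` at `x` of a density of weight `w`,
expressed in the coordinate frame of the chart at `x`; the connection on `ℰ_j(w)` is the one
induced by `∇`. -/
def densHess (D : AffineConn n N) {w : ℝ} (f : ProjDensity n N w) (x : N)
    (v v' : ModelE n) : ℝ :=
  mvfderiv 𝓘(ℝ, ModelE n) (fun y => densDeriv D f x y (coordField x v' y)) x v
    + w / ((n : ℝ) + 2) * connTrace D x x v * densDeriv D f x x v'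
    - densDeriv D f x x (D (coordField x v') x v)

/-- `∇ τ = 0`. -/
def IsParallel (D : AffineConn n N) (τ : ProjDensity n N 1) : Prop :=
  ∀ (x : N) (v : TangentSpace 𝓘(ℝ, ModelE n) x), densDeriv D τ x x v = 0

/-- The curvature `R(v, v')z` at `x`, where `(∇_i∇_j - ∇_j∇_i)X^k = R_{ij}^k_l X^l`; it is
computed with the extensions of the three vectors by constant coefficients in the chart at `x`,
whose Lie brackets vanish. -/
def curvature (D : AffineConn n N) (x : N) (v v' z : ModelE n) : TangentSpace 𝓘(ℝ, ModelE n) x :=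
  D (fun y => D (coordField x z) y (coordField x v' y)) x v
    - D (fun y => D (coordField x z) y (coordField x v y)) x v'

/-- The Ricci tensor `Ric_{jl} = R_{ij}^i_l`. -/
def ricci (D : AffineConn n N) (x : N) (v z : ModelE n) : ℝ :=
  ∑ i, coordComp x x (curvature D x (EuclideanSpace.single i 1) v z) i

/-- The projective Schouten tensor `P_{ij} = Ric_{ij} / n` of a connection preserving a
projective scale. -/
def schouten (D : AffineConn n N) (x : N) (v z : ModelE n) : ℝ := ricci D x v z / n

/-- The Hessian `v^i v'^j ∇_i ∇_j ρ` of a function. -/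
def funHess (D : AffineConn n N) (ρ : N → ℝ) (x : N) (v v' : ModelE n) : ℝ :=
  mvfderiv 𝓘(ℝ, ModelE n)
      (fun y => mvfderiv 𝓘(ℝ, ModelE n) ρ y (coordField x v' y)) x v
    - mvfderiv 𝓘(ℝ, ModelE n) ρ x (D (coordField x v') x v)

/-! ### Strictly convex domains, the Monge–Ampère operator, the Blaschke metric -/

/-- `ρ` is a smooth defining function of `Ω`, negative inside. -/
def IsDefiningFunction (Ω : Set N) (ρ : N → ℝ) : Prop :=
  ContMDiff 𝓘(ℝ, ModelE n) 𝓘(ℝ, ℝ) ∞ ρ ∧ Ω = {x | ρ x < 0} ∧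
    ∀ x ∈ frontier Ω, mvfderiv 𝓘(ℝ, ModelE n) ρ x ≠ 0

/-- `Ω` is a relatively compact domain with smooth boundary which is strictly convex for the
projective structure: for some connection of the class and some defining function `ρ`, the
Hessian of `ρ` is positive definite on the tangent spaces of the boundary. -/
def IsStrictlyConvexDomain (P : ProjectiveStructure n N) (Ω : Set N) : Prop :=
  IsOpen Ω ∧ IsConnected Ω ∧ IsCompact (closure Ω) ∧
    ∃ D ∈ P.carrier, ∃ ρ : N → ℝ, IsDefiningFunction (n := n) Ω ρ ∧
      ∀ x ∈ frontier Ω, ∀ v : ModelE n, v ≠ 0 → mvfderiv 𝓘(ℝ, ModelE n) ρ x v = 0 →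
        0 < funHess D ρ x v v

/-- `r ∈ ℰ(2)` is a smooth defining density of `Ω`, negative inside. -/
def IsDefiningDensity (Ω : Set N) (r : ProjDensity n N 2) : Prop :=
  r.SmoothOn univ ∧ Ω = {x | r.val x < 0} ∧
    ∀ x ∈ frontier Ω, mvfderiv 𝓘(ℝ, ModelE n) (r.rep x) x ≠ 0

/-- The matrix `D_I D_J r = (2r, ∇_j r; ∇_i r, ∇_i∇_j r + 2 r P_{ij})` at `x`, in the
coordinate frame of the chart at `x`. -/
def tractorHess (D : AffineConn n N) (r : ProjDensity n N 2) (x : N) :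
    Matrix (Unit ⊕ Fin (n + 1)) (Unit ⊕ Fin (n + 1)) ℝ :=
  Matrix.fromBlocks
    (Matrix.of fun _ _ => 2 * r.val x)
    (Matrix.of fun _ j => densDeriv D r x x (EuclideanSpace.single j (1 : ℝ) : ModelE n))
    (Matrix.of fun i _ => densDeriv D r x x (EuclideanSpace.single i (1 : ℝ) : ModelE n))
    (Matrix.of fun i j =>
      densHess D r x (EuclideanSpace.single i 1) (EuclideanSpace.single j 1)
        + 2 * r.val x * schouten D x (EuclideanSpace.single i 1) (EuclideanSpace.single j 1))

/-- The Monge–Ampère operator `𝒥[r] = det (D_I D_J r)`. The entries of the matrix have weight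
`2`, so the determinant of the components in a frame `e`, with the entries evaluated on the same
frame `e`, does not depend on `e`: it equals `det_τ (τ^{-2} D_I D_J r)` for every scale `τ`. -/
def mongeAmpere (D : AffineConn n N) (r : ProjDensity n N 2) (x : N) : ℝ :=
  (tractorHess D r x).det

/-- `F = -1 + O(r^m)` near the boundary of `Ω`: `F = -1 + K r^m` on a neighbourhood of `∂Ω`,
with `K` a smooth density of weight `-2m` there. -/
def EqNegOneModPow (Ω : Set N) (r : ProjDensity n N 2) (F : N → ℝ) (m : ℕ) : Prop :=
  ∃ U : Set N, IsOpen U ∧ frontier Ω ⊆ U ∧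
    ∃ K : ProjDensity n N (-(2 * (m : ℝ))), K.SmoothOn U ∧
      ∀ x ∈ U, F x = -1 + K.val x * r.val x ^ m

/-- `r` is a Fefferman defining density of `Ω`: a defining density with
`𝒥[r] = -1 + O(r^∞)` for `n` odd and `𝒥[r] = -1 + 𝒪 r^{n/2+1}` for `n` even.
Here `D` is a connection of the projective class preserving some projective scale. -/
def IsFeffermanDensity (D : AffineConn n N) (Ω : Set N) (r : ProjDensity n N 2) : Prop :=
  IsDefiningDensity Ω r ∧
    (Odd n → ∀ m : ℕ, EqNegOneModPow Ω r (mongeAmpere D r) m) ∧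
    (Even n → EqNegOneModPow Ω r (mongeAmpere D r) (n / 2 + 1))

/-- The tensor `∇_i∇_j r / (-2r) + ∇_i r ∇_j r / (4 r²) - P_{ij}`, at a point where `r < 0`. -/
def blaschke (D : AffineConn n N) (r : ProjDensity n N 2) (x : N) (v v' : ModelE n) : ℝ :=
  densHess D r x v v' / (-2 * r.val x)
    + densDeriv D r x x v * densDeriv D r x x v' / (4 * r.val x ^ 2)
    - schouten D x v v'

/-- `g` is a smooth Riemannian metric on the open set `Ω` (its values elsewhere are
irrelevant). -/
def IsRiemannianMetricOn (Ω : Set N)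
    (g : (x : N) → TangentSpace 𝓘(ℝ, ModelE n) x →L[ℝ] TangentSpace 𝓘(ℝ, ModelE n) x →L[ℝ] ℝ) :
    Prop :=
  (∀ x ∈ Ω, ∀ v v' : TangentSpace 𝓘(ℝ, ModelE n) x, g x v v' = g x v' v) ∧
  (∀ x ∈ Ω, ∀ v : TangentSpace 𝓘(ℝ, ModelE n) x, v ≠ 0 → 0 < g x v v) ∧
  ContMDiffOn 𝓘(ℝ, ModelE n) (𝓘(ℝ, ModelE n).prod 𝓘(ℝ, ModelE n →L[ℝ] ModelE n →L[ℝ] ℝ)) ∞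
    (fun x => TotalSpace.mk' (ModelE n →L[ℝ] ModelE n →L[ℝ] ℝ)
      (E := fun x : N =>
        TangentSpace 𝓘(ℝ, ModelE n) x →L[ℝ] TangentSpace 𝓘(ℝ, ModelE n) x →L[ℝ] ℝ) x (g x)) Ω

/-- A Blaschke metric of `r`: a Riemannian metric on `Ω` that is given by the formula above
near the boundary of `Ω`. -/
def IsBlaschkeMetric (D : AffineConn n N) (Ω : Set N) (r : ProjDensity n N 2)
    (g : (x : N) → TangentSpace 𝓘(ℝ, ModelE n) x →L[ℝ] TangentSpace 𝓘(ℝ, ModelE n) x →L[ℝ] ℝ) :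
    Prop :=
  IsRiemannianMetricOn Ω g ∧
    ∃ U : Set N, IsOpen U ∧ frontier Ω ⊆ U ∧
      ∀ x ∈ U ∩ Ω, ∀ v v' : TangentSpace 𝓘(ℝ, ModelE n) x, g x v v' = blaschke D r x v v'

/-! ### Riemannian volume -/

/-- The Riemannian volume density `√(det g_{ij})` in the coordinates of the chart at `c`. -/
def volDensity
    (g : (x : N) → TangentSpace 𝓘(ℝ, ModelE n) x →L[ℝ] TangentSpace 𝓘(ℝ, ModelE n) x →L[ℝ] ℝ)
    (c y : N) : ℝ :=
  Real.sqrt (Matrix.det (Matrix.of fun i j => g y (coordFrame c y i) (coordFrame c y j)))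

/-- The Riemannian volume of `S`: the supremum of `Σ_k ∫_{B_k} √(det g_{ij}) dx` over the finite
families of measurable sets `B_k`, each contained in the image of a chart, which correspond to
pairwise disjoint subsets of `S`. (For a Borel set `S` this is the usual Riemannian volume.) -/
def riemVol
    (g : (x : N) → TangentSpace 𝓘(ℝ, ModelE n) x →L[ℝ] TangentSpace 𝓘(ℝ, ModelE n) x →L[ℝ] ℝ)
    (S : Set N) : ℝ≥0∞ :=
  ⨆ (m : ℕ) (c : Fin m → N) (B : Fin m → Set (ModelE n))
    (_ : ∀ k, MeasurableSet (B k) ∧ B k ⊆ (chartAt (ModelE n) (c k)).target ∧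
      (chartAt (ModelE n) (c k)).symm '' B k ⊆ S)
    (_ : Pairwise fun k l => Disjoint ((chartAt (ModelE n) (c k)).symm '' B k)
      ((chartAt (ModelE n) (c l)).symm '' B l)),
    ∑ k, ∫⁻ y in B k, ENNReal.ofReal (volDensity g (c k) ((chartAt (ModelE n) (c k)).symm y))

/-- `u = τ^{-1} 𝐮` with `𝐮 = -(-2r)^{1/2} ∈ ℰ(1)` (used where `r ≤ 0`). -/
def scaledU (r : ProjDensity n N 2) (τ : ProjDensity n N 1) (x : N) : ℝ :=
  -Real.sqrt (-2 * r.val x) / τ.val x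

/-- The volume of `{u < -ε}`. -/
def sublevelVol
    (g : (x : N) → TangentSpace 𝓘(ℝ, ModelE n) x →L[ℝ] TangentSpace 𝓘(ℝ, ModelE n) x →L[ℝ] ℝ)
    (Ω : Set N) (r : ProjDensity n N 2) (τ : ProjDensity n N 1) (ε : ℝ) : ℝ≥0∞ :=
  riemVol g {x | x ∈ Ω ∧ scaledU r τ x < -ε}

end ProjectiveGeometry

/-- The expansion
`F(ε) = Σ_{j=0}^{⌈n/2⌉-1} c_j ε^{-n+2j} + L log(1/ε) + V + o(1)` as `ε → 0+`
(note that `⌈n/2⌉ = (n+1)/2` with integer division). -/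
def HasVolExpansion (n : ℕ) (F : ℝ → ℝ) (c : ℕ → ℝ) (L V : ℝ) : Prop :=
  Tendsto (fun ε : ℝ => F ε - ∑ j ∈ Finset.range ((n + 1) / 2), c j * ε ^ (-(n : ℤ) + 2 * (j : ℤ))
    - L * Real.log (1 / ε)) (𝓝[>] 0) (𝓝 V)

end

noncomputable section

/-! ### Asymptotic expansions in powers and a logarithm -/

/-- `A(δ) = Σ_{j<J} c_j δ^{j-ν} + L log(1/δ) + V + o(1)` as `δ → 0+`, for some coefficients `c`. -/
def HasPowerLogExpansion (ν : ℝ) (J : ℕ) (A : ℝ → ℝ) (L V : ℝ) : Prop :=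
  ∃ c : ℕ → ℝ, Tendsto (fun δ : ℝ => A δ - ∑ j ∈ Finset.range J, c j * δ ^ ((j : ℝ) - ν)
    - L * Real.log (1 / δ)) (𝓝[>] 0) (𝓝 V)

namespace HasPowerLogExpansion

variable {ν : ℝ} {J : ℕ} {A B : ℝ → ℝ} {L L' V V' : ℝ}

lemma add (hA : HasPowerLogExpansion ν J A L V) (hB : HasPowerLogExpansion ν J B L' V') :
    HasPowerLogExpansion ν J (fun δ => A δ + B δ) (L + L') (V + V') := by
  obtain ⟨c, hc⟩ := hA
  obtain ⟨d, hd⟩ := hB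
  refine ⟨fun j => c j + d j, (hc.add hd).congr fun δ => ?_⟩
  simp only [add_mul, Finset.sum_add_distrib]
  ring

lemma neg (hA : HasPowerLogExpansion ν J A L V) :
    HasPowerLogExpansion ν J (fun δ => -A δ) (-L) (-V) := by
  obtain ⟨c, hc⟩ := hA
  refine ⟨fun j => -c j, hc.neg.congr fun δ => ?_⟩
  simp only [neg_mul, Finset.sum_neg_distrib]
  ring

lemma sub (hA : HasPowerLogExpansion ν J A L V) (hB : HasPowerLogExpansion ν J B L' V') :
    HasPowerLogExpansion ν J (fun δ => A δ - B δ) (L - L') (V - V') := by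
  simpa only [sub_eq_add_neg] using hA.add hB.neg

lemma congr' (hA : HasPowerLogExpansion ν J A L V) (h : A =ᶠ[𝓝[>] 0] B) :
    HasPowerLogExpansion ν J B L V := by
  obtain ⟨c, hc⟩ := hA
  refine ⟨c, hc.congr' ?_⟩
  filter_upwards [h] with δ hδ
  rw [hδ]

lemma of_tendsto (h : Tendsto A (𝓝[>] 0) (𝓝 V)) : HasPowerLogExpansion ν J A 0 V :=
  ⟨fun _ => 0, by simpa using h⟩

lemma sum {ι : Type*} (s : Finset ι) {A : ι → ℝ → ℝ} {L V : ι → ℝ}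
    (h : ∀ i ∈ s, HasPowerLogExpansion ν J (A i) (L i) (V i)) :
    HasPowerLogExpansion ν J (fun δ => ∑ i ∈ s, A i δ) (∑ i ∈ s, L i) (∑ i ∈ s, V i) := by
  classical
  induction s using Finset.induction_on with
  | empty => simpa using of_tendsto (A := fun _ => (0 : ℝ)) tendsto_const_nhds
  | insert a s ha ih =>
    simp only [Finset.sum_insert ha]
    exact (h a (Finset.mem_insert_self a s)).add
      (ih fun i hi => h i (Finset.mem_insert_of_mem hi))

end HasPowerLogExpansion

lemma tendsto_rpow_nhdsGT_zero {a : ℝ} (ha : 0 < a) :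
    Tendsto (fun δ : ℝ => δ ^ a) (𝓝[>] 0) (𝓝 0) := by
  have h : ContinuousAt (fun δ : ℝ => δ ^ a) 0 := Real.continuousAt_rpow_const 0 a (Or.inr ha.le)
  simpa [ContinuousAt, Real.zero_rpow ha.ne'] using h.tendsto.mono_left nhdsWithin_le_nhds

lemma tendsto_rpow_mul_log_inv_nhdsGT_zero {a : ℝ} (ha : 0 < a) :
    Tendsto (fun δ : ℝ => δ ^ a * Real.log (1 / δ)) (𝓝[>] 0) (𝓝 0) := by
  have := (tendsto_log_mul_rpow_nhdsGT_zero ha).neg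
  simp only [neg_zero] at this
  refine this.congr fun δ => ?_
  rw [one_div, Real.log_inv]
  ring

/-- Negative powers, the logarithm and constants are asymptotically independent. -/
lemma powerLog_coeff_eq_zero (J : ℕ) : ∀ (ν : ℝ) (_ : ∀ j < J, (j : ℝ) < ν) (c : ℕ → ℝ) (L V : ℝ),
    Tendsto (fun δ : ℝ => ∑ j ∈ Finset.range J, c j * δ ^ ((j : ℝ) - ν)
      + L * Real.log (1 / δ)) (𝓝[>] 0) (𝓝 V) → L = 0 ∧ V = 0 := by
  induction J with
  | zero =>
    intro ν _ c L V h
    simp only [Finset.range_zero, Finset.sum_empty, zero_add] at h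
    have hlog : Tendsto (fun δ : ℝ => Real.log (1 / δ)) (𝓝[>] 0) atTop := by
      refine Real.tendsto_log_atTop.comp ?_
      exact tendsto_inv_nhdsGT_zero.congr fun δ => (one_div δ).symm
    have hL : L = 0 := by
      have h1 : Tendsto (fun δ : ℝ => L * Real.log (1 / δ) * (Real.log (1 / δ))⁻¹) (𝓝[>] 0)
          (𝓝 (V * 0)) := h.mul (tendsto_inv_atTop_zero.comp hlog)
      have h2 : Tendsto (fun _ : ℝ => L) (𝓝[>] 0) (𝓝 (V * 0)) := by
        refine h1.congr' ?_
        filter_upwards [hlog.eventually_gt_atTop 0] with δ hδ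
        field_simp
      simpa using tendsto_nhds_unique tendsto_const_nhds h2
    refine ⟨hL, ?_⟩
    subst hL
    simp only [zero_mul] at h
    exact tendsto_nhds_unique h tendsto_const_nhds
  | succ J ih =>
    intro ν hν c L V h
    have hν0 : 0 < ν := by simpa using hν 0 (Nat.succ_pos J)
    have hc : c 0 = 0 := by
      have h1 := (tendsto_rpow_nhdsGT_zero hν0).mul h
      have h2 : Tendsto (fun δ : ℝ => c 0 + (∑ j ∈ Finset.range J, c (j + 1) * δ ^ ((j : ℝ) + 1)
          + L * (δ ^ ν * Real.log (1 / δ)))) (𝓝[>] 0) (𝓝 (0 * V)) := by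
        refine h1.congr' ?_
        filter_upwards [self_mem_nhdsWithin] with δ hδ
        have hδ : 0 < δ := hδ
        rw [Finset.sum_range_succ', mul_add, mul_add, Finset.mul_sum]
        have e1 : ∀ j : ℕ, δ ^ ν * (c (j + 1) * δ ^ (((j + 1 : ℕ) : ℝ) - ν))
            = c (j + 1) * δ ^ ((j : ℝ) + 1) := by
          intro j
          rw [mul_left_comm, ← Real.rpow_add hδ]
          push_cast
          congr 2
          ring
        have e2 : δ ^ ν * (c 0 * δ ^ (((0 : ℕ) : ℝ) - ν)) = c 0 := by
          rw [mul_left_comm, ← Real.rpow_add hδ]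
          simp
        simp only [e1, e2]
        ring
      have h3 : Tendsto (fun δ : ℝ => c 0 + (∑ j ∈ Finset.range J, c (j + 1) * δ ^ ((j : ℝ) + 1)
          + L * (δ ^ ν * Real.log (1 / δ)))) (𝓝[>] 0)
          (𝓝 (c 0 + (∑ j ∈ Finset.range J, c (j + 1) * 0 + L * 0))) := by
        refine tendsto_const_nhds.add ((tendsto_finsetSum _ fun j _ => ?_).add ?_)
        · exact (tendsto_rpow_nhdsGT_zero (by positivity)).const_mul _
        · exact (tendsto_rpow_mul_log_inv_nhdsGT_zero hν0).const_mul _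
      simpa using tendsto_nhds_unique h3 h2
    refine ih (ν - 1) (fun j hj => ?_) (fun j => c (j + 1)) L V (h.congr fun δ => ?_)
    · have := hν (j + 1) (Nat.succ_lt_succ hj)
      push_cast at this
      linarith
    · rw [Finset.sum_range_succ', hc]
      simp only [zero_mul, add_zero]
      congr 1
      refine Finset.sum_congr rfl fun j _ => ?_
      push_cast
      congr 2
      ring

lemma HasPowerLogExpansion.unique {ν : ℝ} {J : ℕ} {A : ℝ → ℝ} {L L' V V' : ℝ}
    (hJ : ∀ j < J, (j : ℝ) < ν) (hA : HasPowerLogExpansion ν J A L V)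
    (hA' : HasPowerLogExpansion ν J A L' V') : L = L' ∧ V = V' := by
  obtain ⟨c, hc⟩ := hA.sub hA'
  simp only [sub_self, zero_sub] at hc
  have h := powerLog_coeff_eq_zero J ν hJ c (L - L') (-(V - V')) (hc.neg.congr fun δ => by ring)
  exact ⟨by linarith [h.1], by linarith [h.2]⟩

/-- Taylor's formula at the left end point of `[0, 1]`. -/
lemma exists_taylor_bound {G : ℝ → ℝ} (hG : ContDiff ℝ ∞ G) (K : ℕ) :
    ∃ (g : ℕ → ℝ) (C : ℝ), 0 ≤ C ∧ ∀ t ∈ Icc (0 : ℝ) 1,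
      |G t - ∑ k ∈ Finset.range (K + 1), g k * t ^ k| ≤ C * t ^ (K + 1) := by
  have hG' : ContDiffOn ℝ (K + 1) G (Icc 0 1) :=
    (hG.of_le (by exact_mod_cast le_top)).contDiffOn
  obtain ⟨C, hC⟩ := exists_taylor_mean_remainder_bound (zero_le_one : (0 : ℝ) ≤ 1) hG'
  refine ⟨fun k => ((k.factorial : ℝ)⁻¹ * iteratedDerivWithin k G (Icc 0 1) 0), |C|,
    abs_nonneg C, fun t ht => ?_⟩
  have h := hC t ht
  rw [taylor_within_apply] at h
  simp only [sub_zero, smul_eq_mul, Real.norm_eq_abs] at h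
  calc _ = |G t - ∑ k ∈ Finset.range (K + 1), (k.factorial : ℝ)⁻¹ * t ^ k
          * iteratedDerivWithin k G (Icc 0 1) 0| := by
        congr 2
        exact Finset.sum_congr rfl fun k _ => by ring
    _ ≤ C * t ^ (K + 1) := h
    _ ≤ _ := mul_le_mul_of_nonneg_right (le_abs_self C) (pow_nonneg ht.1 _)

lemma Ioo_mem_nhdsGT_zero {b : ℝ} (hb : 0 < b) : Ioo (0 : ℝ) b ∈ 𝓝[>] (0 : ℝ) :=
  Ioo_mem_nhdsGT hb

/-- A smooth function times `δ^{-ν}` has an expansion without logarithm, and without constant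
term if `ν` is not an integer. -/
lemma hasPowerLogExpansion_rpow_mul {ν : ℝ} {J : ℕ} (hν : ν ≤ J) {G : ℝ → ℝ}
    (hG : ContDiff ℝ ∞ G) :
    ∃ V, HasPowerLogExpansion ν J (fun δ => δ ^ (-ν) * G δ) 0 V ∧ (ν < J → V = 0) := by
  obtain ⟨g, C, hC0, hC⟩ := exists_taylor_bound hG J
  have hrem : Tendsto (fun δ : ℝ => δ ^ (-ν) * (G δ - ∑ k ∈ Finset.range (J + 1), g k * δ ^ k))
      (𝓝[>] 0) (𝓝 0) := by
    have h0 : Tendsto (fun δ : ℝ => C * δ ^ ((J : ℝ) + 1 - ν)) (𝓝[>] 0) (𝓝 0) := by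
      simpa using
        (tendsto_rpow_nhdsGT_zero (show (0 : ℝ) < (J : ℝ) + 1 - ν by linarith)).const_mul C
    refine squeeze_zero_norm' ?_ h0
    filter_upwards [Ioo_mem_nhdsGT_zero one_pos] with δ hδ
    rw [norm_mul, Real.norm_of_nonneg (Real.rpow_nonneg hδ.1.le _), Real.norm_eq_abs]
    calc _ ≤ δ ^ (-ν) * (C * δ ^ (J + 1)) :=
          mul_le_mul_of_nonneg_left (hC δ ⟨hδ.1.le, hδ.2.le⟩) (Real.rpow_nonneg hδ.1.le _)
      _ = C * δ ^ ((J : ℝ) + 1 - ν) := by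
          rw [mul_left_comm, ← Real.rpow_natCast, ← Real.rpow_add hδ.1]
          push_cast
          congr 2
          ring
  have hmain : ∀ W, Tendsto (fun δ : ℝ => g J * δ ^ ((J : ℝ) - ν)) (𝓝[>] 0) (𝓝 W) →
      HasPowerLogExpansion ν J (fun δ => δ ^ (-ν) * G δ) 0 W := by
    intro W hW
    refine ⟨g, ?_⟩
    have := hrem.add hW
    rw [zero_add] at this
    refine this.congr' ?_
    filter_upwards [self_mem_nhdsWithin] with δ hδ
    have hδ : 0 < δ := hδ
    have e : ∀ k : ℕ, δ ^ (-ν) * (g k * δ ^ k) = g k * δ ^ ((k : ℝ) - ν) := by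
      intro k
      rw [mul_left_comm, ← Real.rpow_natCast, ← Real.rpow_add hδ]
      congr 2
      ring
    rw [mul_sub, Finset.mul_sum, Finset.sum_range_succ]
    simp only [e]
    ring
  rcases hν.lt_or_eq with h | h
  · refine ⟨0, hmain 0 ?_, fun _ => rfl⟩
    simpa using (tendsto_rpow_nhdsGT_zero (show (0 : ℝ) < (J : ℝ) - ν by linarith)).const_mul (g J)
  · refine ⟨g J, hmain _ ?_, fun h' => absurd h h'.ne⟩
    subst h
    simp

lemma zero_notMem_uIcc {δ : ℝ} (hδ : 0 < δ) : (0 : ℝ) ∉ uIcc δ 1 := by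
  rw [mem_uIcc]
  rintro (h | h) <;> linarith [h.1]

lemma integral_rpow_sub_one {a δ : ℝ} (ha : a ≠ 0) (hδ : 0 < δ) :
    ∫ t in δ..1, t ^ (a - 1) = a⁻¹ - a⁻¹ * δ ^ a := by
  rw [integral_rpow]
  · rw [sub_add_cancel, Real.one_rpow]
    field_simp
  · refine Or.inr ⟨fun h => ha (by linarith), ?_⟩
    exact zero_notMem_uIcc hδ

lemma intervalIntegrable_rpow_mul {δ : ℝ} (hδ : 0 < δ) (a : ℝ) {p : ℝ → ℝ} (hp : Continuous p) :
    IntervalIntegrable (fun t : ℝ => t ^ a * p t) volume δ 1 := by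
  refine ContinuousOn.intervalIntegrable fun t ht => ?_
  have ht0 : t ≠ 0 := by
    rintro rfl
    exact zero_notMem_uIcc hδ ht
  exact ((Real.continuousAt_rpow_const t a (Or.inl ht0)).mul hp.continuousAt).continuousWithinAt

/-- The integral of a smooth density against `t^{-ν-1}` over `{t > δ}`; the logarithm occurs only
if `ν` is an integer. -/
lemma hasPowerLogExpansion_integral_Ioi {ν : ℝ} {J : ℕ} (hJ : ∀ j < J, (j : ℝ) < ν)
    (hν : ν ≤ J) {p : ℝ → ℝ} (hp : ContDiff ℝ ∞ p) (hpc : HasCompactSupport p) :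
    ∃ L V, HasPowerLogExpansion ν J (fun δ => ∫ t in Ioi δ, t ^ (-ν - 1) * p t) L V ∧
      (ν < J → L = 0) := by
  obtain ⟨g, C, hC0, hC⟩ := exists_taylor_bound hp J
  set R : ℝ → ℝ := fun t => t ^ (-ν - 1) * (p t - ∑ k ∈ Finset.range (J + 1), g k * t ^ k) with hR
  have hcont : Continuous fun t : ℝ => p t - ∑ k ∈ Finset.range (J + 1), g k * t ^ k :=
    hp.continuous.sub (by fun_prop)
  have hRbd : ∀ t ∈ Ioc (0 : ℝ) 1, ‖R t‖ ≤ C := by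
    intro t ht
    rw [hR, norm_mul, Real.norm_of_nonneg (Real.rpow_nonneg ht.1.le _), Real.norm_eq_abs]
    calc _ ≤ t ^ (-ν - 1) * (C * t ^ (J + 1)) :=
          mul_le_mul_of_nonneg_left (hC t ⟨ht.1.le, ht.2⟩) (Real.rpow_nonneg ht.1.le _)
      _ = C * t ^ ((J : ℝ) - ν) := by
          rw [mul_left_comm, ← Real.rpow_natCast, ← Real.rpow_add ht.1]
          push_cast
          congr 2
          ring
      _ ≤ C * 1 := mul_le_mul_of_nonneg_left
          (Real.rpow_le_one ht.1.le ht.2 (by linarith)) hC0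
      _ = C := mul_one C
  have hRint : IntegrableOn R (Ioc 0 1) := by
    refine Measure.integrableOn_of_bounded (M := C) (by simp) ?_ ?_
    · exact ((measurable_id.pow_const _).mul hcont.measurable).aestronglyMeasurable
    · exact (ae_restrict_iff' measurableSet_Ioc).2 (ae_of_all _ hRbd)
  have hRlim : Tendsto (fun δ : ℝ => ∫ t in δ..1, R t) (𝓝[>] 0) (𝓝 (∫ t in (0 : ℝ)..1, R t)) := by
    have h1 : IntervalIntegrable R volume 0 1 :=
      (intervalIntegrable_iff_integrableOn_Ioc_of_le zero_le_one).2 hRint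
    have h2 := intervalIntegral.continuousOn_primitive_interval_left
      (μ := volume) (f := R) (a := 0) (b := 1)
      (by rw [uIcc_of_le zero_le_one, integrableOn_Icc_iff_integrableOn_Ioc]; exact hRint)
    have h3 := h2 0 (by simp)
    refine h3.tendsto.mono_left ?_
    rw [uIcc_of_le zero_le_one]
    exact nhdsWithin_le_of_mem (mem_of_superset (Ioo_mem_nhdsGT_zero one_pos) Ioo_subset_Icc_self)
  set W := ∫ t in Ioi (1 : ℝ), t ^ (-ν - 1) * p t
  have hsplit : ∀ δ ∈ Ioo (0 : ℝ) 1, ∫ t in Ioi δ, t ^ (-ν - 1) * p t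
      = (∑ k ∈ Finset.range (J + 1), g k * ∫ t in δ..1, t ^ ((k : ℝ) - ν - 1))
        + (∫ t in δ..1, R t) + W := by
    intro δ hδ
    have hi1 := intervalIntegrable_rpow_mul hδ.1 (-ν - 1) hp.continuous
    have hi2 : IntegrableOn (fun t : ℝ => t ^ (-ν - 1) * p t) (Ioi 1) := by
      have hc : Continuous fun t : ℝ => (max t 1) ^ (-ν - 1) * p t := by
        refine Continuous.mul ?_ hp.continuous
        exact (continuous_id.max continuous_const).rpow_const
          fun t => Or.inl (lt_of_lt_of_le one_pos (le_max_right t 1)).ne'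
      have hi : Integrable fun t : ℝ => (max t 1) ^ (-ν - 1) * p t :=
        hc.integrable_of_hasCompactSupport hpc.mul_left
      refine hi.integrableOn.congr_fun (fun t ht => ?_) measurableSet_Ioi
      simp only [max_eq_left (le_of_lt (mem_Ioi.1 ht))]
    have hi1' : IntegrableOn (fun t : ℝ => t ^ (-ν - 1) * p t) (Ioc δ 1) :=
      (intervalIntegrable_iff_integrableOn_Ioc_of_le hδ.2.le).1 hi1
    rw [← Ioc_union_Ioi_eq_Ioi hδ.2.le, setIntegral_union (Ioc_disjoint_Ioi le_rfl)
      measurableSet_Ioi hi1' hi2, ← intervalIntegral.integral_of_le hδ.2.le]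
    congr 1
    have hkint : ∀ k ∈ Finset.range (J + 1), IntervalIntegrable
        (fun t : ℝ => t ^ (-ν - 1) * (g k * t ^ k)) volume δ 1 := fun k _ =>
      intervalIntegrable_rpow_mul hδ.1 _ (by fun_prop)
    have e1 : ∀ k : ℕ, ∫ t in δ..1, t ^ (-ν - 1) * (g k * t ^ k)
        = g k * ∫ t in δ..1, t ^ ((k : ℝ) - ν - 1) := by
      intro k
      rw [← intervalIntegral.integral_const_mul]
      refine intervalIntegral.integral_congr fun t ht => ?_
      rw [uIcc_of_le hδ.2.le] at ht
      have ht0 : 0 < t := hδ.1.trans_le ht.1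
      rw [mul_left_comm, ← Real.rpow_natCast, ← Real.rpow_add ht0]
      congr 2
      ring
    have hsum : IntervalIntegrable (fun t : ℝ => ∑ k ∈ Finset.range (J + 1),
        t ^ (-ν - 1) * (g k * t ^ k)) volume δ 1 := by
      simp only [← Finset.mul_sum]
      exact intervalIntegrable_rpow_mul hδ.1 (-ν - 1) (by fun_prop)
    rw [← Finset.sum_congr rfl fun k _ => e1 k, ← intervalIntegral.integral_finsetSum hkint,
      ← intervalIntegral.integral_add
        hsum (intervalIntegrable_rpow_mul hδ.1 _ hcont)]
    refine intervalIntegral.integral_congr fun t _ => ?_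
    simp only [mul_sub, Finset.mul_sum]
    ring
  have hterm : ∀ k < J, ∀ δ ∈ Ioo (0 : ℝ) 1, g k * ∫ t in δ..1, t ^ ((k : ℝ) - ν - 1)
      = g k * ((k : ℝ) - ν)⁻¹ - g k * ((k : ℝ) - ν)⁻¹ * δ ^ ((k : ℝ) - ν) := by
    intro k hk δ hδ
    rw [integral_rpow_sub_one (by linarith [hJ k hk]) hδ.1]
    ring
  set V₀ := ∑ k ∈ Finset.range J, g k * ((k : ℝ) - ν)⁻¹
  have hmain : ∀ L W', Tendsto (fun δ : ℝ => g J * (∫ t in δ..1, t ^ ((J : ℝ) - ν - 1))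
      - L * Real.log (1 / δ)) (𝓝[>] 0) (𝓝 W') →
      HasPowerLogExpansion ν J (fun δ => ∫ t in Ioi δ, t ^ (-ν - 1) * p t) L
        (V₀ + W + ((∫ t in (0 : ℝ)..1, R t) + W')) := by
    intro L W' hW'
    refine ⟨fun k => -(g k * ((k : ℝ) - ν)⁻¹), ?_⟩
    refine (tendsto_const_nhds.add (hRlim.add hW')).congr' ?_
    filter_upwards [Ioo_mem_nhdsGT_zero one_pos] with δ hδ
    rw [hsplit δ hδ, Finset.sum_range_succ,
      Finset.sum_congr rfl fun k hk => hterm k (Finset.mem_range.1 hk) δ hδ,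
      Finset.sum_sub_distrib]
    simp only [neg_mul, Finset.sum_neg_distrib]
    ring
  rcases hν.lt_or_eq with h | h
  · refine ⟨0, _, hmain 0 (g J * ((J : ℝ) - ν)⁻¹) ?_, fun _ => rfl⟩
    have h0 : (0 : ℝ) < (J : ℝ) - ν := by linarith
    have := ((tendsto_rpow_nhdsGT_zero h0).const_mul (g J * ((J : ℝ) - ν)⁻¹)).const_sub
      (g J * ((J : ℝ) - ν)⁻¹)
    rw [mul_zero, sub_zero] at this
    refine this.congr' ?_
    filter_upwards [self_mem_nhdsWithin] with δ hδ
    rw [integral_rpow_sub_one h0.ne' hδ]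
    ring
  · refine ⟨g J, _, hmain (g J) 0 ?_, fun h' => absurd h h'.ne⟩
    refine tendsto_const_nhds.congr' ?_
    filter_upwards [self_mem_nhdsWithin] with δ hδ
    have hδ : 0 < δ := hδ
    have : ∫ t in δ..1, t ^ ((J : ℝ) - ν - 1) = Real.log (1 / δ) := by
      rw [← integral_inv_of_pos hδ one_pos]
      simp [h, Real.rpow_neg_one]
    rw [this, sub_self]

/-- Expansions persist under multiplicative averaging. -/
lemma HasPowerLogExpansion.average {ν : ℝ} {J : ℕ} {A : ℝ → ℝ} {L V : ℝ}
    (hA : HasPowerLogExpansion ν J A L V) (hAanti : AntitoneOn A (Ioi 0))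
    {φ : ℝ → ℝ} (hφ : Continuous φ) (hφ1 : ∫ q in (1 : ℝ)..2, φ q = 1) :
    ∃ V', HasPowerLogExpansion ν J (fun δ => ∫ q in (1 : ℝ)..2, φ q * A (δ * q)) L V' ∧
      (L = 0 → V' = V) := by
  obtain ⟨c, hc⟩ := hA
  set R : ℝ → ℝ := fun δ => A δ - ∑ j ∈ Finset.range J, c j * δ ^ ((j : ℝ) - ν)
    - L * Real.log (1 / δ) - V with hR
  have hR0 : Tendsto R (𝓝[>] 0) (𝓝 0) := by
    have := hc.sub_const V
    rwa [sub_self] at this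
  have h12 : uIcc (1 : ℝ) 2 = Icc 1 2 := uIcc_of_le one_le_two
  have hpow : ∀ a : ℝ, IntervalIntegrable (fun q : ℝ => φ q * q ^ a) volume 1 2 := by
    intro a
    refine ContinuousOn.intervalIntegrable fun q hq => ?_
    rw [h12] at hq
    exact (hφ.continuousAt.mul (Real.continuousAt_rpow_const q a
      (Or.inl (by linarith [hq.1])))).continuousWithinAt
  have hlog : IntervalIntegrable (fun q : ℝ => φ q * Real.log q) volume 1 2 := by
    refine ContinuousOn.intervalIntegrable fun q hq => ?_
    rw [h12] at hq
    exact (hφ.continuousAt.mul (Real.continuousAt_log (by linarith [hq.1]))).continuousWithinAt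
  have hAint : ∀ δ > 0, IntervalIntegrable (fun q : ℝ => φ q * A (δ * q)) volume 1 2 := by
    intro δ hδ
    refine IntervalIntegrable.continuousOn_mul ?_ hφ.continuousOn
    refine AntitoneOn.intervalIntegrable fun q hq q' hq' hqq => ?_
    rw [h12] at hq hq'
    exact hAanti (mul_pos hδ (by linarith [hq.1])) (mul_pos hδ (by linarith [hq'.1]))
      (mul_le_mul_of_nonneg_left hqq hδ.le)
  set κ := ∫ q in (1 : ℝ)..2, φ q * Real.log q
  set m : ℕ → ℝ := fun j => ∫ q in (1 : ℝ)..2, φ q * q ^ ((j : ℝ) - ν)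
  have hsum : ∀ δ > 0, IntervalIntegrable (fun q : ℝ => ∑ j ∈ Finset.range J,
      c j * δ ^ ((j : ℝ) - ν) * (φ q * q ^ ((j : ℝ) - ν))) volume 1 2 := by
    intro δ _
    have := IntervalIntegrable.sum (Finset.range J) fun j _ =>
      (hpow ((j : ℝ) - ν)).const_mul (c j * δ ^ ((j : ℝ) - ν))
    refine this.congr fun q _ => ?_
    simp
  have key : ∀ δ > 0, ∫ q in (1 : ℝ)..2, φ q * R (δ * q)
      = (∫ q in (1 : ℝ)..2, φ q * A (δ * q))
        - ∑ j ∈ Finset.range J, c j * m j * δ ^ ((j : ℝ) - ν)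
        - L * Real.log (1 / δ) + L * κ - V := by
    intro δ hδ
    have e : ∀ q ∈ uIcc (1 : ℝ) 2, φ q * R (δ * q) = φ q * A (δ * q)
        - ∑ j ∈ Finset.range J, c j * δ ^ ((j : ℝ) - ν) * (φ q * q ^ ((j : ℝ) - ν))
        - (L * Real.log (1 / δ) + V) * φ q + L * (φ q * Real.log q) := by
      intro q hq
      rw [h12] at hq
      have hq0 : 0 < q := by linarith [hq.1]
      have e1 : ∑ j ∈ Finset.range J, c j * δ ^ ((j : ℝ) - ν) * (φ q * q ^ ((j : ℝ) - ν))
          = φ q * ∑ j ∈ Finset.range J, c j * (δ * q) ^ ((j : ℝ) - ν) := by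
        rw [Finset.mul_sum]
        refine Finset.sum_congr rfl fun j _ => ?_
        rw [Real.mul_rpow hδ.le hq0.le]
        ring
      simp only [hR]
      rw [e1, one_div, one_div, Real.log_inv, Real.log_inv, Real.log_mul hδ.ne' hq0.ne']
      ring
    rw [intervalIntegral.integral_congr e, intervalIntegral.integral_add
      (((hAint δ hδ).sub (hsum δ hδ)).sub ((hφ.intervalIntegrable _ _).const_mul _))
      (hlog.const_mul _), intervalIntegral.integral_sub ((hAint δ hδ).sub (hsum δ hδ))
      ((hφ.intervalIntegrable _ _).const_mul _), intervalIntegral.integral_sub (hAint δ hδ)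
      (hsum δ hδ), intervalIntegral.integral_const_mul, intervalIntegral.integral_const_mul,
      intervalIntegral.integral_finsetSum fun j _ => (hpow _).const_mul _, hφ1]
    simp only [intervalIntegral.integral_const_mul]
    have : ∑ j ∈ Finset.range J, c j * δ ^ ((j : ℝ) - ν) * m j
        = ∑ j ∈ Finset.range J, c j * m j * δ ^ ((j : ℝ) - ν) :=
      Finset.sum_congr rfl fun j _ => by ring
    simp only [m] at this ⊢
    rw [this]
    ring
  have hlim : Tendsto (fun δ : ℝ => ∫ q in (1 : ℝ)..2, φ q * R (δ * q)) (𝓝[>] 0) (𝓝 0) := by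
    obtain ⟨Cφ, hCφ⟩ := isCompact_Icc.exists_bound_of_continuousOn
      (hφ.continuousOn (s := Icc (1 : ℝ) 2))
    have hC0 : 0 ≤ Cφ := (norm_nonneg _).trans (hCφ 1 (by simp))
    rw [Metric.tendsto_nhds]
    intro η hη
    have h1 : ∀ᶠ δ in 𝓝[>] (0 : ℝ), ‖R δ‖ < η / (Cφ + 1) := by
      have := hR0.norm
      rw [norm_zero] at this
      exact this.eventually_lt_const (by positivity)
    obtain ⟨b, hb, hbR⟩ := (mem_nhdsGT_iff_exists_Ioo_subset).1 h1
    have hb : 0 < b := hb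
    filter_upwards [Ioo_mem_nhdsGT_zero (half_pos hb)] with δ hδ
    rw [dist_zero_right]
    have : ‖∫ q in (1 : ℝ)..2, φ q * R (δ * q)‖ ≤ Cφ * (η / (Cφ + 1)) * |2 - 1| := by
      refine intervalIntegral.norm_integral_le_of_norm_le_const fun q hq => ?_
      rw [uIoc_of_le one_le_two] at hq
      rw [norm_mul]
      refine mul_le_mul (hCφ q ⟨hq.1.le, hq.2⟩) (le_of_lt (hbR ⟨?_, ?_⟩)) (norm_nonneg _) hC0
      · exact mul_pos hδ.1 (by linarith [hq.1])
      · nlinarith [hδ.1, hδ.2, hq.2, hq.1]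
    refine this.trans_lt ?_
    norm_num
    rw [mul_div_assoc', div_lt_iff₀ (by positivity)]
    nlinarith
  refine ⟨V - L * κ, ⟨fun j => c j * m j, ?_⟩, fun h => by rw [h]; ring⟩
  have := hlim.add_const (V - L * κ)
  rw [zero_add] at this
  refine this.congr' ?_
  filter_upwards [self_mem_nhdsWithin] with δ hδ
  rw [key δ hδ]
  ring


/-! ### Straightening a defining function -/

section Straightening

variable {E : Type*} [NormedAddCommGroup E] [NormedSpace ℝ E]

lemma contDiff_continuousLinearMap_det [FiniteDimensional ℝ E] :
    ContDiff ℝ ∞ fun f : E →L[ℝ] E => f.det := by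
  set b := Module.finBasis ℝ E
  have h : ∀ f : E →L[ℝ] E, f.det = ∑ σ : Equiv.Perm (Fin (Module.finrank ℝ E)),
      ((Equiv.Perm.sign σ : ℤ) : ℝ) * ∏ i, LinearMap.toContinuousLinearMap (b.coord (σ i))
          (f (b i)) := by
    intro f
    rw [ContinuousLinearMap.det, ← LinearMap.det_toMatrix b, Matrix.det_apply']
    simp [LinearMap.toMatrix_apply]
  simp only [h]
  refine ContDiff.sum fun σ _ => contDiff_const.mul (contDiff_prod fun i _ => ?_)
  exact (ContinuousLinearMap.contDiff _).comp
    (ContinuousLinearMap.apply ℝ E (b i)).contDiff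

/-- Extension by zero of a smooth function that vanishes off a compact subset of its domain. -/
lemma ContDiffOn.contDiff_indicator {T C : Set E} {f : E → ℝ} (hT : IsOpen T)
    (hf : ContDiffOn ℝ ∞ f T) (hC : IsCompact C) (hCT : C ⊆ T)
    (h0 : ∀ z ∈ T, z ∉ C → f z = 0) :
    ContDiff ℝ ∞ (T.indicator f) ∧ HasCompactSupport (T.indicator f) := by
  have hz : ∀ z, z ∉ C → T.indicator f z = 0 := fun z hz => by
    by_cases hzT : z ∈ T
    · rw [indicator_of_mem hzT, h0 z hzT hz]
    · exact indicator_of_notMem hzT f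
  refine ⟨contDiff_iff_contDiffAt.2 fun z => ?_, HasCompactSupport.intro hC hz⟩
  by_cases hzC : z ∈ C
  · have hzT := hT.mem_nhds (hCT hzC)
    refine (hf.contDiffAt hzT).congr_of_eventuallyEq ?_
    filter_upwards [hzT] with y hy
    exact indicator_of_mem hy f
  · refine contDiffAt_const (c := (0 : ℝ)) |>.congr_of_eventuallyEq ?_
    filter_upwards [hC.isClosed.isOpen_compl.mem_nhds hzC] with y hy
    exact hz y hy

variable [FiniteDimensional ℝ E]

/-- A smooth function on an open set agrees on a given compact subset with a compactly supported
smooth function on the whole space. -/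
lemma ContDiffOn.exists_contDiff_eqOn {T C : Set E} {f : E → ℝ} (hT : IsOpen T)
    (hf : ContDiffOn ℝ ∞ f T) (hC : IsCompact C) (hCT : C ⊆ T) :
    ∃ F : E → ℝ, ContDiff ℝ ∞ F ∧ HasCompactSupport F ∧ EqOn F f C := by
  obtain ⟨K, hK, hCK, hKT⟩ := exists_compact_between hC hT hCT
  obtain ⟨ψ, hψ1, hψ0, -⟩ := exists_contMDiffMap_one_nhds_of_subset_interior (n := ⊤) 𝓘(ℝ, E)
    hC.isClosed hCK
  have hψ : ContDiff ℝ ∞ ψ := ψ.contMDiff.contDiff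
  obtain ⟨h1, h2⟩ := ContDiffOn.contDiff_indicator (f := fun z => ψ z * f z) hT
    (hψ.contDiffOn.mul hf) hK hKT fun z _ hz => by simp [hψ0 z hz]
  refine ⟨_, h1, h2, fun z hz => ?_⟩
  rw [indicator_of_mem (hCT hz), hψ1.self_of_nhdsSet z hz, one_mul]

/-- Near a point where `dS ≠ 0` there is a smooth chart in which `S` is a linear function. -/
lemma exists_openPartialHomeomorph_straightening {S : E → ℝ} {O : Set E} (hO : IsOpen O)
    (hS : ContDiffOn ℝ ∞ S O) {y₀ : E} (hy₀ : y₀ ∈ O) (hdS : fderiv ℝ S y₀ ≠ 0) :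
    ∃ (ℓ : E →L[ℝ] ℝ) (v : E) (Φ : OpenPartialHomeomorph E E), ℓ v = 1 ∧ y₀ ∈ Φ.source ∧
      Φ.source ⊆ O ∧ (∀ y ∈ Φ.source, ℓ (Φ y) = S y) ∧
      ContDiffOn ℝ ∞ Φ Φ.source ∧ ContDiffOn ℝ ∞ Φ.symm Φ.target := by
  set ℓ := fderiv ℝ S y₀
  obtain ⟨w, hw⟩ : ∃ w, ℓ w ≠ 0 := by
    by_contra! h
    exact hdS (ContinuousLinearMap.ext h)
  set v := (ℓ w)⁻¹ • w
  have hv : ℓ v = 1 := by simp [v, hw]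
  set φ : E → E := fun y => y + (S y - ℓ y) • v with hφ
  have hφs : ContDiffOn ℝ ∞ φ O :=
    contDiffOn_id.add ((hS.sub ℓ.contDiff.contDiffOn).smul contDiffOn_const)
  have hℓφ : ∀ y, ℓ (φ y) = S y := fun y => by simp [hφ, hv]
  have hSd : HasFDerivAt S ℓ y₀ :=
    ((hS.contDiffAt (hO.mem_nhds hy₀)).differentiableAt (by simp)).hasFDerivAt
  have hφd : HasFDerivAt φ ((ContinuousLinearEquiv.refl ℝ E : E ≃L[ℝ] E) : E →L[ℝ] E) y₀ := by
    have := (hasFDerivAt_id (𝕜 := ℝ) y₀).add ((hSd.sub ℓ.hasFDerivAt).smul_const v)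
    simp only [sub_self, ContinuousLinearMap.zero_smulRight, add_zero] at this
    exact this
  have hφc : ContDiffAt ℝ ∞ φ y₀ := hφs.contDiffAt (hO.mem_nhds hy₀)
  set Ψ := hφc.toOpenPartialHomeomorph φ hφd (by simp)
  have hΨ : ∀ y, Ψ y = φ y := fun y => rfl
  set Q : Set E := O ∩ fderiv ℝ φ ⁻¹' range ((↑) : (E ≃L[ℝ] E) → E →L[ℝ] E)
  have hQ : IsOpen Q :=
    (hφs.continuousOn_fderiv_of_isOpen hO (by simp)).isOpen_inter_preimage hO
      ContinuousLinearEquiv.isOpen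
  have hsrc : (Ψ.restrOpen Q hQ).source = Ψ.source ∩ Q := Ψ.restrOpen_source Q hQ
  refine ⟨ℓ, v, Ψ.restrOpen Q hQ, hv, ?_, ?_, fun y _ => hℓφ y, ?_, ?_⟩
  · rw [hsrc]
    refine ⟨hφc.mem_toOpenPartialHomeomorph_source hφd (by simp), hy₀, ?_⟩
    exact ⟨_, hφd.fderiv.symm⟩
  · rw [hsrc]
    exact fun y hy => hy.2.1
  · rw [hsrc]
    exact hφs.mono fun y hy => hy.2.1
  · intro z hz
    have hz' := (Ψ.restrOpen Q hQ).map_target hz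
    rw [hsrc] at hz'
    obtain ⟨e', he'⟩ := hz'.2.2
    have hc : ContDiffAt ℝ ∞ φ ((Ψ.restrOpen Q hQ).symm z) :=
      hφs.contDiffAt (hO.mem_nhds hz'.2.1)
    refine ((Ψ.restrOpen Q hQ).contDiffAt_symm (f₀' := e') hz ?_ hc).contDiffWithinAt
    have := (hc.differentiableAt (by simp)).hasFDerivAt
    rw [← he'] at this
    exact this

/-- In suitable local coordinates `(t, w)` the function `S` becomes `t`. -/
lemma exists_straightening [MeasurableSpace E] [BorelSpace E] (μ : Measure E) [μ.IsAddHaarMeasure]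
    {S : E → ℝ} {O : Set E} (hO : IsOpen O) (hS : ContDiffOn ℝ ∞ S O) {y₀ : E} (hy₀ : y₀ ∈ O) (hdS : fderiv ℝ S y₀ ≠ 0) :
    ∃ (K : Submodule ℝ E) (O' : Set E), IsOpen O' ∧ y₀ ∈ O' ∧ O' ⊆ O ∧
      ∀ h : E → ℝ, ContDiff ℝ ∞ h → HasCompactSupport h → tsupport h ⊆ O' →
      ∀ β : E → ℝ, ContDiffOn ℝ ∞ β O' →
      ∃ h' β' : ℝ × K → ℝ, ContDiff ℝ ∞ h' ∧ HasCompactSupport h' ∧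
        ContDiff ℝ ∞ β' ∧ HasCompactSupport β' ∧ ∀ f : ℝ → ℝ → ℝ,
          ∫ y, f (S y) (β y) * h y ∂μ
            = ∫ z, f z.1 (β' z) * h' z ∂((volume : Measure ℝ).prod Measure.addHaar) := by
  obtain ⟨ℓ, v, Φ, hv, hy, hsO, hℓ, hΦ, hΦs⟩ :=
    exists_openPartialHomeomorph_straightening hO hS hy₀ hdS
  have hri : Function.RightInverse (ContinuousLinearMap.toSpanSingleton ℝ v) ℓ := fun t => by
    simp [hv]
  set e : E ≃L[ℝ] ℝ × ℓ.ker := ContinuousLinearEquiv.equivOfRightInverse ℓ _ hri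
  have he : ∀ x, (e x).1 = ℓ x := fun x => ContinuousLinearEquiv.fst_equivOfRightInverse _ _ hri x
  refine ⟨ℓ.ker, Φ.source, Φ.open_source, hy, hsO, fun h hh hhc hhs β hβ => ?_⟩
  set C := Φ '' tsupport h
  have hC : IsCompact C := hhc.isCompact.image_of_continuousOn (Φ.continuousOn.mono hhs)
  have hCT : C ⊆ Φ.target := by
    rintro _ ⟨y, hy, rfl⟩
    exact Φ.map_source (hhs hy)
  have hT := Φ.open_target
  have hdiff : ∀ z ∈ Φ.target, DifferentiableAt ℝ Φ.symm z := fun z hz =>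
    (hΦs.contDiffAt (hT.mem_nhds hz)).differentiableAt (by simp)
  have hdet : ∀ z ∈ Φ.target, (fderiv ℝ Φ.symm z).det ≠ 0 := by
    intro z hz h0
    have h1 : DifferentiableAt ℝ Φ (Φ.symm z) :=
      (hΦ.contDiffAt (Φ.open_source.mem_nhds (Φ.map_target hz))).differentiableAt (by simp)
    have h2 : HasFDerivAt (Φ ∘ Φ.symm) ((fderiv ℝ Φ (Φ.symm z)).comp (fderiv ℝ Φ.symm z)) z :=
      h1.hasFDerivAt.comp z (hdiff z hz).hasFDerivAt
    have h3 : HasFDerivAt (Φ ∘ Φ.symm) (ContinuousLinearMap.id ℝ E) z := by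
      refine (hasFDerivAt_id z).congr_of_eventuallyEq ?_
      filter_upwards [hT.mem_nhds hz] with y hy
      exact Φ.right_inv hy
    have h4 := congrArg (fun A : E →L[ℝ] E => A.det) (h2.unique h3)
    simp only [ContinuousLinearMap.det, ContinuousLinearMap.toLinearMap_comp,
      LinearMap.det_comp, ContinuousLinearMap.coe_id, LinearMap.det_id] at h4 h0
    rw [h0, mul_zero] at h4
    exact zero_ne_one h4
  set H : E → ℝ := fun z => |(fderiv ℝ Φ.symm z).det| * h (Φ.symm z)
  have hHs : ContDiffOn ℝ ∞ H Φ.target := by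
    refine ContDiffOn.mul (fun z hz => ContDiffAt.contDiffWithinAt ?_) (hh.comp_contDiffOn hΦs)
    have h1 : ContDiffAt ℝ ∞ (fderiv ℝ Φ.symm) z :=
      (hΦs.contDiffAt (hT.mem_nhds hz)).fderiv_right (by simp)
    exact (contDiffAt_abs (hdet z hz)).comp z
      (contDiff_continuousLinearMap_det.contDiffAt.comp z h1)
  have hH0 : ∀ z ∈ Φ.target, z ∉ C → h (Φ.symm z) = 0 := by
    intro z hz hzC
    by_contra hne
    exact hzC ⟨Φ.symm z, subset_tsupport h hne, Φ.right_inv hz⟩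
  obtain ⟨hI1, hI2⟩ := hHs.contDiff_indicator hT hC hCT
    fun z hz hzC => by simp [H, hH0 z hz hzC]
  obtain ⟨b, hb1, hb2, hb3⟩ := ContDiffOn.exists_contDiff_eqOn hT
    (hβ.comp hΦs fun z hz => Φ.map_target hz) hC hCT
  have hc := Measure.isAddLeftInvariant_eq_smul (μ.map e)
    ((volume : Measure ℝ).prod (Measure.addHaar : Measure ℓ.ker))
  set c := Measure.addHaarScalarFactor (μ.map e)
    ((volume : Measure ℝ).prod (Measure.addHaar : Measure ℓ.ker))
  refine ⟨fun x => (c : ℝ) * Φ.target.indicator H (e.symm x), fun x => b (e.symm x),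
    contDiff_const.mul (hI1.comp e.symm.contDiff),
    (hI2.comp_homeomorph e.symm.toHomeomorph).mul_left,
    hb1.comp e.symm.contDiff, hb2.comp_homeomorph e.symm.toHomeomorph, fun f => ?_⟩
  have himg : Φ.symm '' Φ.target = Φ.source := Φ.symm.image_source_eq_target
  calc ∫ y, f (S y) (β y) * h y ∂μ
      = ∫ y in Φ.source, f (S y) (β y) * h y ∂μ := by
        refine (setIntegral_eq_integral_of_forall_compl_eq_zero fun y hy => ?_).symm
        rw [image_eq_zero_of_notMem_tsupport fun h => hy (hhs h), mul_zero]
    _ = ∫ z in Φ.target, |(fderiv ℝ Φ.symm z).det| •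
          (f (S (Φ.symm z)) (β (Φ.symm z)) * h (Φ.symm z)) ∂μ := by
        rw [← himg]
        exact integral_image_eq_integral_abs_det_fderiv_smul μ hT.measurableSet
          (fun z hz => (hdiff z hz).hasFDerivAt.hasFDerivWithinAt) Φ.symm.injOn _
    _ = ∫ z in Φ.target, f (ℓ z) (b z) * Φ.target.indicator H z ∂μ := by
        refine setIntegral_congr_fun hT.measurableSet fun z hz => ?_
        simp only [indicator_of_mem hz, H]
        by_cases hzC : z ∈ C
        · rw [hb3 hzC, ← hℓ _ (Φ.map_target hz), Φ.right_inv hz, Function.comp_apply, smul_eq_mul]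
          ring
        · simp [hH0 z hz hzC]
    _ = ∫ z, f (ℓ z) (b z) * Φ.target.indicator H z ∂μ := by
        refine setIntegral_eq_integral_of_forall_compl_eq_zero fun y hy => ?_
        rw [indicator_of_notMem hy, mul_zero]
    _ = ∫ x, f x.1 (b (e.symm x)) * Φ.target.indicator H (e.symm x) ∂(μ.map e) := by
        have h1 := e.toHomeomorph.measurableEmbedding.integral_map (μ := μ)
          fun x => f x.1 (b (e.symm x)) * Φ.target.indicator H (e.symm x)
        simp only [ContinuousLinearEquiv.coe_toHomeomorph] at h1
        rw [h1]
        simp only [he, ContinuousLinearEquiv.symm_apply_apply]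
    _ = _ := by
        rw [hc, integral_smul_nnreal_measure, NNReal.smul_def, smul_eq_mul, ← integral_const_mul]
        refine integral_congr_ae (ae_of_all _ fun x => ?_)
        simp only
        ring


/-! ### Local integrals over superlevel sets -/

variable {P : Type*} [NormedAddCommGroup P] [NormedSpace ℝ P] {F : Type*} [NormedAddCommGroup F]
  [NormedSpace ℝ F] [MeasurableSpace F] [BorelSpace F]

lemma contDiff_integral_of_compact_support (μ : Measure F) [IsLocallyFiniteMeasure μ]
    {g : P → F → ℝ} (hg : ContDiff ℝ ∞ (Function.uncurry g)) {k : Set F} (hk : IsCompact k)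
    (hgk : ∀ p x, x ∉ k → g p x = 0) : ContDiff ℝ ∞ fun p => ∫ x, g p x ∂μ := by
  have h := contDiffOn_convolution_right_with_param (𝕜 := ℝ) (μ := μ) (n := ⊤)
    (ContinuousLinearMap.mul ℝ ℝ) (f := fun _ : F => (1 : ℝ)) (g := fun p x => g p (-x))
    (s := univ) (k := -k) isOpen_univ hk.neg
    (fun p x _ hx => hgk p (-x) fun h => hx (by simpa using h))
    (continuous_const.locallyIntegrable)
    (by
      refine ContDiff.contDiffOn ?_
      exact hg.comp (contDiff_fst.prodMk contDiff_snd.neg))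
  rw [univ_prod_univ, contDiffOn_univ] at h
  have h2 := h.comp (contDiff_id.prodMk (contDiff_const (c := (0 : F))))
  have h3 : (fun p => ∫ x, g p x ∂μ) = (fun q : P × F => convolution (fun _ : F => (1 : ℝ))
      (fun x => g q.1 (-x)) (ContinuousLinearMap.mul ℝ ℝ) μ q.2) ∘ fun x => (id x, 0) := by
    ext p
    simp [convolution]
  rw [h3]
  exact h2

variable [FiniteDimensional ℝ F]

lemma integral_prod_comp_mul_left (μ : Measure F) [SFinite μ] {δ : ℝ} (hδ : 0 < δ)
    (k : ℝ × F → ℝ) :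
    ∫ z, k z ∂((volume : Measure ℝ).prod μ)
      = δ * ∫ z, k (δ * z.1, z.2) ∂((volume : Measure ℝ).prod μ) := by
  have h1 : ((volume : Measure ℝ).prod μ).map (Prod.map (δ * ·) id)
      = ENNReal.ofReal |δ⁻¹| • (volume : Measure ℝ).prod μ := by
    rw [← Measure.map_prod_map _ _ (measurable_const_mul δ) measurable_id,
      Real.map_volume_mul_left hδ.ne', Measure.map_id, Measure.prod_smul_left]
  have h2 := ((Homeomorph.mulLeft₀ δ hδ.ne').prodCongr
    (Homeomorph.refl F)).measurableEmbedding.integral_map (μ := (volume : Measure ℝ).prod μ) k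
  have h3 : ⇑((Homeomorph.mulLeft₀ δ hδ.ne').prodCongr (Homeomorph.refl F))
      = Prod.map (δ * ·) id := rfl
  rw [h3, h1, integral_smul_measure, ENNReal.toReal_ofReal (abs_nonneg _),
    abs_of_pos (inv_pos.2 hδ)] at h2
  change _ = δ * ∫ z, k (Prod.map (δ * ·) id z) ∂_
  rw [← h2, smul_eq_mul, mul_inv_cancel_left₀ hδ.ne']

lemma exists_integral_fst_mul (μ : Measure F) [SFinite μ] [IsLocallyFiniteMeasure μ]
    {h : ℝ × F → ℝ} (hh : ContDiff ℝ ∞ h) (hc : HasCompactSupport h) :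
    ∃ p : ℝ → ℝ, ContDiff ℝ ∞ p ∧ HasCompactSupport p ∧
      ∀ f : ℝ → ℝ, Measurable f → (∃ C, ∀ t, ‖f t‖ ≤ C) →
        ∫ z, f z.1 * h z ∂((volume : Measure ℝ).prod μ) = ∫ t, f t * p t := by
  refine ⟨fun t => ∫ w, h (t, w) ∂μ, ?_, ?_, fun f hf hfb => ?_⟩
  · refine contDiff_integral_of_compact_support μ (g := fun t w => h (t, w)) hh
      (hc.isCompact.image continuous_snd) fun t w hw => ?_
    exact image_eq_zero_of_notMem_tsupport fun h' => hw ⟨_, h', rfl⟩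
  · refine HasCompactSupport.intro (hc.isCompact.image continuous_fst) fun t ht => ?_
    have : ∀ w, h (t, w) = 0 := fun w =>
      image_eq_zero_of_notMem_tsupport fun h' => ht ⟨_, h', rfl⟩
    simp [this]
  · obtain ⟨C, hC⟩ := hfb
    have hi : Integrable (fun z : ℝ × F => f z.1 * h z) ((volume : Measure ℝ).prod μ) :=
      (hh.continuous.integrable_of_hasCompactSupport hc).bdd_mul
        (hf.comp measurable_fst).aestronglyMeasurable (ae_of_all _ fun z => hC z.1)
    rw [integral_prod _ hi]
    simp only [integral_const_mul]

/-- A smooth cutoff function: `0` on `x ≤ 1`, `1` on `x ≥ 2`. -/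
def smoothCutoff (x : ℝ) : ℝ := Real.smoothTransition (x - 1)

lemma smoothCutoff_contDiff : ContDiff ℝ ∞ smoothCutoff :=
  Real.smoothTransition.contDiff.comp (contDiff_id.sub contDiff_const)

lemma smoothCutoff_of_le {x : ℝ} (h : x ≤ 1) : smoothCutoff x = 0 :=
  Real.smoothTransition.zero_of_nonpos (by linarith)

lemma smoothCutoff_of_ge {x : ℝ} (h : 2 ≤ x) : smoothCutoff x = 1 :=
  Real.smoothTransition.one_of_one_le (by linarith)

lemma exists_contDiff_eq_rpow {b : ℝ} (hb : 0 < b) (a : ℝ) :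
    ∃ η : ℝ → ℝ, ContDiff ℝ ∞ η ∧ ∀ q, b ≤ q → η q = q ^ a := by
  refine ⟨fun q => smoothCutoff (2 / b * q) * q ^ a, contDiff_iff_contDiffAt.2 fun q => ?_,
    fun q hq => ?_⟩
  · rcases lt_or_ge 0 q with h | h
    · exact (smoothCutoff_contDiff.comp (contDiff_const.mul contDiff_id)).contDiffAt.mul
        (Real.contDiffAt_rpow_const_of_ne h.ne')
    · refine (contDiffAt_const (c := (0 : ℝ))).congr_of_eventuallyEq ?_
      filter_upwards [Iio_mem_nhds (show q < b / 2 by linarith)] with x hx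
      rw [smoothCutoff_of_le, zero_mul]
      have : x < b / 2 := hx
      rw [div_mul_eq_mul_div, div_le_one hb]
      linarith
  · simp only
    rw [smoothCutoff_of_ge, one_mul]
    rw [div_mul_eq_mul_div, le_div_iff₀ hb]
    linarith

/-- Changing the defining function `t` to `t e^β` changes the regularized integral of `t^{-ν-1} h`
by `δ^{-ν}` times a smooth function of the parameter `δ`. -/
lemma exists_contDiff_cutoff_difference (μ : Measure F) [SFinite μ] [IsLocallyFiniteMeasure μ]
    {h β : ℝ × F → ℝ} (hh : ContDiff ℝ ∞ h) (hc : HasCompactSupport h) (hβ : ContDiff ℝ ∞ β)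
    (hβc : HasCompactSupport β) (ν : ℝ) :
    ∃ G : ℝ → ℝ, ContDiff ℝ ∞ G ∧ ∀ δ > 0,
      ∫ z, (smoothCutoff (z.1 * Real.exp (β z) / δ) - smoothCutoff (z.1 / δ)) * z.1 ^ (-ν - 1)
        * h z ∂((volume : Measure ℝ).prod μ) = δ ^ (-ν) * G δ := by
  obtain ⟨C, hC⟩ := hβc.exists_bound_of_continuous hβ.continuous
  have hC0 : 0 ≤ C := (norm_nonneg _).trans (hC 0)
  have hC1 : ∀ z, -C ≤ β z := fun z => (abs_le.1 (hC z)).1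
  have hC2 : ∀ z, β z ≤ C := fun z => (abs_le.1 (hC z)).2
  obtain ⟨η, hη, hηe⟩ := exists_contDiff_eq_rpow (Real.exp_pos (-C)) (-ν - 1)
  set g : ℝ → ℝ × F → ℝ := fun δ z =>
    (smoothCutoff (z.1 * Real.exp (β (δ * z.1, z.2))) - smoothCutoff z.1) * η z.1
      * h (δ * z.1, z.2)
  have hsmall : ∀ (q b : ℝ), b ≤ C → q < Real.exp (-C) → q * Real.exp b ≤ 1 := by
    intro q b hb hq
    calc q * Real.exp b ≤ Real.exp (-C) * Real.exp b :=
          mul_le_mul_of_nonneg_right hq.le (Real.exp_pos b).le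
      _ ≤ Real.exp (-C) * Real.exp C :=
          mul_le_mul_of_nonneg_left (Real.exp_le_exp.2 hb) (Real.exp_pos _).le
      _ = 1 := by rw [← Real.exp_add]; simp
  have hexp1 : Real.exp (-C) ≤ 1 := Real.exp_le_one_iff.2 (by linarith)
  have hzero : ∀ (q b : ℝ), b ≤ C → q < Real.exp (-C) →
      smoothCutoff (q * Real.exp b) - smoothCutoff q = 0 := fun q b hb hq => by
    rw [smoothCutoff_of_le (hsmall q b hb hq), smoothCutoff_of_le (by linarith), sub_zero]
  have hgs : ContDiff ℝ ∞ (Function.uncurry g) := by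
    have hT : ContDiff ℝ ∞ fun x : ℝ × (ℝ × F) => ((x.1 * x.2.1, x.2.2) : ℝ × F) :=
      (contDiff_fst.mul (contDiff_fst.comp contDiff_snd)).prodMk (contDiff_snd.comp contDiff_snd)
    have hq : ContDiff ℝ ∞ fun x : ℝ × (ℝ × F) => x.2.1 := contDiff_fst.comp contDiff_snd
    exact (((smoothCutoff_contDiff.comp (hq.mul (Real.contDiff_exp.comp (hβ.comp hT)))).sub
      (smoothCutoff_contDiff.comp hq)).mul (hη.comp hq)).mul (hh.comp hT)
  have hgk : ∀ (δ : ℝ) (z : ℝ × F),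
      z ∉ Icc (Real.exp (-C)) (2 * Real.exp C) ×ˢ (Prod.snd '' tsupport h) →
      g δ z = 0 := by
    intro δ z hz
    by_cases h1 : (δ * z.1, z.2) ∈ tsupport h
    · have h2 : z.1 ∉ Icc (Real.exp (-C)) (2 * Real.exp C) := fun h' =>
        hz ⟨h', _, h1, rfl⟩
      rw [mem_Icc, not_and_or, not_le, not_le] at h2
      rcases h2 with h2 | h2
      · simp only [g, hzero _ _ (hC2 _) h2, zero_mul]
      · have h3 : (1 : ℝ) ≤ Real.exp C := Real.one_le_exp hC0
        have h4 : 2 ≤ z.1 * Real.exp (β (δ * z.1, z.2)) := by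
          calc (2 : ℝ) = 2 * Real.exp C * Real.exp (-C) := by
                rw [mul_assoc, ← Real.exp_add]; simp
            _ ≤ z.1 * Real.exp (β (δ * z.1, z.2)) :=
                mul_le_mul h2.le (Real.exp_le_exp.2 (hC1 _)) (Real.exp_pos _).le (by linarith)
        simp only [g]
        rw [smoothCutoff_of_ge h4, smoothCutoff_of_ge (by linarith)]
        simp
    · simp only [g, image_eq_zero_of_notMem_tsupport h1, mul_zero]
  have hG : ContDiff ℝ ∞ fun δ => ∫ z, g δ z ∂((volume : Measure ℝ).prod μ) :=
    contDiff_integral_of_compact_support _ hgs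
      (isCompact_Icc.prod (hc.isCompact.image continuous_snd)) hgk
  refine ⟨_, hG, fun δ hδ => ?_⟩
  rw [integral_prod_comp_mul_left μ hδ, show (-ν) = 1 + (-ν - 1) by ring, Real.rpow_add hδ,
    Real.rpow_one, mul_assoc]
  congr 1
  rw [← integral_const_mul]
  refine integral_congr_ae (ae_of_all _ fun z => ?_)
  simp only [g]
  rw [show δ * z.1 * Real.exp (β (δ * z.1, z.2)) / δ = z.1 * Real.exp (β (δ * z.1, z.2)) by
    field_simp, mul_div_cancel_left₀ _ hδ.ne']
  rcases lt_or_ge z.1 (Real.exp (-C)) with h1 | h1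
  · rw [hzero _ _ (hC2 _) h1]
    simp
  · rw [hηe _ h1, Real.mul_rpow hδ.le ((Real.exp_pos _).le.trans h1),
      show 1 + (-ν - 1) - 1 = -ν - 1 by ring]
    ring

variable [MeasurableSpace E] [BorelSpace E]

/-- Locally, the push-forward of a smooth compactly supported density under a function without
critical points has a smooth density. -/
lemma exists_local_pushforward_density (μ : Measure E) [μ.IsAddHaarMeasure]
    {S : E → ℝ} {O : Set E} (hO : IsOpen O) (hS : ContDiffOn ℝ ∞ S O) {y₀ : E} (hy₀ : y₀ ∈ O) (hdS : fderiv ℝ S y₀ ≠ 0) :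
    ∃ O' : Set E, IsOpen O' ∧ y₀ ∈ O' ∧ O' ⊆ O ∧
      ∀ h : E → ℝ, ContDiff ℝ ∞ h → HasCompactSupport h → tsupport h ⊆ O' →
      ∃ p : ℝ → ℝ, ContDiff ℝ ∞ p ∧ HasCompactSupport p ∧
        ∀ f : ℝ → ℝ, Measurable f → (∃ C, ∀ t, ‖f t‖ ≤ C) →
          ∫ y, f (S y) * h y ∂μ = ∫ t, f t * p t := by
  obtain ⟨K, O', h1, h2, h3, H⟩ := exists_straightening μ hO hS hy₀ hdS
  refine ⟨O', h1, h2, h3, fun h hh hhc hhs => ?_⟩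
  obtain ⟨h', β', hh', hc', -, -, hf⟩ := H h hh hhc hhs (fun _ => 0) contDiffOn_const
  obtain ⟨p, hp, hpc, hpf⟩ := exists_integral_fst_mul Measure.addHaar hh' hc'
  exact ⟨p, hp, hpc, fun f hfm hfb => (hf fun t _ => f t).trans (hpf f hfm hfb)⟩

/-- The local form of `exists_contDiff_cutoff_difference`. -/
lemma exists_local_cutoff_difference (μ : Measure E) [μ.IsAddHaarMeasure]
    {S : E → ℝ} {O : Set E} (hO : IsOpen O) (hS : ContDiffOn ℝ ∞ S O) {y₀ : E} (hy₀ : y₀ ∈ O) (hdS : fderiv ℝ S y₀ ≠ 0)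
    (ν : ℝ) :
    ∃ O' : Set E, IsOpen O' ∧ y₀ ∈ O' ∧ O' ⊆ O ∧
      ∀ h : E → ℝ, ContDiff ℝ ∞ h → HasCompactSupport h → tsupport h ⊆ O' →
      ∀ β : E → ℝ, ContDiffOn ℝ ∞ β O' →
      ∃ G : ℝ → ℝ, ContDiff ℝ ∞ G ∧ ∀ δ > 0,
        ∫ y, (smoothCutoff (S y * Real.exp (β y) / δ) - smoothCutoff (S y / δ))
          * S y ^ (-ν - 1) * h y ∂μ = δ ^ (-ν) * G δ := by
  obtain ⟨K, O', h1, h2, h3, H⟩ := exists_straightening μ hO hS hy₀ hdS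
  refine ⟨O', h1, h2, h3, fun h hh hhc hhs β hβ => ?_⟩
  obtain ⟨h', β', hh', hc', hβ', hβc', hf⟩ := H h hh hhc hhs β hβ
  obtain ⟨G, hG, hGe⟩ := exists_contDiff_cutoff_difference Measure.addHaar hh' hc' hβ' hβc' ν
  exact ⟨G, hG, fun δ hδ => (hf fun t b => (smoothCutoff (t * Real.exp b / δ)
    - smoothCutoff (t / δ)) * t ^ (-ν - 1)).trans (hGe δ hδ)⟩

end Straightening

section FrameChange

variable {n : ℕ} {N : Type*} [TopologicalSpace N] [ChartedSpace (ModelE n) N]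
  [IsManifold 𝓘(ℝ, ModelE n) ∞ N]

/-! ### Change of coordinate frames -/

/-- The Jacobian determinant at `y` of the transition from the chart at `c` to the chart at `c'`. -/
def chartJacobian (n : ℕ) {N : Type*} [TopologicalSpace N] [ChartedSpace (ModelE n) N]
    [IsManifold 𝓘(ℝ, ModelE n) ∞ N] (c c' y : N) : ℝ :=
  ContinuousLinearMap.det (tangentCoordChange 𝓘(ℝ, ModelE n) c c' y : ModelE n →L[ℝ] ModelE n)

/-- The coordinate frame as a basis of the tangent space. -/
def coordBasis {c y : N} (hy : y ∈ (chartAt (ModelE n) c).source) :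
    Module.Basis (Fin (n + 1)) ℝ (TangentSpace 𝓘(ℝ, ModelE n) y) :=
  (EuclideanSpace.basisFun (Fin (n + 1)) ℝ).toBasis.map
    ((trivializationAt (ModelE n) (TangentSpace 𝓘(ℝ, ModelE n)) c).continuousLinearEquivAt
      ℝ y (by simpa using hy)).symm.toLinearEquiv

lemma coordBasis_apply {c y : N} (hy : y ∈ (chartAt (ModelE n) c).source) (i : Fin (n + 1)) :
    coordBasis hy i = coordFrame (n := n) c y i := by
  simp only [coordBasis, coordFrame, coordField, Module.Basis.map_apply,
    OrthonormalBasis.coe_toBasis, EuclideanSpace.basisFun_apply]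
  exact congrFun (Trivialization.symm_continuousLinearEquivAt_eq _ _) _

lemma linearIndependent_coordFrame {c y : N} (hy : y ∈ (chartAt (ModelE n) c).source) :
    LinearIndependent ℝ (coordFrame (n := n) c y) := by
  rw [← funext (coordBasis_apply hy)]
  exact (coordBasis hy).linearIndependent

lemma coordFrame_self (c : N) (i : Fin (n + 1)) :
    coordFrame (n := n) c c i = (EuclideanSpace.single i 1 : ModelE n) := by
  change (_ : ModelE n) = _
  rw [coordFrame, coordField,
    TangentBundle.symmL_trivializationAt_eq_core (mem_chart_source (ModelE n) c)]
  exact tangentCoordChange_self (by rw [extChartAt_source]; exact mem_chart_source _ c)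

lemma exists_linearMap_coordFrame {c c' y : N} (hy : y ∈ (chartAt (ModelE n) c).source)
    (hy' : y ∈ (chartAt (ModelE n) c').source) :
    ∃ B : TangentSpace 𝓘(ℝ, ModelE n) y →ₗ[ℝ] TangentSpace 𝓘(ℝ, ModelE n) y,
      (∀ i, B (coordFrame (n := n) c' y i) = coordFrame (n := n) c y i) ∧
        LinearMap.det B = chartJacobian n c c' y := by
  set t := trivializationAt (ModelE n) (TangentSpace 𝓘(ℝ, ModelE n) (M := N)) c
  set t' := trivializationAt (ModelE n) (TangentSpace 𝓘(ℝ, ModelE n) (M := N)) c'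
  have hb : y ∈ t'.baseSet := by simpa [t'] using hy'
  refine ⟨((t.symmL ℝ y) ∘L (t'.continuousLinearMapAt ℝ y)).toLinearMap, fun i => ?_, ?_⟩
  · simp only [coordFrame, coordField, ContinuousLinearMap.coe_coe, ContinuousLinearMap.comp_apply]
    rw [t'.continuousLinearMapAt_symmL hb]
  · rw [← LinearMap.det_conj _ (t'.continuousLinearEquivAt ℝ y hb).toLinearEquiv, chartJacobian,
      ContinuousLinearMap.det]
    congr 1
    ext1 v
    have h1 : t'.continuousLinearMapAt ℝ y (t.symmL ℝ y v)
        = tangentCoordChange 𝓘(ℝ, ModelE n) c c' y v := by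
      rw [TangentBundle.symmL_trivializationAt_eq_core hy,
        TangentBundle.continuousLinearMapAt_trivializationAt_eq_core hy']
      exact tangentCoordChange_comp (by simp [hy, hy'])
    rw [ContinuousLinearMap.coe_coe, ← h1]
    have h2 := congrFun (t'.coe_continuousLinearEquivAt_eq (R := ℝ) hb)
    have h3 := congrFun (t'.symm_continuousLinearEquivAt_eq (R := ℝ) hb)
    change t'.continuousLinearEquivAt ℝ y hb (t.symmL ℝ y (t'.continuousLinearMapAt ℝ y
      ((t'.continuousLinearEquivAt ℝ y hb).symm v))) = _
    rw [h2, h3, t'.continuousLinearMapAt_symmL hb]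

lemma chartJacobian_ne_zero {c c' y : N} (hy : y ∈ (chartAt (ModelE n) c).source)
    (hy' : y ∈ (chartAt (ModelE n) c').source) : chartJacobian n c c' y ≠ 0 := by
  obtain ⟨B, hB, hdet⟩ := exists_linearMap_coordFrame hy hy'
  rw [← hdet]
  obtain ⟨B', hB', -⟩ := exists_linearMap_coordFrame hy' hy
  have h : B ∘ₗ B' = LinearMap.id := by
    refine (coordBasis hy).ext fun i => ?_
    rw [LinearMap.comp_apply, coordBasis_apply, hB', hB, LinearMap.id_apply]
  intro h0
  have h1 := congrArg LinearMap.det h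
  rw [LinearMap.det_comp, h0, zero_mul, LinearMap.det_id] at h1
  exact zero_ne_one h1

namespace ProjDensity

variable {w : ℝ}

lemma rep_change (f : ProjDensity n N w) {c c' y : N} (hy : y ∈ (chartAt (ModelE n) c).source)
    (hy' : y ∈ (chartAt (ModelE n) c').source) :
    f.rep c y = |chartJacobian n c c' y| ^ (-w / ((n : ℝ) + 2)) * f.rep c' y := by
  obtain ⟨B, hB, hdet⟩ := exists_linearMap_coordFrame hy hy'
  have h0 := chartJacobian_ne_zero hy hy'
  rw [← hdet] at h0 ⊢
  rw [rep, rep, ← f.map_frame y _ B (linearIndependent_coordFrame hy') h0]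
  simp only [hB]

lemma val_eq_rep (f : ProjDensity n N w) {c y : N} (hy : y ∈ (chartAt (ModelE n) c).source) :
    f.val y = |chartJacobian n y c y| ^ (-w / ((n : ℝ) + 2)) * f.rep c y :=
  f.rep_change (mem_chart_source _ y) hy

end ProjDensity

lemma IsProjectiveScale.rep_pos {σ : ProjDensity n N 1} (hσ : IsProjectiveScale σ) {c y : N}
    (hy : y ∈ (chartAt (ModelE n) c).source) : 0 < σ.rep c y :=
  hσ.2 y _ (linearIndependent_coordFrame hy)

lemma IsProjectiveScale.val_pos {σ : ProjDensity n N 1} (hσ : IsProjectiveScale σ) (y : N) :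
    0 < σ.val y :=
  hσ.rep_pos (mem_chart_source _ y)

lemma IsProjectiveScale.inv_pow_rep_change {σ : ProjDensity n N 1} {c c' y : N}
    (hy : y ∈ (chartAt (ModelE n) c).source)
    (hy' : y ∈ (chartAt (ModelE n) c').source) :
    (σ.rep c y ^ (n + 2))⁻¹ = |chartJacobian n c c' y| * (σ.rep c' y ^ (n + 2))⁻¹ := by
  rw [σ.rep_change hy hy', mul_pow, mul_inv, ← Real.rpow_natCast, ← Real.rpow_mul (abs_nonneg _),
    ← Real.rpow_neg (abs_nonneg _)]
  have : -(-1 / ((n : ℝ) + 2) * ((n + 2 : ℕ) : ℝ)) = 1 := by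
    push_cast
    field_simp
  rw [this, Real.rpow_one]

lemma volDensity_change
    (g : (x : N) → TangentSpace 𝓘(ℝ, ModelE n) x →L[ℝ] TangentSpace 𝓘(ℝ, ModelE n) x →L[ℝ] ℝ)
    {c c' y : N} (hy : y ∈ (chartAt (ModelE n) c).source)
    (hy' : y ∈ (chartAt (ModelE n) c').source) :
    volDensity g c y = |chartJacobian n c c' y| * volDensity g c' y := by
  obtain ⟨B, hB, hdet⟩ := exists_linearMap_coordFrame hy hy'
  set b := coordBasis (n := n) hy'
  set M : Matrix (Fin (n + 1)) (Fin (n + 1)) ℝ := LinearMap.toMatrix b b B with hM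
  have hBM : ∀ i, coordFrame (n := n) c y i = ∑ k, M k i • coordFrame (n := n) c' y k := by
    intro i
    rw [← hB i, ← coordBasis_apply hy', ← b.sum_repr (B (b i))]
    refine Finset.sum_congr rfl fun k _ => ?_
    rw [hM, LinearMap.toMatrix_apply, coordBasis_apply hy', coordBasis_apply hy']
  have hG : (Matrix.of fun i j => g y (coordFrame c y i) (coordFrame c y j))
      = M.transpose * (Matrix.of fun i j => g y (coordFrame c' y i) (coordFrame c' y j)) * M := by
    ext i j
    simp only [Matrix.of_apply, Matrix.mul_apply, Matrix.transpose_apply, hBM i, hBM j, map_sum,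
      map_smul, sum_apply, smul_apply, smul_eq_mul,
      Finset.sum_mul, Finset.mul_sum]
    refine Finset.sum_congr rfl fun k _ => Finset.sum_congr rfl fun l _ => ?_
    ring
  rw [volDensity, volDensity, hG, Matrix.det_mul, Matrix.det_mul, Matrix.det_transpose,
    LinearMap.det_toMatrix, hdet, mul_right_comm, Real.sqrt_mul (mul_self_nonneg _),
    Real.sqrt_mul_self_eq_abs]

/-! ### The Monge–Ampère operator and the Blaschke volume -/

lemma mongeAmpere_eq (D : AffineConn n N) (r : ProjDensity n N 2) {x : N} (hx : r.val x ≠ 0) :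
    mongeAmpere D r x = -(-2 * r.val x) ^ (n + 2) *
      (Matrix.of fun i j : Fin (n + 1) =>
        blaschke D r x (EuclideanSpace.single i 1) (EuclideanSpace.single j 1)).det := by
  set ρ := r.val x
  let _ : Invertible (Matrix.of fun _ _ : Unit => 2 * ρ) :=
    ⟨Matrix.of fun _ _ => (2 * ρ)⁻¹,
      by ext i j; simp [Matrix.mul_apply]; field_simp,
      by ext i j; simp [Matrix.mul_apply]; field_simp⟩
  rw [mongeAmpere, tractorHess, Matrix.det_fromBlocks₁₁]
  have h1 : (Matrix.of fun _ _ : Unit => 2 * ρ).det = 2 * ρ := by simp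
  have h2 : (⅟(Matrix.of fun _ _ : Unit => 2 * ρ)) = Matrix.of fun _ _ : Unit => (2 * ρ)⁻¹ := rfl
  rw [h1, h2]
  have h3 : ∀ A : Matrix (Fin (n + 1)) (Fin (n + 1)) ℝ,
      2 * ρ * ((-2 * ρ) • A).det = -(-2 * ρ) ^ (n + 2) * A.det := by
    intro A
    rw [Matrix.det_smul, Fintype.card_fin]
    ring
  rw [← h3]
  congr 2
  ext i j
  simp only [Matrix.sub_apply, Matrix.of_apply, Matrix.mul_apply, Finset.univ_unique,
    Finset.sum_singleton, Matrix.smul_apply, smul_eq_mul, blaschke]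
  change _ = -2 * ρ * (_ / (-2 * ρ) + _ / (4 * ρ ^ 2) - _)
  field_simp
  ring

/-! ### Defining functions -/

/-- The function `τ^{-2} (-2 r)`, which is positive where `r < 0`. -/
def scaledDefining (r : ProjDensity n N 2) (τ : ProjDensity n N 1) (x : N) : ℝ :=
  -2 * r.val x / τ.val x ^ 2

lemma scaledDefining_eq_rep (r : ProjDensity n N 2) (τ : ProjDensity n N 1) {c y : N}
    (hy : y ∈ (chartAt (ModelE n) c).source) :
    scaledDefining r τ y = -2 * r.rep c y / τ.rep c y ^ 2 := by
  have h0 := abs_pos.2 (chartJacobian_ne_zero (mem_chart_source (ModelE n) y) hy)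
  rw [scaledDefining, r.val_eq_rep hy, τ.val_eq_rep hy, mul_pow, ← Real.rpow_natCast,
    ← Real.rpow_mul h0.le, show (-1 / ((n : ℝ) + 2) * ((2 : ℕ) : ℝ)) = -2 / ((n : ℝ) + 2) by
      push_cast; ring]
  have := (Real.rpow_pos_of_pos h0 (-2 / ((n : ℝ) + 2))).ne'
  rw [mul_left_comm, mul_div_mul_left _ _ this]

/-- The logarithm of `σ² / τ²`. -/
def logScaleRatio (σ τ : ProjDensity n N 1) (x : N) : ℝ := 2 * Real.log (σ.val x / τ.val x)

lemma scaledDefining_eq_mul_exp (r : ProjDensity n N 2) {σ τ : ProjDensity n N 1}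
    (hσ : IsProjectiveScale σ) (hτ : IsProjectiveScale τ) (x : N) :
    scaledDefining r τ x = scaledDefining r σ x * Real.exp (logScaleRatio σ τ x) := by
  have h1 := hσ.val_pos x
  have h2 := hτ.val_pos x
  rw [scaledDefining, scaledDefining, logScaleRatio, mul_comm 2, Real.exp_mul,
    Real.exp_log (div_pos h1 h2), Real.rpow_two, div_pow]
  field_simp

lemma logScaleRatio_eq_rep (σ τ : ProjDensity n N 1) {c y : N}
    (hy : y ∈ (chartAt (ModelE n) c).source) :
    logScaleRatio σ τ y = 2 * Real.log (σ.rep c y / τ.rep c y) := by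
  have h0 := abs_pos.2 (chartJacobian_ne_zero (mem_chart_source (ModelE n) y) hy)
  rw [logScaleRatio, σ.val_eq_rep hy, τ.val_eq_rep hy,
    mul_div_mul_left _ _ (Real.rpow_pos_of_pos h0 _).ne']

omit [IsManifold 𝓘(ℝ, ModelE n) ∞ N] in
lemma contMDiff_of_eq_on_charts {f : N → ℝ} (F : N → N → ℝ)
    (hF : ∀ c, ContMDiffOn 𝓘(ℝ, ModelE n) 𝓘(ℝ, ℝ) ∞ (F c) (chartAt (ModelE n) c).source)
    (hfF : ∀ c, ∀ y ∈ (chartAt (ModelE n) c).source, f y = F c y) :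
    ContMDiff 𝓘(ℝ, ModelE n) 𝓘(ℝ, ℝ) ∞ f := by
  intro c
  have hs := (chartAt (ModelE n) c).open_source.mem_nhds (mem_chart_source (ModelE n) c)
  refine ((hF c).contMDiffAt hs).congr_of_eventuallyEq ?_
  filter_upwards [hs] with y hy
  exact hfF c y hy

lemma contMDiff_scaledDefining {r : ProjDensity n N 2} (hr : r.SmoothOn univ)
    {τ : ProjDensity n N 1} (hτ : IsProjectiveScale τ) :
    ContMDiff 𝓘(ℝ, ModelE n) 𝓘(ℝ, ℝ) ∞ (scaledDefining r τ) := by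
  refine contMDiff_of_eq_on_charts (fun c y => -2 * r.rep c y / τ.rep c y ^ 2) (fun c => ?_)
    fun c y hy => scaledDefining_eq_rep r τ hy
  have h1 := hr c
  have h2 := hτ.1 c
  rw [univ_inter] at h1 h2
  exact (contMDiffOn_const.mul h1).div₀ (h2.pow 2) fun y hy => (pow_pos (hτ.rep_pos hy) 2).ne'

lemma contMDiff_logScaleRatio {σ τ : ProjDensity n N 1} (hσ : IsProjectiveScale σ)
    (hτ : IsProjectiveScale τ) :
    ContMDiff 𝓘(ℝ, ModelE n) 𝓘(ℝ, ℝ) ∞ (logScaleRatio σ τ) := by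
  refine contMDiff_of_eq_on_charts (fun c y => 2 * Real.log (σ.rep c y / τ.rep c y)) (fun c => ?_)
    fun c y hy => logScaleRatio_eq_rep σ τ hy
  have h1 := hσ.1 c
  have h2 := hτ.1 c
  rw [univ_inter] at h1 h2
  refine contMDiffOn_const.mul fun y hy => ?_
  have h3 : ContMDiffWithinAt 𝓘(ℝ, ModelE n) 𝓘(ℝ, ℝ) ∞ (fun y => σ.rep c y / τ.rep c y)
      (chartAt (ModelE n) c).source y :=
    (h1.div₀ h2 fun y hy => (hτ.rep_pos hy).ne') y hy
  have h4 : ContMDiffAt 𝓘(ℝ, ℝ) 𝓘(ℝ, ℝ) ∞ Real.log (σ.rep c y / τ.rep c y) :=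
    (Real.contDiffAt_log.2 (div_pos (hσ.rep_pos hy) (hτ.rep_pos hy)).ne').contMDiffAt
  exact h4.comp_contMDiffWithinAt y h3

lemma contDiffOn_comp_chart_symm {f : N → ℝ} {c : N}
    (hf : ContMDiffOn 𝓘(ℝ, ModelE n) 𝓘(ℝ, ℝ) ∞ f (chartAt (ModelE n) c).source) :
    ContDiffOn ℝ ∞ (f ∘ (chartAt (ModelE n) c).symm) (chartAt (ModelE n) c).target := by
  rw [← contMDiffOn_iff_contDiffOn]
  exact hf.comp contMDiffOn_chart_symm fun z hz => (chartAt (ModelE n) c).map_target hz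

lemma fderiv_scaledDefining_ne_zero {r : ProjDensity n N 2} (hr : r.SmoothOn univ)
    {τ : ProjDensity n N 1} (hτ : IsProjectiveScale τ) {x : N} (hx : scaledDefining r τ x = 0)
    (hd : mvfderiv 𝓘(ℝ, ModelE n) (r.rep x) x ≠ 0) :
    fderiv ℝ (scaledDefining r τ ∘ (chartAt (ModelE n) x).symm) (chartAt (ModelE n) x x) ≠ 0 := by
  set φ := chartAt (ModelE n) x
  have hxφ : x ∈ φ.source := mem_chart_source _ x
  have h1 := hr x
  have h2 := hτ.1 x
  rw [univ_inter] at h1 h2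
  have hR := contDiffOn_comp_chart_symm h1
  have hT := contDiffOn_comp_chart_symm h2
  have hS := contDiffOn_comp_chart_symm (contMDiff_scaledDefining hr hτ).contMDiffOn (c := x)
  have hz := φ.open_target.mem_nhds (φ.map_source hxφ)
  have hTd := ((hT.contDiffAt hz).differentiableAt (by simp)).hasFDerivAt
  have hSd := ((hS.contDiffAt hz).differentiableAt (by simp)).hasFDerivAt
  intro h0
  rw [h0] at hSd
  have hRS : (r.rep x ∘ φ.symm) =ᶠ[𝓝 (φ x)]
      fun z => -(1 / 2) * ((scaledDefining r τ ∘ φ.symm) z * (τ.rep x ∘ φ.symm) z ^ 2) := by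
    filter_upwards [hz] with z hz
    have := (hτ.rep_pos (φ.map_target hz)).ne'
    simp only [Function.comp_apply]
    rw [scaledDefining_eq_rep r τ (φ.map_target hz)]
    field_simp
  have hRd : HasFDerivAt (r.rep x ∘ φ.symm) (0 : ModelE n →L[ℝ] ℝ) (φ x) := by
    refine HasFDerivAt.congr_of_eventuallyEq ?_ hRS
    have h3 : scaledDefining r τ (φ.symm (φ x)) = 0 := by rw [φ.left_inv hxφ, hx]
    have := ((hSd.mul (hTd.pow 2)).const_mul (-(1 / 2)))
    simp only [Function.comp_apply, φ, h3] at this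
    simpa using this
  apply hd
  have hmd : MDifferentiableAt 𝓘(ℝ, ModelE n) 𝓘(ℝ, ℝ) (r.rep x) x :=
    (h1.contMDiffAt (φ.open_source.mem_nhds hxφ)).mdifferentiableAt (by simp)
  ext v
  simp only [mvfderiv, hmd.mfderiv]
  have : fderivWithin ℝ (writtenInExtChartAt 𝓘(ℝ, ModelE n) 𝓘(ℝ, ℝ) x (r.rep x))
      (range 𝓘(ℝ, ModelE n)) (extChartAt 𝓘(ℝ, ModelE n) x x) = 0 := by
    simp only [writtenInExtChartAt, extChartAt, mfld_simps, fderivWithin_univ]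
    exact hRd.fderiv
  rw [this]
  exact map_zero (NormedSpace.fromTangentSpace (𝕜 := ℝ) (r.rep x x))

end FrameChange

section ChartMeasure

variable {n : ℕ} {N : Type*} [TopologicalSpace N] [ChartedSpace (ModelE n) N]
  [MeasurableSpace N] [BorelSpace N]

/-! ### Smooth measures on a manifold -/

omit [MeasurableSpace N] [BorelSpace N] in
lemma ContinuousOn.measurableSet_inter_preimage_of_isOpen {X Y : Type*} [TopologicalSpace X]
    [MeasurableSpace X] [BorelSpace X] [TopologicalSpace Y] [MeasurableSpace Y] [BorelSpace Y]
    {f : X → Y} {s : Set X} (hs : IsOpen s) (hf : ContinuousOn f s) {t : Set Y}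
    (ht : MeasurableSet t) : MeasurableSet (s ∩ f ⁻¹' t) := by
  have h := (continuousOn_iff_continuous_domRestrict.1 hf).measurable ht
  have h2 := hs.measurableSet.subtype_image h
  convert h2 using 1
  ext x
  simp [and_comm]

/-- The part of the target of the chart at `c` that corresponds to `S`. -/
def chartImage (n : ℕ) {N : Type*} [TopologicalSpace N] [ChartedSpace (ModelE n) N]
    (c : N) (S : Set N) : Set (ModelE n) :=
  (chartAt (ModelE n) c).target ∩ (chartAt (ModelE n) c).symm ⁻¹' S

lemma measurableSet_chartImage (c : N) {S : Set N} (hS : MeasurableSet S) :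
    MeasurableSet (chartImage n c S) :=
  (chartAt (ModelE n) c).continuousOn_symm.measurableSet_inter_preimage_of_isOpen
    (chartAt (ModelE n) c).open_target hS

lemma aemeasurable_chart_symm (c : N) :
    AEMeasurable (chartAt (ModelE n) c).symm
      ((volume : Measure (ModelE n)).restrict (chartAt (ModelE n) c).target) :=
  (chartAt (ModelE n) c).continuousOn_symm.aemeasurable
    (chartAt (ModelE n) c).open_target.measurableSet

/-- The measure on the domain of the chart at `c` with density `κ c` in the coordinates of that
chart. -/
def chartMeasure (n : ℕ) {N : Type*} [TopologicalSpace N] [ChartedSpace (ModelE n) N]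
    [MeasurableSpace N] (κ : N → N → ℝ) (c : N) : Measure N :=
  Measure.map (chartAt (ModelE n) c).symm
    (((volume : Measure (ModelE n)).restrict (chartAt (ModelE n) c).target).withDensity
      fun z => ENNReal.ofReal (κ c ((chartAt (ModelE n) c).symm z)))

lemma chartMeasure_apply (κ : N → N → ℝ) (c : N) {S : Set N} (hS : MeasurableSet S) :
    chartMeasure n κ c S = ∫⁻ z in chartImage n c S,
      ENNReal.ofReal (κ c ((chartAt (ModelE n) c).symm z)) := by
  rw [chartMeasure, Measure.map_apply_of_aemeasurable
    ((aemeasurable_chart_symm c).mono_ac (withDensity_absolutelyContinuous _ _)) hS,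
    withDensity_apply', Measure.restrict_restrict'
      (chartAt (ModelE n) c).open_target.measurableSet, inter_comm]
  rfl

lemma chartMeasure_inter_source (κ : N → N → ℝ) (c : N) {S : Set N} (hS : MeasurableSet S) :
    chartMeasure n κ c (S ∩ (chartAt (ModelE n) c).source) = chartMeasure n κ c S := by
  rw [chartMeasure_apply κ c hS,
    chartMeasure_apply κ c (hS.inter (chartAt (ModelE n) c).open_source.measurableSet)]
  congr 2
  ext z
  simp only [chartImage, mem_inter_iff, mem_preimage]
  exact ⟨fun h => ⟨h.1, h.2.1⟩, fun h => ⟨h.1, h.2, (chartAt (ModelE n) c).map_target h.1⟩⟩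

variable [IsManifold 𝓘(ℝ, ModelE n) ∞ N]

/-- The family `κ c` of functions transforms like a density of the volume under change of charts. -/
def IsChartDensity (n : ℕ) {N : Type*} [TopologicalSpace N] [ChartedSpace (ModelE n) N]
    [IsManifold 𝓘(ℝ, ModelE n) ∞ N] (κ : N → N → ℝ) : Prop :=
  ∀ c c' y : N, y ∈ (chartAt (ModelE n) c).source → y ∈ (chartAt (ModelE n) c').source →
    κ c y = |chartJacobian n c c' y| * κ c' y

lemma chartMeasure_eq_of_subset {κ : N → N → ℝ} (hκ : IsChartDensity n κ) {c c' : N} {S : Set N}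
    (hS : MeasurableSet S) (hSc : S ⊆ (chartAt (ModelE n) c).source)
    (hSc' : S ⊆ (chartAt (ModelE n) c').source) :
    chartMeasure n κ c S = chartMeasure n κ c' S := by
  set φ := chartAt (ModelE n) c
  set φ' := chartAt (ModelE n) c'
  rw [chartMeasure_apply κ c hS, chartMeasure_apply κ c' hS]
  have himg : (φ' ∘ φ.symm) '' chartImage n c S = chartImage n c' S := by
    ext z
    constructor
    · rintro ⟨w, hw, rfl⟩
      refine ⟨φ'.map_source (hSc' hw.2), ?_⟩
      simp only [mem_preimage, Function.comp_apply]
      rw [φ'.left_inv (hSc' hw.2)]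
      exact hw.2
    · intro hz
      refine ⟨φ (φ'.symm z), ⟨φ.map_source (hSc hz.2), ?_⟩, ?_⟩
      · rw [mem_preimage, φ.left_inv (hSc hz.2)]
        exact hz.2
      · rw [Function.comp_apply, φ.left_inv (hSc hz.2), φ'.right_inv hz.1]
  have hderiv : ∀ z ∈ chartImage n c S, HasFDerivWithinAt (φ' ∘ φ.symm)
      (tangentCoordChange 𝓘(ℝ, ModelE n) c c' (φ.symm z) : ModelE n →L[ℝ] ModelE n)
      (chartImage n c S) z := by
    intro z hz
    have h := hasFDerivWithinAt_tangentCoordChange (I := 𝓘(ℝ, ModelE n)) (x := c) (y := c')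
      (z := φ.symm z) (by
        rw [extChartAt_source, extChartAt_source]
        exact ⟨hSc hz.2, hSc' hz.2⟩)
    simp only [mfld_simps] at h
    rw [φ.right_inv hz.1, hasFDerivWithinAt_univ] at h
    exact h.hasFDerivWithinAt
  have hinj : InjOn (φ' ∘ φ.symm) (chartImage n c S) := by
    intro z hz w hw h
    have h2 := φ'.injOn (hSc' hz.2) (hSc' hw.2) h
    exact φ.symm.injOn hz.1 hw.1 h2
  rw [← himg, lintegral_image_eq_lintegral_abs_det_fderiv_mul volume
    (measurableSet_chartImage c hS) hderiv hinj]
  refine setLIntegral_congr_fun (measurableSet_chartImage c hS) fun z hz => ?_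
  simp only [Function.comp_apply]
  rw [φ'.left_inv (hSc' hz.2), ← ENNReal.ofReal_mul (abs_nonneg _),
    hκ c c' _ (hSc hz.2) (hSc' hz.2)]
  rfl

lemma exists_measure_restrict_source [SigmaCompactSpace N] [Nonempty N] {κ : N → N → ℝ}
    (hκ : IsChartDensity n κ) :
    ∃ μ : Measure N, ∀ c, μ.restrict (chartAt (ModelE n) c).source = chartMeasure n κ c := by
  obtain ⟨s, hs, hcov⟩ := countable_cover_nhds_of_sigmaCompact
    (f := fun x : N => (chartAt (ModelE n) x).source)
    fun x => (chartAt (ModelE n) x).open_source.mem_nhds (mem_chart_source _ x)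
  have hne : s.Nonempty := by
    rw [nonempty_iff_ne_empty]
    rintro rfl
    simp only [mem_empty_iff_false, iUnion_of_empty, iUnion_empty] at hcov
    exact empty_ne_univ hcov
  obtain ⟨f, rfl⟩ := hs.exists_eq_range hne
  rw [biUnion_range] at hcov
  set A : ℕ → Set N := disjointed fun k => (chartAt (ModelE n) (f k)).source
  have hA : ∀ k, MeasurableSet (A k) := MeasurableSet.disjointed fun k =>
    (chartAt (ModelE n) (f k)).open_source.measurableSet
  have hAd : Pairwise (Function.onFun Disjoint A) := disjoint_disjointed _
  have hAU : ⋃ k, A k = univ := by rw [iUnion_disjointed, hcov]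
  have hAs : ∀ k, A k ⊆ (chartAt (ModelE n) (f k)).source := fun k => disjointed_subset _ k
  refine ⟨Measure.sum fun k => (chartMeasure n κ (f k)).restrict (A k), fun c => ?_⟩
  ext S hS
  have hSc : MeasurableSet (S ∩ (chartAt (ModelE n) c).source) :=
    hS.inter (chartAt (ModelE n) c).open_source.measurableSet
  rw [Measure.restrict_apply hS, Measure.sum_apply _ hSc]
  have h1 : ∀ k, (chartMeasure n κ (f k)).restrict (A k) (S ∩ (chartAt (ModelE n) c).source)
      = chartMeasure n κ c (S ∩ (chartAt (ModelE n) c).source ∩ A k) := by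
    intro k
    rw [Measure.restrict_apply hSc]
    exact chartMeasure_eq_of_subset hκ (hSc.inter (hA k))
      (inter_subset_right.trans (hAs k)) (inter_subset_left.trans inter_subset_right)
  simp only [h1]
  rw [← measure_iUnion (fun i j hij => (hAd hij).mono inter_subset_right inter_subset_right)
    fun k => hSc.inter (hA k), ← inter_iUnion, hAU, inter_univ, chartMeasure_inter_source κ c hS]

/-- `μ` has the smooth positive density `κ c` in the chart at each `c`. -/
structure HasChartDensity (n : ℕ) {N : Type*} [TopologicalSpace N] [ChartedSpace (ModelE n) N]
    [MeasurableSpace N] (μ : Measure N) (κ : N → N → ℝ) : Prop where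
  restrict_source : ∀ c, μ.restrict (chartAt (ModelE n) c).source = chartMeasure n κ c
  contMDiffOn : ∀ c, ContMDiffOn 𝓘(ℝ, ModelE n) 𝓘(ℝ, ℝ) ∞ (κ c) (chartAt (ModelE n) c).source
  pos : ∀ c, ∀ y ∈ (chartAt (ModelE n) c).source, 0 < κ c y

namespace HasChartDensity

variable {μ : Measure N} {κ : N → N → ℝ}

omit [BorelSpace N] [IsManifold 𝓘(ℝ, ModelE n) ∞ N] in
lemma continuousOn_comp_symm (hμ : HasChartDensity n μ κ) (c : N) :
    ContinuousOn (fun z => κ c ((chartAt (ModelE n) c).symm z)) (chartAt (ModelE n) c).target :=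
  (hμ.contMDiffOn c).continuousOn.comp (chartAt (ModelE n) c).continuousOn_symm
    fun _ hz => (chartAt (ModelE n) c).map_target hz

omit [BorelSpace N] [IsManifold 𝓘(ℝ, ModelE n) ∞ N] in
lemma aemeasurable_density (hμ : HasChartDensity n μ κ) (c : N) :
    AEMeasurable (fun z => ENNReal.ofReal (κ c ((chartAt (ModelE n) c).symm z)))
      ((volume : Measure (ModelE n)).restrict (chartAt (ModelE n) c).target) :=
  ((hμ.continuousOn_comp_symm c).aemeasurable
    (chartAt (ModelE n) c).open_target.measurableSet).ennreal_ofReal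

omit [IsManifold 𝓘(ℝ, ModelE n) ∞ N] in
lemma setIntegral_source (hμ : HasChartDensity n μ κ) (c : N) {f : N → ℝ} (hf : Measurable f) :
    ∫ x in (chartAt (ModelE n) c).source, f x ∂μ
      = ∫ z in (chartAt (ModelE n) c).target, f ((chartAt (ModelE n) c).symm z)
        * κ c ((chartAt (ModelE n) c).symm z) := by
  rw [hμ.restrict_source c, chartMeasure, integral_map
    ((aemeasurable_chart_symm c).mono_ac (withDensity_absolutelyContinuous _ _))
    hf.aestronglyMeasurable, integral_withDensity_eq_integral_toReal_smul₀
    (hμ.aemeasurable_density c) (ae_of_all _ fun _ => ENNReal.ofReal_lt_top)]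
  refine setIntegral_congr_fun (chartAt (ModelE n) c).open_target.measurableSet fun z hz => ?_
  rw [ENNReal.toReal_ofReal (hμ.pos c _ ((chartAt (ModelE n) c).map_target hz)).le, smul_eq_mul,
    mul_comm]

omit [IsManifold 𝓘(ℝ, ModelE n) ∞ N] in
lemma setLIntegral_chart (hμ : HasChartDensity n μ κ) (c : N) {f : N → ℝ≥0∞} (hf : Measurable f)
    {S : Set N} (hS : MeasurableSet S) (hSc : S ⊆ (chartAt (ModelE n) c).source) :
    ∫⁻ x in S, f x ∂μ = ∫⁻ z in chartImage n c S, f ((chartAt (ModelE n) c).symm z)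
        * ENNReal.ofReal (κ c ((chartAt (ModelE n) c).symm z)) := by
  have hφ := (aemeasurable_chart_symm (n := n) c).mono_ac (withDensity_absolutelyContinuous
    ((volume : Measure (ModelE n)).restrict (chartAt (ModelE n) c).target)
    fun z => ENNReal.ofReal (κ c ((chartAt (ModelE n) c).symm z)))
  have hm := (chartAt (ModelE n) c).open_target.measurableSet
  rw [← inter_eq_self_of_subset_left hSc, ← Measure.restrict_restrict hS, hμ.restrict_source c,
    inter_eq_self_of_subset_left hSc, chartMeasure, ← lintegral_indicator hS,
    lintegral_map' ((hf.indicator hS).aemeasurable) hφ,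
    lintegral_withDensity_eq_lintegral_mul₀ (hμ.aemeasurable_density c)
      (g := fun z => S.indicator f ((chartAt (ModelE n) c).symm z))
      ((hf.indicator hS).comp_aemeasurable (aemeasurable_chart_symm c))]
  rw [← lintegral_indicator hm, ← lintegral_indicator (measurableSet_chartImage c hS)]
  congr 1
  ext z
  by_cases h1 : z ∈ (chartAt (ModelE n) c).target <;>
    by_cases h2 : (chartAt (ModelE n) c).symm z ∈ S <;>
    simp [indicator, chartImage, h1, h2, mul_comm]

omit [IsManifold 𝓘(ℝ, ModelE n) ∞ N] in
lemma isLocallyFiniteMeasure (hμ : HasChartDensity n μ κ) : IsLocallyFiniteMeasure μ := by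
  refine ⟨fun x => ?_⟩
  set φ := chartAt (ModelE n) x
  have hx : x ∈ φ.source := mem_chart_source _ x
  obtain ⟨K, hK, hxK, hKφ⟩ := exists_compact_subset φ.open_target (φ.map_source hx)
  have hV : IsOpen (φ.source ∩ φ ⁻¹' interior K) := φ.isOpen_inter_preimage isOpen_interior
  refine ⟨_, hV.mem_nhds ⟨hx, hxK⟩, ?_⟩
  have h1 := hμ.setLIntegral_chart x (f := fun _ => 1) measurable_const hV.measurableSet
    inter_subset_left
  rw [setLIntegral_one] at h1
  rw [h1]
  simp only [one_mul]
  have h2 : IntegrableOn (fun z => κ x (φ.symm z)) K :=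
    ((hμ.continuousOn_comp_symm x).mono hKφ).integrableOn_compact hK
  refine lt_of_le_of_lt (lintegral_mono_set fun z hz => ?_) h2.lintegral_lt_top
  have := hz.2.2
  rw [mem_preimage, φ.right_inv hz.1] at this
  exact interior_subset this

end HasChartDensity

end ChartMeasure

section RiemannianVolume

variable {n : ℕ} {N : Type*} [TopologicalSpace N] [ChartedSpace (ModelE n) N]
  [IsManifold 𝓘(ℝ, ModelE n) ∞ N]
  {g : (x : N) → TangentSpace 𝓘(ℝ, ModelE n) x →L[ℝ] TangentSpace 𝓘(ℝ, ModelE n) x →L[ℝ] ℝ}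
  {Ω : Set N}

/-! ### The Riemannian volume as a measure with a density -/

lemma contMDiffOn_coordFrame (c : N) (i : Fin (n + 1)) :
    ContMDiffOn 𝓘(ℝ, ModelE n) (𝓘(ℝ, ModelE n).prod 𝓘(ℝ, ModelE n)) ∞
      (fun y => TotalSpace.mk' (ModelE n) y (coordFrame (n := n) c y i))
      (chartAt (ModelE n) c).source := by
  have h := (trivializationAt (ModelE n) (TangentSpace 𝓘(ℝ, ModelE n) (M := N))
    c).contMDiffOn_section_baseSet_iff (IB := 𝓘(ℝ, ModelE n)) (n := ∞)
    (s := fun y => coordFrame (n := n) c y i)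
  rw [TangentBundle.trivializationAt_baseSet] at h
  refine h.2 ((contMDiffOn_const (c := (EuclideanSpace.single i 1 : ModelE n))).congr
    fun y hy => ?_)
  have hb : y ∈ (trivializationAt (ModelE n) (TangentSpace 𝓘(ℝ, ModelE n) (M := N)) c).baseSet := by
    simpa using hy
  have h2 := (trivializationAt (ModelE n) (TangentSpace 𝓘(ℝ, ModelE n) (M := N))
    c).continuousLinearMapAt_symmL (R := ℝ) hb (EuclideanSpace.single i 1)
  rw [← congrFun (Trivialization.coe_continuousLinearEquivAt_eq (R := ℝ) _ hb)] at h2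
  exact h2

lemma continuousOn_volDensity (hg : IsRiemannianMetricOn Ω g) (c : N) :
    ContinuousOn (volDensity g c) ((chartAt (ModelE n) c).source ∩ Ω) := by
  have h1 : ∀ i j, ContinuousOn (fun y => g y (coordFrame c y i) (coordFrame c y j))
      ((chartAt (ModelE n) c).source ∩ Ω) := by
    intro i j x hx
    have h : ContMDiffWithinAt 𝓘(ℝ, ModelE n) (𝓘(ℝ, ModelE n).prod 𝓘(ℝ, ℝ)) ∞
        (fun y => TotalSpace.mk' ℝ (E := Bundle.Trivial N ℝ) y
          (g y (coordFrame c y i) (coordFrame c y j)))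
        ((chartAt (ModelE n) c).source ∩ Ω) x := by
      apply ContMDiffWithinAt.clm_bundle_apply₂ (F₁ := ModelE n) (F₂ := ModelE n)
      · exact (hg.2.2 x hx.2).mono inter_subset_right
      · exact (contMDiffOn_coordFrame c i x hx.1).mono inter_subset_left
      · exact (contMDiffOn_coordFrame c j x hx.1).mono inter_subset_left
    simp only [contMDiffWithinAt_totalSpace] at h
    exact h.2.continuousWithinAt
  have h2 : ContinuousOn (fun y => (Matrix.of fun i j : Fin (n + 1) =>
      g y (coordFrame c y i) (coordFrame c y j)).det) ((chartAt (ModelE n) c).source ∩ Ω) := by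
    simp only [Matrix.det_apply', Matrix.of_apply]
    exact continuousOn_finsetSum _ fun p _ => continuousOn_const.mul
      (continuousOn_finsetProd _ fun i _ => h1 _ _)
  exact h2.sqrt

/-- The density of the Riemannian volume of `g` with respect to the volume of the scale `σ`. -/
def volumeRatio
    (g : (x : N) → TangentSpace 𝓘(ℝ, ModelE n) x →L[ℝ] TangentSpace 𝓘(ℝ, ModelE n) x →L[ℝ] ℝ)
    (σ : ProjDensity n N 1) (x : N) : ℝ :=
  volDensity g x x * σ.val x ^ (n + 2)

/-- The volume density of the scale `σ` in the chart at `c`. -/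
def scaleDensity (σ : ProjDensity n N 1) (c y : N) : ℝ := (σ.rep c y ^ (n + 2))⁻¹

lemma isChartDensity_scaleDensity (σ : ProjDensity n N 1) :
    IsChartDensity n (scaleDensity σ) := fun _ _ _ hy hy' =>
  IsProjectiveScale.inv_pow_rep_change hy hy'

lemma volumeRatio_mul_scaleDensity
    (g : (x : N) → TangentSpace 𝓘(ℝ, ModelE n) x →L[ℝ] TangentSpace 𝓘(ℝ, ModelE n) x →L[ℝ] ℝ)
    {σ : ProjDensity n N 1} (hσ : IsProjectiveScale σ) {c y : N}
    (hy : y ∈ (chartAt (ModelE n) c).source) :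
    volumeRatio g σ y * scaleDensity σ c y = volDensity g c y := by
  have h1 := isChartDensity_scaleDensity σ c y y hy (mem_chart_source _ y)
  have h2 : scaleDensity σ y y = (σ.val y ^ (n + 2))⁻¹ := rfl
  rw [h1, h2, volDensity_change g hy (mem_chart_source _ y), volumeRatio]
  have := (pow_pos (hσ.val_pos y) (n + 2)).ne'
  field_simp

lemma volumeRatio_nonneg {σ : ProjDensity n N 1} (hσ : IsProjectiveScale σ) (x : N) :
    0 ≤ volumeRatio g σ x :=
  mul_nonneg (Real.sqrt_nonneg _) (pow_pos (hσ.val_pos x) _).le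

lemma continuousOn_volumeRatio (hΩ : IsOpen Ω) (hg : IsRiemannianMetricOn Ω g)
    {σ : ProjDensity n N 1} (hσ : IsProjectiveScale σ) : ContinuousOn (volumeRatio g σ) Ω := by
  intro c hc
  set s := (chartAt (ModelE n) c).source ∩ Ω
  have hs : s ∈ 𝓝 c := ((chartAt (ModelE n) c).open_source.inter hΩ).mem_nhds
    ⟨mem_chart_source _ c, hc⟩
  have h1 : ContinuousOn (fun y => volDensity g c y * σ.rep c y ^ (n + 2)) s := by
    refine (continuousOn_volDensity hg c).mul (ContinuousOn.pow ?_ _)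
    have := (hσ.1 c).continuousOn
    rw [univ_inter] at this
    exact this.mono inter_subset_left
  refine ((h1.continuousAt hs).congr ?_).continuousWithinAt
  filter_upwards [hs] with y hy
  rw [← volumeRatio_mul_scaleDensity g hσ hy.1, scaleDensity,
    inv_mul_cancel_right₀ (pow_pos (hσ.rep_pos hy.1) _).ne']

variable [MeasurableSpace N] [BorelSpace N]

omit [BorelSpace N] in
lemma hasChartDensity_scaleDensity {σ : ProjDensity n N 1} (hσ : IsProjectiveScale σ)
    {μ : Measure N} (hμ : ∀ c, μ.restrict (chartAt (ModelE n) c).source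
      = chartMeasure n (scaleDensity σ) c) : HasChartDensity n μ (scaleDensity σ) where
  restrict_source := hμ
  contMDiffOn c := by
    have h := hσ.1 c
    rw [univ_inter] at h
    exact (h.pow (n + 2)).inv₀ fun y hy => (pow_pos (hσ.rep_pos hy) _).ne'
  pos c y hy := inv_pos.2 (pow_pos (hσ.rep_pos hy) _)

omit [IsManifold 𝓘(ℝ, ModelE n) ∞ N] in
lemma measurable_indicator_of_continuousOn {X Y : Type*} [TopologicalSpace X] [MeasurableSpace X]
    [BorelSpace X] [TopologicalSpace Y] [MeasurableSpace Y] [BorelSpace Y] [Zero Y]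
    {f : X → Y} {s : Set X} (hs : IsOpen s) (hf : ContinuousOn f s) :
    Measurable (s.indicator f) := by
  classical
  exact hf.measurable_piecewise continuousOn_const hs.measurableSet

lemma setLIntegral_volDensity (hΩ : IsOpen Ω) (hg : IsRiemannianMetricOn Ω g)
    {σ : ProjDensity n N 1} (hσ : IsProjectiveScale σ) {μ : Measure N}
    (hμ : HasChartDensity n μ (scaleDensity σ)) (c : N) {S : Set N} (hS : MeasurableSet S)
    (hSc : S ⊆ (chartAt (ModelE n) c).source) (hSΩ : S ⊆ Ω) :
    ∫⁻ z in chartImage n c S, ENNReal.ofReal (volDensity g c ((chartAt (ModelE n) c).symm z))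
      = ∫⁻ x in S, ENNReal.ofReal (volumeRatio g σ x) ∂μ := by
  have hm : Measurable fun x => ENNReal.ofReal (Ω.indicator (volumeRatio g σ) x) :=
    (measurable_indicator_of_continuousOn hΩ (continuousOn_volumeRatio hΩ hg hσ)).ennreal_ofReal
  have h1 : ∫⁻ x in S, ENNReal.ofReal (volumeRatio g σ x) ∂μ
      = ∫⁻ x in S, ENNReal.ofReal (Ω.indicator (volumeRatio g σ) x) ∂μ :=
    setLIntegral_congr_fun hS fun x hx => by rw [indicator_of_mem (hSΩ hx)]
  rw [h1, hμ.setLIntegral_chart c hm hS hSc]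
  refine setLIntegral_congr_fun (measurableSet_chartImage c hS) fun z hz => ?_
  rw [indicator_of_mem (hSΩ hz.2), ← ENNReal.ofReal_mul (volumeRatio_nonneg hσ _),
    volumeRatio_mul_scaleDensity g hσ (hSc hz.2)]

lemma riemVol_eq_setLIntegral (hΩ : IsOpen Ω) (hΩc : IsCompact (closure Ω))
    (hg : IsRiemannianMetricOn Ω g) {σ : ProjDensity n N 1} (hσ : IsProjectiveScale σ)
    {μ : Measure N} (hμ : HasChartDensity n μ (scaleDensity σ)) {S : Set N}
    (hS : MeasurableSet S) (hSΩ : S ⊆ Ω) :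
    riemVol g S = ∫⁻ x in S, ENNReal.ofReal (volumeRatio g σ x) ∂μ := by
  apply le_antisymm
  · refine iSup_le fun m => iSup_le fun c => iSup_le fun B => iSup_le fun hB => iSup_le fun hd => ?_
    set T : Fin m → Set N := fun k => (chartAt (ModelE n) (c k)).symm '' B k
    have hTs : ∀ k, T k ⊆ (chartAt (ModelE n) (c k)).source := by
      rintro k _ ⟨z, hz, rfl⟩
      exact (chartAt (ModelE n) (c k)).map_target ((hB k).2.1 hz)
    have hTB : ∀ k, chartImage n (c k) (T k) = B k := by
      intro k
      ext z
      constructor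
      · rintro ⟨hz, w, hw, hwz⟩
        rwa [← (chartAt (ModelE n) (c k)).symm.injOn ((hB k).2.1 hw) hz hwz]
      · exact fun hz => ⟨(hB k).2.1 hz, z, hz, rfl⟩
    have hTm : ∀ k, MeasurableSet (T k) := by
      intro k
      have h : T k = (chartAt (ModelE n) (c k)).source ∩ chartAt (ModelE n) (c k) ⁻¹' B k := by
        ext x
        constructor
        · rintro ⟨z, hz, rfl⟩
          refine ⟨(chartAt (ModelE n) (c k)).map_target ((hB k).2.1 hz), ?_⟩
          rwa [mem_preimage, (chartAt (ModelE n) (c k)).right_inv ((hB k).2.1 hz)]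
        · exact fun hx => ⟨_, hx.2, (chartAt (ModelE n) (c k)).left_inv hx.1⟩
      rw [h]
      exact (chartAt (ModelE n) (c k)).continuousOn.measurableSet_inter_preimage_of_isOpen
        (chartAt (ModelE n) (c k)).open_source (hB k).1
    have h1 : ∀ k, ∫⁻ y in B k, ENNReal.ofReal (volDensity g (c k)
        ((chartAt (ModelE n) (c k)).symm y)) = ∫⁻ x in T k, ENNReal.ofReal (volumeRatio g σ x) ∂μ :=
      fun k => by
        rw [← setLIntegral_volDensity hΩ hg hσ hμ (c k) (hTm k) (hTs k)
          ((hB k).2.2.trans hSΩ), hTB k]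
    rw [Finset.sum_congr rfl fun k _ => h1 k, ← tsum_fintype (L := .unconditional _),
      ← lintegral_iUnion hTm hd]
    exact lintegral_mono_set (iUnion_subset fun k => (hB k).2.2)
  · obtain ⟨t, -, ht⟩ := hΩc.elim_nhds_subcover (fun x => (chartAt (ModelE n) x).source)
      fun x _ => (chartAt (ModelE n) x).open_source.mem_nhds (mem_chart_source _ x)
    set c : Fin t.card → N := fun k => (t.equivFin.symm k : N)
    set A : Fin t.card → Set N := disjointed fun k => (chartAt (ModelE n) (c k)).source
    have hA : ∀ k, MeasurableSet (A k) := fun k => by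
      simp only [A, disjointed_apply, Finset.sup_set_eq_biUnion]
      exact (chartAt (ModelE n) (c k)).open_source.measurableSet.diff
        (Finset.measurableSet_biUnion _ fun j _ =>
          (chartAt (ModelE n) (c j)).open_source.measurableSet)
    have hAd : Pairwise (Function.onFun Disjoint A) := disjoint_disjointed _
    have hAs : ∀ k, A k ⊆ (chartAt (ModelE n) (c k)).source := fun k => disjointed_subset _ k
    have hcov : S = ⋃ k, S ∩ A k := by
      rw [← inter_iUnion, iUnion_disjointed, eq_comm, inter_eq_left]
      intro x hx
      obtain ⟨y, hy, hxy⟩ := mem_iUnion₂.1 (ht (subset_closure (hSΩ hx)))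
      exact mem_iUnion.2 ⟨t.equivFin ⟨y, hy⟩, by simpa [c] using hxy⟩
    have himg : ∀ k, (chartAt (ModelE n) (c k)).symm '' chartImage n (c k) (S ∩ A k) ⊆ S ∩ A k := by
      rintro k _ ⟨z, hz, rfl⟩
      exact hz.2
    have h1 : ∫⁻ x in S, ENNReal.ofReal (volumeRatio g σ x) ∂μ
        = ∑ k, ∫⁻ y in chartImage n (c k) (S ∩ A k), ENNReal.ofReal (volDensity g (c k)
          ((chartAt (ModelE n) (c k)).symm y)) := by
      conv_lhs => rw [hcov]
      rw [lintegral_iUnion (fun k => hS.inter (hA k))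
        (fun i j hij => (hAd hij).mono inter_subset_right inter_subset_right), tsum_fintype]
      exact Finset.sum_congr rfl fun k _ => (setLIntegral_volDensity hΩ hg hσ hμ (c k)
        (hS.inter (hA k)) (inter_subset_right.trans (hAs k)) (inter_subset_left.trans hSΩ)).symm
    rw [h1, riemVol]
    refine le_iSup_of_le t.card (le_iSup_of_le c (le_iSup_of_le
      (fun k => chartImage n (c k) (S ∩ A k)) (le_iSup_of_le (fun k => ⟨?_, ?_, ?_⟩)
        (le_iSup_of_le (fun i j hij => ?_) le_rfl))))
    · exact measurableSet_chartImage _ (hS.inter (hA k))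
    · exact inter_subset_left
    · exact (himg k).trans inter_subset_left
    · exact (hAd hij).mono ((himg i).trans inter_subset_right) ((himg j).trans inter_subset_right)

end RiemannianVolume

section BlaschkeVolume

variable {n : ℕ} {N : Type*} [TopologicalSpace N] [ChartedSpace (ModelE n) N]
  [IsManifold 𝓘(ℝ, ModelE n) ∞ N]
  {g : (x : N) → TangentSpace 𝓘(ℝ, ModelE n) x →L[ℝ] TangentSpace 𝓘(ℝ, ModelE n) x →L[ℝ] ℝ}
  {Ω : Set N}

/-! ### The volume of the Blaschke metric near the boundary -/

lemma IsDefiningDensity.mem_iff {r : ProjDensity n N 2} (hr : IsDefiningDensity Ω r)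
    {τ : ProjDensity n N 1} (hτ : IsProjectiveScale τ) {x : N} :
    x ∈ Ω ↔ 0 < scaledDefining r τ x := by
  rw [hr.2.1, mem_ofPred_eq, scaledDefining, lt_div_iff₀ (pow_pos (hτ.val_pos x) 2), zero_mul]
  constructor <;> intro h <;> linarith

lemma IsDefiningDensity.isOpen {r : ProjDensity n N 2} (hr : IsDefiningDensity Ω r)
    {τ : ProjDensity n N 1} (hτ : IsProjectiveScale τ) : IsOpen Ω := by
  have : Ω = scaledDefining r τ ⁻¹' Ioi 0 := by
    ext x
    exact hr.mem_iff hτ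
  rw [this]
  exact isOpen_Ioi.preimage (contMDiff_scaledDefining hr.1 hτ).continuous

lemma IsDefiningDensity.eq_zero_of_mem_frontier {r : ProjDensity n N 2}
    (hr : IsDefiningDensity Ω r) {τ : ProjDensity n N 1} (hτ : IsProjectiveScale τ) {x : N}
    (hx : x ∈ frontier Ω) : scaledDefining r τ x = 0 := by
  rw [(hr.isOpen hτ).frontier_eq] at hx
  refine le_antisymm (not_lt.1 fun h => hx.2 ((hr.mem_iff hτ).2 h)) ?_
  have hcl : IsClosed {x | 0 ≤ scaledDefining r τ x} :=
    isClosed_le continuous_const (contMDiff_scaledDefining hr.1 hτ).continuous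
  exact closure_minimal (fun y hy => ((hr.mem_iff hτ).1 hy).le) hcl hx.1

lemma rpow_neg_half_sub_one {p : ℝ} (hp : 0 < p) (n : ℕ) :
    p ^ (-((n : ℝ) / 2) - 1) = (Real.sqrt (p ^ (n + 2)))⁻¹ := by
  rw [Real.sqrt_eq_rpow, ← Real.rpow_natCast, ← Real.rpow_mul hp.le, ← Real.rpow_neg hp.le]
  congr 1
  push_cast
  ring

/-- Where `g` is the Blaschke metric, its volume is `√(-𝒥[r]) (-2r)^{-(n+2)/2}`. -/
lemma volumeRatio_eq_of_blaschke {D : AffineConn n N} {r : ProjDensity n N 2}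
    {σ : ProjDensity n N 1} (hσ : IsProjectiveScale σ) {x : N} (hx : r.val x < 0)
    (hgx : ∀ v v' : TangentSpace 𝓘(ℝ, ModelE n) x, g x v v' = blaschke D r x v v') :
    volumeRatio g σ x = Real.sqrt (-mongeAmpere D r x)
      * scaledDefining r σ x ^ (-((n : ℝ) / 2) - 1) := by
  have hq : 0 < -2 * r.val x := by linarith
  have hσx := hσ.val_pos x
  have hG : (Matrix.of fun i j : Fin (n + 1) => g x (coordFrame x x i) (coordFrame x x j))
      = Matrix.of fun i j : Fin (n + 1) =>
        blaschke D r x (EuclideanSpace.single i 1) (EuclideanSpace.single j 1) := by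
    ext i j
    rw [Matrix.of_apply, Matrix.of_apply, hgx, coordFrame_self, coordFrame_self]
  have hdet : (Matrix.of fun i j : Fin (n + 1) => g x (coordFrame x x i) (coordFrame x x j)).det
      = -mongeAmpere D r x / (-2 * r.val x) ^ (n + 2) := by
    rw [mongeAmpere_eq D r hx.ne, hG, neg_mul, neg_neg,
      mul_div_cancel_left₀ _ (pow_pos hq (n + 2)).ne']
  rw [volumeRatio, volDensity, hdet, Real.sqrt_div' _ (pow_pos hq _).le, scaledDefining,
    rpow_neg_half_sub_one (div_pos hq (pow_pos hσx 2)), div_pow,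
    Real.sqrt_div' _ (pow_pos (pow_pos hσx 2) _).le, ← pow_mul, mul_comm 2, pow_mul,
    Real.sqrt_sq (pow_pos hσx _).le]
  have := Real.sqrt_pos.2 (pow_pos hq (n + 2))
  field_simp

lemma abs_sqrt_one_add_sub_one_le (X : ℝ) : |Real.sqrt (1 + X) - 1| ≤ |X| := by
  rcases le_total 0 (1 + X) with h | h
  · have h0 := Real.sqrt_nonneg (1 + X)
    have h1 : (Real.sqrt (1 + X) - 1) * (Real.sqrt (1 + X) + 1) = X := by
      have := Real.mul_self_sqrt h
      linarith
    calc |Real.sqrt (1 + X) - 1| = |Real.sqrt (1 + X) - 1| * 1 := (mul_one _).symm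
      _ ≤ |Real.sqrt (1 + X) - 1| * |Real.sqrt (1 + X) + 1| := by
          refine mul_le_mul_of_nonneg_left ?_ (abs_nonneg _)
          rw [abs_of_nonneg (by linarith)]
          linarith
      _ = |X| := by rw [← abs_mul, h1]
  · rw [Real.sqrt_eq_zero_of_nonpos h, zero_sub, abs_neg, abs_one, abs_of_neg (by linarith)]
    linarith

lemma val_mul_val_pow {r : ProjDensity n N 2} {m : ℕ} (K : ProjDensity n N (-(2 * (m : ℝ))))
    {c y : N} (hy : y ∈ (chartAt (ModelE n) c).source) :
    K.val y * r.val y ^ m = K.rep c y * r.rep c y ^ m := by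
  have h0 := abs_pos.2 (chartJacobian_ne_zero (mem_chart_source (ModelE n) y) hy)
  rw [K.val_eq_rep hy, r.val_eq_rep hy, mul_pow, ← Real.rpow_natCast (_ ^ _), ← Real.rpow_mul h0.le,
    mul_mul_mul_comm, ← Real.rpow_add h0]
  have : -(-(2 * (m : ℝ))) / ((n : ℝ) + 2) + -2 / ((n : ℝ) + 2) * (m : ℝ) = 0 := by ring
  rw [this, Real.rpow_zero, one_mul]

lemma IsFeffermanDensity.exists_eqNegOneModPow {D : AffineConn n N} {r : ProjDensity n N 2}
    (hr : IsFeffermanDensity D Ω r) :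
    ∃ m : ℕ, (n : ℝ) / 2 + 1 ≤ m ∧ EqNegOneModPow Ω r (mongeAmpere D r) m := by
  rcases Nat.even_or_odd n with h | h
  · refine ⟨_, ?_, hr.2.2 h⟩
    obtain ⟨k, rfl⟩ := h
    rw [show (k + k) / 2 = k by omega]
    push_cast
    linarith
  · refine ⟨n + 2, ?_, hr.2.1 h _⟩
    push_cast
    have : (0 : ℝ) ≤ n := n.cast_nonneg
    linarith

/-- The volume of the Blaschke metric differs from the volume `(-2r)^{-(n+2)/2}` by a bounded
density. -/
lemma exists_bound_volumeRatio_sub {D : AffineConn n N} {r : ProjDensity n N 2}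
    (hΩc : IsCompact (closure Ω)) (hr : IsFeffermanDensity D Ω r) (hg : IsBlaschkeMetric D Ω r g)
    {σ : ProjDensity n N 1} (hσ : IsProjectiveScale σ) :
    ∃ C : ℝ, ∀ x ∈ Ω,
      |volumeRatio g σ x - scaledDefining r σ x ^ (-((n : ℝ) / 2) - 1)| ≤ C := by
  set s := scaledDefining r σ
  have hs : Continuous s := (contMDiff_scaledDefining hr.1.1 hσ).continuous
  have hΩ := hr.1.isOpen hσ
  obtain ⟨m, hm, U', hU', hU'f, K, hK, hJ⟩ := hr.exists_eqNegOneModPow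
  obtain ⟨hgR, U, hU, hUf, hgU⟩ := hg
  suffices h : ∃ C : ℝ, ∀ x ∈ closure Ω, x ∈ Ω →
      |volumeRatio g σ x - s x ^ (-((n : ℝ) / 2) - 1)| ≤ C by
    obtain ⟨C, hC⟩ := h
    exact ⟨C, fun x hx => hC x (subset_closure hx) hx⟩
  refine hΩc.induction_on (p := fun S => ∃ C : ℝ, ∀ x ∈ S, x ∈ Ω →
      |volumeRatio g σ x - s x ^ (-((n : ℝ) / 2) - 1)| ≤ C) ⟨0, by simp⟩ ?_ ?_ ?_
  · rintro S T hST ⟨C, hC⟩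
    exact ⟨C, fun x hx => hC x (hST hx)⟩
  · rintro S T ⟨C, hC⟩ ⟨C', hC'⟩
    refine ⟨max C C', fun x hx hxΩ => ?_⟩
    rcases hx with hx | hx
    · exact (hC x hx hxΩ).trans (le_max_left _ _)
    · exact (hC' x hx hxΩ).trans (le_max_right _ _)
  intro c hc
  by_cases hcΩ : c ∈ Ω
  · have h1 : ContinuousAt (fun x => |volumeRatio g σ x - s x ^ (-((n : ℝ) / 2) - 1)|) c :=
      (((continuousOn_volumeRatio hΩ hgR hσ).continuousAt (hΩ.mem_nhds hcΩ)).sub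
        (hs.continuousAt.rpow_const (Or.inl ((hr.1.mem_iff hσ).1 hcΩ).ne'))).abs
    refine ⟨_, mem_nhdsWithin_of_mem_nhds (h1.eventually_lt_const (lt_add_one _)),
      _, fun x hx _ => le_of_lt hx⟩
  · have hcf : c ∈ frontier Ω := by
      rw [hΩ.frontier_eq]
      exact ⟨hc, hcΩ⟩
    set φ := chartAt (ModelE n) c
    have hcφ : c ∈ φ.source := mem_chart_source _ c
    have hUφ := (hU'.inter φ.open_source).mem_nhds ⟨hU'f hcf, hcφ⟩
    have hkc : ContinuousAt (fun x => |K.rep c x * (-(σ.rep c x ^ 2) / 2) ^ m|) c := by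
      have h1 : ContinuousAt (K.rep c) c := (hK c).continuousOn.continuousAt hUφ
      have h2 : ContinuousAt (σ.rep c) c := by
        have := (hσ.1 c).continuousOn
        rw [univ_inter] at this
        exact this.continuousAt (φ.open_source.mem_nhds hcφ)
      exact (h1.mul (((h2.pow 2).neg.div_const 2).pow m)).abs
    set C := |K.rep c c * (-(σ.rep c c ^ 2) / 2) ^ m| + 1
    have hs1 : ∀ᶠ x in 𝓝 c, s x < 1 := by
      refine hs.continuousAt.eventually_lt_const ?_
      exact (hr.1.eq_zero_of_mem_frontier hσ hcf).trans_lt one_pos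
    have hev := (hkc.eventually_lt_const (lt_add_one _)).and (hs1.and
      ((eventually_mem_set.2 hUφ).and (eventually_mem_set.2 (hU.mem_nhds (hUf hcf)))))
    refine ⟨_, mem_nhdsWithin_of_mem_nhds hev, C, fun x hx hxΩ => ?_⟩
    obtain ⟨hx1, hx2, hx3, hx4⟩ := hx
    have hsx : 0 < s x := (hr.1.mem_iff hσ).1 hxΩ
    have hrx : r.val x < 0 := by
      have := hr.1.2.1 ▸ hxΩ
      exact this
    have hkey : -mongeAmpere D r x
        = 1 + -(K.rep c x * (-(σ.rep c x ^ 2) / 2) ^ m * s x ^ m) := by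
      have h1 : s x = -2 * r.rep c x / σ.rep c x ^ 2 := scaledDefining_eq_rep r σ hx3.2
      have h2 : r.rep c x = -(σ.rep c x ^ 2) / 2 * s x := by
        have := (hσ.rep_pos hx3.2).ne'
        rw [h1]
        field_simp
      rw [hJ x hx3.1, val_mul_val_pow K hx3.2, h2, mul_pow]
      ring
    rw [volumeRatio_eq_of_blaschke hσ hrx (hgU x ⟨hx4, hxΩ⟩), ← sub_one_mul, abs_mul,
      abs_of_pos (Real.rpow_pos_of_pos hsx _), hkey]
    calc _ ≤ |-(K.rep c x * (-(σ.rep c x ^ 2) / 2) ^ m * s x ^ m)|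
          * s x ^ (-((n : ℝ) / 2) - 1) :=
          mul_le_mul_of_nonneg_right (abs_sqrt_one_add_sub_one_le _)
            (Real.rpow_pos_of_pos hsx _).le
      _ = |K.rep c x * (-(σ.rep c x ^ 2) / 2) ^ m| * s x ^ ((m : ℝ) - ((n : ℝ) / 2 + 1)) := by
          rw [abs_neg, abs_mul, abs_of_pos (pow_pos hsx m), mul_assoc, ← Real.rpow_natCast (s x) m,
            ← Real.rpow_add hsx]
          congr 2
          ring
      _ ≤ C * 1 := mul_le_mul hx1.le (Real.rpow_le_one hsx.le hx2.le (by linarith))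
          (Real.rpow_pos_of_pos hsx _).le (by positivity)
      _ = C := mul_one C

end BlaschkeVolume

section GlobalExpansion

variable {n : ℕ} {N : Type*} [TopologicalSpace N] [ChartedSpace (ModelE n) N]

/-! ### Expansions of integrals over superlevel sets of a defining function -/

/-- `s` is a smooth function on `N`, positive exactly in `Ω`, with nonvanishing differential on the
boundary of `Ω`. -/
structure IsPositiveDefining (n : ℕ) {N : Type*} [TopologicalSpace N] [ChartedSpace (ModelE n) N]
    (Ω : Set N) (s : N → ℝ) : Prop where
  contMDiff : ContMDiff 𝓘(ℝ, ModelE n) 𝓘(ℝ, ℝ) ∞ s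
  mem_iff : ∀ x, x ∈ Ω ↔ 0 < s x
  fderiv_ne_zero : ∀ x ∈ frontier Ω,
    fderiv ℝ (s ∘ (chartAt (ModelE n) x).symm) (chartAt (ModelE n) x x) ≠ 0

namespace IsPositiveDefining

variable {Ω : Set N} {s : N → ℝ}

lemma continuous (hs : IsPositiveDefining n Ω s) : Continuous s := hs.contMDiff.continuous

lemma isOpen (hs : IsPositiveDefining n Ω s) : IsOpen Ω := by
  have : Ω = s ⁻¹' Ioi 0 := by
    ext x
    exact hs.mem_iff x
  rw [this]
  exact isOpen_Ioi.preimage hs.continuous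

lemma isCompact_le (hs : IsPositiveDefining n Ω s) (hΩc : IsCompact (closure Ω)) {δ : ℝ}
    (hδ : 0 < δ) : IsCompact {x | δ ≤ s x} :=
  hΩc.of_isClosed_subset (isClosed_le continuous_const hs.continuous)
    fun x hx => subset_closure ((hs.mem_iff x).2 (hδ.trans_le hx))

lemma exists_partition [T2Space N] [SigmaCompactSpace N] [IsManifold 𝓘(ℝ, ModelE n) ∞ N]
    (hs : IsPositiveDefining n Ω s) (hΩc : IsCompact (closure Ω)) {U : N → Set N}
    (hU : ∀ x ∈ frontier Ω, IsOpen (U x) ∧ x ∈ U x) :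
    ∃ (t : Finset N) (ψ : N → N → ℝ) (δ₀ : ℝ), 0 < δ₀ ∧ (∀ x ∈ t, x ∈ frontier Ω) ∧
      (∀ x ∈ t, ContMDiff 𝓘(ℝ, ModelE n) 𝓘(ℝ, ℝ) ∞ (ψ x) ∧ tsupport (ψ x) ⊆ U x) ∧
      ∀ y ∈ Ω, s y < δ₀ → ∑ x ∈ t, ψ x y = 1 := by
  classical
  have hfc : IsCompact (frontier Ω) := hΩc.of_isClosed_subset isClosed_frontier
    frontier_subset_closure
  obtain ⟨t, htf, ht⟩ := hfc.elim_nhds_subcover U fun x hx => (hU x hx).1.mem_nhds (hU x hx).2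
  set V := ⋃ x ∈ t, U x
  have hV : IsOpen V := isOpen_biUnion fun x hx => (hU x (htf x hx)).1
  have hpos : ∀ y ∈ closure Ω \ V, 0 < s y := by
    intro y hy
    rw [← hs.mem_iff]
    by_contra hyΩ
    refine hy.2 (ht ?_)
    rw [hs.isOpen.frontier_eq]
    exact ⟨hy.1, hyΩ⟩
  obtain ⟨δ₀, hδ₀, hδ⟩ : ∃ δ₀ > 0, ∀ y ∈ closure Ω \ V, δ₀ ≤ s y := by
    rcases (closure Ω \ V).eq_empty_or_nonempty with h | h
    · exact ⟨1, one_pos, by simp [h]⟩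
    · obtain ⟨y, hy, hmin⟩ := (hΩc.diff hV).exists_isMinOn h hs.continuous.continuousOn
      exact ⟨s y, hpos y hy, fun z hz => hmin hz⟩
  set Z := closure Ω ∩ {y | s y ≤ δ₀ / 2}
  have hZ : IsClosed Z := isClosed_closure.inter (isClosed_le hs.continuous continuous_const)
  have hZV : Z ⊆ ⋃ x : t, U x := by
    intro y hy
    have : y ∈ V := by
      by_contra hyV
      have h1 := hδ y ⟨hy.1, hyV⟩
      have h2 : s y ≤ δ₀ / 2 := hy.2
      linarith
    simpa [V] using this
  obtain ⟨f, hf⟩ := SmoothPartitionOfUnity.exists_isSubordinate 𝓘(ℝ, ModelE n) hZ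
    (fun x : t => U x) (fun x => (hU x (htf x x.2)).1) hZV
  refine ⟨t, fun x => if hx : x ∈ t then f ⟨x, hx⟩ else 0, δ₀ / 2, half_pos hδ₀, htf, ?_, ?_⟩
  · intro x hx
    simp only [hx, dif_pos]
    exact ⟨(f ⟨x, hx⟩).contMDiff, hf ⟨x, hx⟩⟩
  · intro y hy hys
    have h1 := f.sum_eq_one (show y ∈ Z from ⟨subset_closure hy, hys.le⟩)
    rw [finsum_eq_sum_of_fintype] at h1
    rw [← h1, ← Finset.sum_coe_sort t]
    refine Finset.sum_congr rfl fun x _ => ?_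
    simp

end IsPositiveDefining

/-- A neighbourhood of `c` whose closure is a compact subset of the part of the chart at `c` over
`O'`. -/
lemma exists_chart_neighborhood {c : N} {O' : Set (ModelE n)} (hO' : IsOpen O')
    (hc : chartAt (ModelE n) c c ∈ O') :
    ∃ (K : Set (ModelE n)) (U : Set N), IsCompact K ∧ K ⊆ O' ∧ IsOpen U ∧ c ∈ U ∧
      U ⊆ (chartAt (ModelE n) c).source ∩ chartAt (ModelE n) c ⁻¹' K := by
  obtain ⟨K, hK, hcK, hKO⟩ := exists_compact_subset hO' hc
  exact ⟨K, _, hK, hKO, (chartAt (ModelE n) c).isOpen_inter_preimage isOpen_interior,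
    ⟨mem_chart_source _ c, hcK⟩, inter_subset_inter_right _ (preimage_mono interior_subset)⟩

variable {Ω : Set N} {s : N → ℝ}

lemma IsPositiveDefining.continuousOn_rpow (hs : IsPositiveDefining n Ω s) {δ : ℝ} (hδ : 0 < δ)
    (a : ℝ) : ContinuousOn (fun x => s x ^ a) {x | δ ≤ s x} := fun _ hx =>
  (hs.continuous.continuousAt.rpow_const
    (Or.inl (hδ.trans_le hx).ne')).continuousWithinAt

variable [MeasurableSpace N] [BorelSpace N] {μ : Measure N} {κ : N → N → ℝ}

/-- Integrals of functions supported in a chart as integrals over the model space. -/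
lemma HasChartDensity.exists_integral_mul_eq [IsManifold 𝓘(ℝ, ModelE n) ∞ N]
    (hμ : HasChartDensity n μ κ) {c : N}
    {K : Set (ModelE n)} (hK : IsCompact K) (hKt : K ⊆ (chartAt (ModelE n) c).target)
    {ψ : N → ℝ} (hψ : ContMDiff 𝓘(ℝ, ModelE n) 𝓘(ℝ, ℝ) ∞ ψ)
    (hψK : tsupport ψ ⊆ (chartAt (ModelE n) c).source ∩ chartAt (ModelE n) c ⁻¹' K) :
    ∃ h : ModelE n → ℝ, ContDiff ℝ ∞ h ∧ HasCompactSupport h ∧ tsupport h ⊆ K ∧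
      ∀ f : N → ℝ, Measurable f →
        ∫ x, f x * ψ x ∂μ = ∫ z, f ((chartAt (ModelE n) c).symm z) * h z := by
  set φ := chartAt (ModelE n) c
  set H : ModelE n → ℝ := fun z => ψ (φ.symm z) * κ c (φ.symm z)
  have hH : ContDiffOn ℝ ∞ H φ.target :=
    (contDiffOn_comp_chart_symm hψ.contMDiffOn).mul (contDiffOn_comp_chart_symm (hμ.contMDiffOn c))
  have h0 : ∀ z ∈ φ.target, z ∉ K → H z = 0 := by
    intro z hz hzK
    have : ψ (φ.symm z) = 0 := by
      refine image_eq_zero_of_notMem_tsupport fun h => hzK ?_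
      have := (hψK h).2
      rwa [mem_preimage, φ.right_inv hz] at this
    simp [H, this]
  obtain ⟨h1, h2⟩ := hH.contDiff_indicator φ.open_target hK hKt h0
  refine ⟨_, h1, h2, closure_minimal (fun z hz => ?_) hK.isClosed, fun f hf => ?_⟩
  · by_contra hzK
    apply hz
    by_cases hzt : z ∈ φ.target
    · rw [indicator_of_mem hzt, h0 z hzt hzK]
    · exact indicator_of_notMem hzt _
  · have e1 : ∫ x, f x * ψ x ∂μ = ∫ x in φ.source, f x * ψ x ∂μ := by
      refine (setIntegral_eq_integral_of_forall_compl_eq_zero fun x hx => ?_).symm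
      rw [image_eq_zero_of_notMem_tsupport fun h => hx (hψK h).1, mul_zero]
    have e2 : ∫ z, f (φ.symm z) * φ.target.indicator H z
        = ∫ z in φ.target, f (φ.symm z) * φ.target.indicator H z := by
      refine (setIntegral_eq_integral_of_forall_compl_eq_zero fun x hx => ?_).symm
      rw [indicator_of_notMem hx, mul_zero]
    rw [e1, e2, hμ.setIntegral_source c (f := fun x => f x * ψ x) (hf.mul hψ.continuous.measurable)]
    refine setIntegral_congr_fun φ.open_target.measurableSet fun z hz => ?_
    simp only [indicator_of_mem hz, H, mul_assoc, φ]

lemma IsPositiveDefining.integrableOn_of_continuousOn [T2Space N] [IsLocallyFiniteMeasure μ]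
    (hs : IsPositiveDefining n Ω s) (hΩc : IsCompact (closure Ω)) {δ : ℝ} (hδ : 0 < δ) {f : N → ℝ}
    (hf : ContinuousOn f {x | δ ≤ s x}) : IntegrableOn f {x | δ ≤ s x} μ :=
  hf.integrableOn_compact (hs.isCompact_le hΩc hδ)

/-- Integrals of `s^{-ν-1}` over the superlevel sets of a defining function. -/
theorem IsPositiveDefining.exists_expansion [T2Space N] [SigmaCompactSpace N]
    [IsManifold 𝓘(ℝ, ModelE n) ∞ N] (hμ : HasChartDensity n μ κ)
    (hs : IsPositiveDefining n Ω s) (hΩc : IsCompact (closure Ω)) {ν : ℝ} {J : ℕ}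
    (hJ : ∀ j < J, (j : ℝ) < ν) (hν : ν ≤ J) (hν0 : 0 ≤ ν) {m : N → ℝ}
    (hm : ContMDiff 𝓘(ℝ, ModelE n) 𝓘(ℝ, ℝ) ∞ m) :
    ∃ L V, HasPowerLogExpansion ν J
      (fun δ => ∫ x in {x | δ < s x}, s x ^ (-ν - 1) * m x ∂μ) L V ∧ (ν < J → L = 0) := by
  have := hμ.isLocallyFiniteMeasure
  have hloc : ∀ c ∈ frontier Ω, ∃ (K : Set (ModelE n)) (U : Set N), IsOpen U ∧ c ∈ U ∧
      IsCompact K ∧ K ⊆ (chartAt (ModelE n) c).target ∧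
      U ⊆ (chartAt (ModelE n) c).source ∩ chartAt (ModelE n) c ⁻¹' K ∧
      ∀ h : ModelE n → ℝ, ContDiff ℝ ∞ h → HasCompactSupport h → tsupport h ⊆ K →
      ∃ p : ℝ → ℝ, ContDiff ℝ ∞ p ∧ HasCompactSupport p ∧
        ∀ f : ℝ → ℝ, Measurable f → (∃ C, ∀ t, ‖f t‖ ≤ C) →
          ∫ y, f (s ((chartAt (ModelE n) c).symm y)) * h y = ∫ t, f t * p t := by
    intro c hc
    obtain ⟨O', h1, h2, h3, h4⟩ := exists_local_pushforward_density volume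
      (chartAt (ModelE n) c).open_target
      (contDiffOn_comp_chart_symm hs.contMDiff.contMDiffOn)
      ((chartAt (ModelE n) c).map_source (mem_chart_source _ c)) (hs.fderiv_ne_zero c hc)
    obtain ⟨K, U, hK, hKO, hU, hcU, hUK⟩ := exists_chart_neighborhood h1 h2
    exact ⟨K, U, hU, hcU, hK, hKO.trans h3, hUK, fun h hh hhc hhK => h4 h hh hhc (hhK.trans hKO)⟩
  choose! K U hU hcU hK hKt hUK hp using hloc
  obtain ⟨t, ψ, δ₀, hδ₀, htf, hψ, hsum⟩ := hs.exists_partition hΩc fun x hx => ⟨hU x hx, hcU x hx⟩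
  have hterm : ∀ c ∈ t, ∃ L V, HasPowerLogExpansion ν J
      (fun δ => ∫ x in {x | δ < s x}, s x ^ (-ν - 1) * (m x * ψ c x) ∂μ) L V ∧
      (ν < J → L = 0) := by
    intro c hct
    have hc := htf c hct
    obtain ⟨h, hh, hhc, hhK, hint⟩ := hμ.exists_integral_mul_eq (hK c hc) (hKt c hc)
      (ψ := fun x => m x * ψ c x) (hm.mul (hψ c hct).1)
      ((closure_mono (Function.support_mul_subset_right _ _)).trans
        ((hψ c hct).2.trans (hUK c hc)))
    obtain ⟨p, hps, hpc, hpf⟩ := hp c hc h hh hhc hhK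
    obtain ⟨L, V, hLV, hL⟩ := hasPowerLogExpansion_integral_Ioi hJ hν hps hpc
    refine ⟨L, V, hLV.congr' ?_, hL⟩
    filter_upwards [self_mem_nhdsWithin] with δ hδ
    have hδ : 0 < δ := hδ
    set F : ℝ → ℝ := (Ioi δ).indicator fun t => t ^ (-ν - 1) with hF
    have hFm : Measurable F := (measurable_id.pow_const _).indicator measurableSet_Ioi
    have hFb : ∃ C, ∀ t, ‖F t‖ ≤ C := by
      refine ⟨δ ^ (-ν - 1), fun t => ?_⟩
      by_cases ht : t ∈ Ioi δ
      · rw [hF, indicator_of_mem ht,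
          Real.norm_of_nonneg (Real.rpow_nonneg (hδ.le.trans (le_of_lt ht)) _)]
        exact Real.rpow_le_rpow_of_nonpos hδ (le_of_lt ht) (by linarith)
      · rw [hF, indicator_of_notMem ht, norm_zero]
        exact Real.rpow_nonneg hδ.le _
    have e1 : ∫ x in {x | δ < s x}, s x ^ (-ν - 1) * (m x * ψ c x) ∂μ
        = ∫ x, F (s x) * (m x * ψ c x) ∂μ := by
      rw [← integral_indicator (measurableSet_lt measurable_const hs.continuous.measurable)]
      congr 1
      ext x
      by_cases hx : δ < s x
      · simp [hF, indicator, hx]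
      · simp [hF, indicator, hx]
    rw [e1, hint (fun x => F (s x)) (hFm.comp hs.continuous.measurable), hpf F hFm hFb,
      ← integral_indicator measurableSet_Ioi]
    congr 1
    ext x
    by_cases hx : x ∈ Ioi δ
    · simp [hF, hx]
    · simp [hF, hx]
  choose! L V hLV hL using hterm
  set ψ₀ : N → ℝ := fun x => 1 - ∑ c ∈ t, ψ c x
  have hψ₀c : Continuous ψ₀ := continuous_const.sub
    (continuous_finsetSum _ fun c hc => (hψ c hc).1.continuous)
  set W := ∫ x in {x | δ₀ ≤ s x}, s x ^ (-ν - 1) * (m x * ψ₀ x) ∂μ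
  refine ⟨∑ c ∈ t, L c + 0, ∑ c ∈ t, V c + W, ?_, fun h => ?_⟩
  · refine ((HasPowerLogExpansion.sum t hLV).add (HasPowerLogExpansion.of_tendsto
      (A := fun _ => W) tendsto_const_nhds)).congr' ?_
    filter_upwards [Ioo_mem_nhdsGT_zero hδ₀] with δ hδ
    have hsub : {x | δ < s x} ⊆ {x | δ ≤ s x} := fun x hx => show δ ≤ s x from le_of_lt hx
    have hI : ∀ q : N → ℝ, Continuous q →
        IntegrableOn (fun x => s x ^ (-ν - 1) * (m x * q x)) {x | δ < s x} μ := fun q hq =>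
      (hs.integrableOn_of_continuousOn hΩc hδ.1 ((hs.continuousOn_rpow hδ.1 _).mul
        (hm.continuous.mul hq).continuousOn)).mono_set hsub
    have hW : W = ∫ x in {x | δ < s x}, s x ^ (-ν - 1) * (m x * ψ₀ x) ∂μ := by
      refine setIntegral_eq_of_subset_of_forall_sdiff_eq_zero
        (measurableSet_lt measurable_const hs.continuous.measurable)
        (fun x hx => show δ < s x from hδ.2.trans_le hx) (fun x hx => ?_) |>.symm
      have h1 : δ < s x := hx.1
      have h2 : ψ₀ x = 0 := by
        simp only [ψ₀]
        rw [hsum x ((hs.mem_iff x).2 (hδ.1.trans h1)) (not_le.1 hx.2), sub_self]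
      rw [h2, mul_zero, mul_zero]
    rw [hW, ← integral_finsetSum _ fun c hc => hI (ψ c) (hψ c hc).1.continuous,
      ← integral_add (integrable_finsetSum _ fun c hc => hI (ψ c) (hψ c hc).1.continuous)
        (hI ψ₀ hψ₀c)]
    refine integral_congr_ae (ae_of_all _ fun x => ?_)
    simp only [ψ₀, ← Finset.mul_sum]
    ring
  · rw [Finset.sum_eq_zero fun c hc => hL c hc h, add_zero]

end GlobalExpansion

/-! ### Averages over the superlevel sets of a function -/

lemma smoothCutoff_nonneg (x : ℝ) : 0 ≤ smoothCutoff x := Real.smoothTransition.nonneg _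

lemma smoothCutoff_le_one (x : ℝ) : smoothCutoff x ≤ 1 := Real.smoothTransition.le_one _

lemma monotone_smoothCutoff : Monotone smoothCutoff := fun x y hxy =>
  Real.smoothTransition.monotone (by linarith)

lemma continuous_deriv_smoothCutoff : Continuous (deriv smoothCutoff) :=
  smoothCutoff_contDiff.continuous_deriv (by simp)

lemma deriv_smoothCutoff_of_le {x : ℝ} (h : x ≤ 1) : deriv smoothCutoff x = 0 :=
  IsLocalMin.deriv_eq_zero <| Filter.Eventually.of_forall fun y => by
    rw [smoothCutoff_of_le h]
    exact smoothCutoff_nonneg y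

lemma deriv_smoothCutoff_of_ge {x : ℝ} (h : 2 ≤ x) : deriv smoothCutoff x = 0 :=
  IsLocalMax.deriv_eq_zero <| Filter.Eventually.of_forall fun y => by
    rw [smoothCutoff_of_ge h]
    exact smoothCutoff_le_one y

lemma integral_deriv_smoothCutoff (a b : ℝ) :
    ∫ q in a..b, deriv smoothCutoff q = smoothCutoff b - smoothCutoff a :=
  intervalIntegral.integral_deriv_eq_sub
    (fun x _ => (smoothCutoff_contDiff.differentiable (by simp)).differentiableAt)
    (continuous_deriv_smoothCutoff.intervalIntegrable _ _)

section LayerCake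

variable {X : Type*} [MeasurableSpace X] {ρ : Measure X} {f : X → ℝ}

lemma integrable_smoothCutoff_div (hf : Measurable f) (hfin : ∀ δ > 0, ρ {x | δ < f x} < ⊤)
    {δ : ℝ} (hδ : 0 < δ) : Integrable (fun x => smoothCutoff (f x / δ)) ρ := by
  have hm : MeasurableSet {x | δ < f x} := measurableSet_lt measurable_const hf
  have h1 : Integrable ({x | δ < f x}.indicator fun _ => (1 : ℝ)) ρ :=
    (integrable_indicator_iff hm).2 (integrableOn_const (hfin δ hδ).ne)
  refine h1.mono' (smoothCutoff_contDiff.continuous.measurable.comp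
    (hf.div_const δ)).aestronglyMeasurable (ae_of_all _ fun x => ?_)
  rw [Real.norm_of_nonneg (smoothCutoff_nonneg _)]
  by_cases hx : δ < f x
  · rw [indicator_of_mem (show x ∈ {x | δ < f x} from hx)]
    exact smoothCutoff_le_one _
  · rw [smoothCutoff_of_le ((div_le_one hδ).2 (not_lt.1 hx))]
    exact indicator_nonneg (fun _ _ => zero_le_one) _

lemma antitoneOn_measureReal_lt (hfin : ∀ δ > 0, ρ {x | δ < f x} < ⊤) :
    AntitoneOn (fun δ => ρ.real {x | δ < f x}) (Ioi 0) := fun a ha _ _ hab =>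
  measureReal_mono (fun x hx => show a < f x from hab.trans_lt hx) (hfin a ha).ne

/-- A smoothed volume of a superlevel set is an average of the volumes of superlevel sets. -/
lemma integral_smoothCutoff_div (hf : Measurable f) (hfin : ∀ δ > 0, ρ {x | δ < f x} < ⊤)
    {δ : ℝ} (hδ : 0 < δ) :
    ∫ x, smoothCutoff (f x / δ) ∂ρ
      = ∫ q in (1 : ℝ)..2, deriv smoothCutoff q * ρ.real {x | δ * q < f x} := by
  set F : X → ℝ := fun x => max (f x / δ) 0
  have hF : Measurable F := (hf.div_const δ).max measurable_const
  have hFχ : ∀ x, ∫ t in (0 : ℝ)..F x, deriv smoothCutoff t = smoothCutoff (f x / δ) := by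
    intro x
    rw [integral_deriv_smoothCutoff, smoothCutoff_of_le zero_le_one, sub_zero]
    rcases le_total (f x / δ) 0 with h | h
    · simp only [F, max_eq_right h]
      rw [smoothCutoff_of_le zero_le_one, smoothCutoff_of_le (h.trans zero_le_one)]
    · simp only [F, max_eq_left h]
  have hset : ∀ q ∈ Ioi (0 : ℝ), {x | δ * q < f x} = {x | q < F x} := by
    intro q hq
    ext x
    have hq : 0 < q := hq
    simp [F, lt_div_iff₀ hδ, mul_comm q, not_lt.2 hq.le]
  have hχ' : ∀ t, 0 ≤ deriv smoothCutoff t := fun t => monotone_smoothCutoff.deriv_nonneg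
  have hlc := lintegral_comp_eq_lintegral_meas_lt_mul ρ (f := F) (g := deriv smoothCutoff)
    (ae_of_all _ fun x => le_max_right _ _) hF.aemeasurable
    (fun t _ => continuous_deriv_smoothCutoff.intervalIntegrable _ _) (ae_of_all _ hχ')
  simp only [hFχ] at hlc
  have e1 : ∫ q in (1 : ℝ)..2, deriv smoothCutoff q * ρ.real {x | δ * q < f x}
      = ∫ q in Ioi 0, deriv smoothCutoff q * ρ.real {x | δ * q < f x} := by
    rw [intervalIntegral.integral_of_le one_le_two]
    refine (setIntegral_eq_of_subset_of_forall_sdiff_eq_zero measurableSet_Ioi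
      (fun q hq => show (0 : ℝ) < q from one_pos.trans hq.1) fun q hq => ?_).symm
    rcases le_or_gt q 1 with h | h
    · rw [deriv_smoothCutoff_of_le h, zero_mul]
    · rw [deriv_smoothCutoff_of_ge (not_lt.1 fun h2 => hq.2 ⟨h, h2.le⟩), zero_mul]
  have hanti : AntitoneOn (fun q => ρ.real {x | δ * q < f x}) (Ioi 0) := by
    intro a ha b hb hab
    exact antitoneOn_measureReal_lt hfin (mul_pos hδ ha) (mul_pos hδ hb)
      (mul_le_mul_of_nonneg_left hab hδ.le)
  rw [e1, integral_eq_lintegral_of_nonneg_ae (ae_of_all _ fun x => smoothCutoff_nonneg _)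
    (integrable_smoothCutoff_div hf hfin hδ).aestronglyMeasurable,
    integral_eq_lintegral_of_nonneg_ae
      (ae_of_all _ fun q => mul_nonneg (hχ' q) measureReal_nonneg)
      (continuous_deriv_smoothCutoff.aestronglyMeasurable.mul
        (aemeasurable_restrict_of_antitoneOn measurableSet_Ioi hanti).aestronglyMeasurable), hlc]
  congr 1
  refine setLIntegral_congr_fun measurableSet_Ioi fun q hq => ?_
  rw [ENNReal.ofReal_mul (hχ' q), mul_comm, measureReal_def,
    ENNReal.ofReal_toReal (hfin _ (mul_pos hδ hq)).ne, hset q hq]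

end LayerCake

section Comparison

variable {n : ℕ} {N : Type*} [TopologicalSpace N] [ChartedSpace (ModelE n) N]
  [MeasurableSpace N] [BorelSpace N] {μ : Measure N} {κ : N → N → ℝ} {Ω : Set N} {s s' : N → ℝ}

/-! ### Change of the defining function -/

/-- The regularized integrals of `s^{-ν-1}` for two defining functions `s` and `s e^β` differ by
a quantity whose expansion has no logarithm, and no constant term if `ν` is not an integer. -/
theorem IsPositiveDefining.exists_expansion_cutoff_difference [T2Space N] [SigmaCompactSpace N]
    [IsManifold 𝓘(ℝ, ModelE n) ∞ N] (hμ : HasChartDensity n μ κ)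
    (hs : IsPositiveDefining n Ω s) (hΩc : IsCompact (closure Ω)) {ν : ℝ} {J : ℕ}
    (hν : ν ≤ J) {β : N → ℝ} (hβ : ContMDiff 𝓘(ℝ, ModelE n) 𝓘(ℝ, ℝ) ∞ β) :
    ∃ V, HasPowerLogExpansion ν J (fun δ => ∫ x, (smoothCutoff (s x * Real.exp (β x) / δ)
      - smoothCutoff (s x / δ)) * s x ^ (-ν - 1) ∂μ) 0 V ∧ (ν < J → V = 0) := by
  have := hμ.isLocallyFiniteMeasure
  set Φ : ℝ → N → ℝ := fun δ x => (smoothCutoff (s x * Real.exp (β x) / δ)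
      - smoothCutoff (s x / δ)) * s x ^ (-ν - 1) with hΦ
  have hχ : Measurable smoothCutoff := smoothCutoff_contDiff.continuous.measurable
  have hΦm : ∀ δ, Measurable (Φ δ) := fun δ =>
    ((hχ.comp ((hs.continuous.mul (Real.continuous_exp.comp
      hβ.continuous)).measurable.div_const δ)).sub
      (hχ.comp (hs.continuous.measurable.div_const δ))).mul (hs.continuous.measurable.pow_const _)
  obtain ⟨b, hb0, hb⟩ : ∃ b, 0 ≤ b ∧ ∀ x ∈ Ω, |β x| ≤ b := by
    obtain ⟨b, hb⟩ := hΩc.exists_bound_of_continuousOn hβ.continuous.continuousOn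
    exact ⟨max b 0, le_max_right _ _, fun x hx =>
      (hb x (subset_closure hx)).trans (le_max_left _ _)⟩
  have hexp : ∀ x ∈ Ω, Real.exp (-b) ≤ Real.exp (β x) ∧ Real.exp (β x) ≤ Real.exp b := fun x hx =>
    ⟨Real.exp_le_exp.2 (abs_le.1 (hb x hx)).1, Real.exp_le_exp.2 (abs_le.1 (hb x hx)).2⟩
  have hΦ0 : ∀ δ > 0, ∀ x, s x < δ * Real.exp (-b) → Φ δ x = 0 := by
    intro δ hδ x hx
    have h1 : s x ≤ δ := hx.le.trans
      (mul_le_of_le_one_right hδ.le (Real.exp_le_one_iff.2 (by linarith)))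
    have h2 : s x * Real.exp (β x) ≤ δ := by
      by_cases hxΩ : x ∈ Ω
      · calc s x * Real.exp (β x) ≤ δ * Real.exp (-b) * Real.exp b :=
            mul_le_mul hx.le (hexp x hxΩ).2 (Real.exp_pos _).le
              (mul_pos hδ (Real.exp_pos _)).le
          _ = δ := by rw [mul_assoc, ← Real.exp_add, neg_add_cancel, Real.exp_zero, mul_one]
      · rw [hs.mem_iff, not_lt] at hxΩ
        exact (mul_nonpos_of_nonpos_of_nonneg hxΩ (Real.exp_pos _).le).trans hδ.le
    simp only [hΦ]
    rw [smoothCutoff_of_le ((div_le_one hδ).2 h1), smoothCutoff_of_le ((div_le_one hδ).2 h2),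
      sub_self, zero_mul]
  have hΦ1 : ∀ δ > 0, ∀ x ∈ Ω, 2 * δ * Real.exp b ≤ s x → Φ δ x = 0 := by
    intro δ hδ x hxΩ hx
    have h1 : 2 * δ ≤ s x := (le_mul_of_one_le_right (by positivity)
      (Real.one_le_exp_iff.2 hb0)).trans hx
    have h2 : 2 * δ ≤ s x * Real.exp (β x) := by
      calc 2 * δ = 2 * δ * Real.exp b * Real.exp (-b) := by
            rw [mul_assoc (2 * δ), ← Real.exp_add, add_neg_cancel, Real.exp_zero, mul_one]
        _ ≤ s x * Real.exp (β x) := mul_le_mul hx (hexp x hxΩ).1 (Real.exp_pos _).le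
              ((hs.mem_iff x).1 hxΩ).le
    simp only [hΦ]
    rw [smoothCutoff_of_ge ((le_div_iff₀ hδ).2 h1), smoothCutoff_of_ge ((le_div_iff₀ hδ).2 h2),
      sub_self, zero_mul]
  have hI : ∀ δ > 0, ∀ q : N → ℝ, Continuous q → Integrable (fun x => Φ δ x * q x) μ := by
    intro δ hδ q hq
    have hδb : 0 < δ * Real.exp (-b) := mul_pos hδ (Real.exp_pos _)
    refine (integrableOn_iff_integrable_of_support_subset
      (s := {x | δ * Real.exp (-b) ≤ s x}) fun x hx => ?_).1
      (hs.integrableOn_of_continuousOn hΩc hδb (ContinuousOn.mul (ContinuousOn.mul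
        (Continuous.continuousOn ?_) (hs.continuousOn_rpow hδb _)) hq.continuousOn))
    · by_contra hlt
      exact hx (by simp only [hΦ0 δ hδ x (not_le.1 hlt), zero_mul])
    · have hc := smoothCutoff_contDiff.continuous
      exact (hc.comp ((hs.continuous.mul (Real.continuous_exp.comp hβ.continuous)).div_const δ)).sub
        (hc.comp (hs.continuous.div_const δ))
  have hloc : ∀ c ∈ frontier Ω, ∃ (K : Set (ModelE n)) (U : Set N), IsOpen U ∧ c ∈ U ∧
      IsCompact K ∧ K ⊆ (chartAt (ModelE n) c).target ∧
      U ⊆ (chartAt (ModelE n) c).source ∩ chartAt (ModelE n) c ⁻¹' K ∧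
      ∀ h : ModelE n → ℝ, ContDiff ℝ ∞ h → HasCompactSupport h → tsupport h ⊆ K →
      ∃ G : ℝ → ℝ, ContDiff ℝ ∞ G ∧ ∀ δ > 0,
        ∫ y, Φ δ ((chartAt (ModelE n) c).symm y) * h y = δ ^ (-ν) * G δ := by
    intro c hc
    obtain ⟨O', h1, h2, h3, h4⟩ := exists_local_cutoff_difference volume
      (chartAt (ModelE n) c).open_target
      (contDiffOn_comp_chart_symm hs.contMDiff.contMDiffOn)
      ((chartAt (ModelE n) c).map_source (mem_chart_source _ c)) (hs.fderiv_ne_zero c hc) ν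
    obtain ⟨K, U, hK, hKO, hU, hcU, hUK⟩ := exists_chart_neighborhood h1 h2
    exact ⟨K, U, hU, hcU, hK, hKO.trans h3, hUK, fun h hh hhc hhK => h4 h hh hhc (hhK.trans hKO)
      _ ((contDiffOn_comp_chart_symm hβ.contMDiffOn).mono h3)⟩
  choose! K U hU hcU hK hKt hUK hG using hloc
  obtain ⟨t, ψ, δ₀, hδ₀, htf, hψ, hsum⟩ := hs.exists_partition hΩc fun x hx => ⟨hU x hx, hcU x hx⟩
  have hterm : ∀ c ∈ t, ∃ V, HasPowerLogExpansion ν J (fun δ => ∫ x, Φ δ x * ψ c x ∂μ) 0 V ∧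
      (ν < J → V = 0) := by
    intro c hct
    have hc := htf c hct
    obtain ⟨h, hh, hhc, hhK, hint⟩ := hμ.exists_integral_mul_eq (hK c hc) (hKt c hc)
      (hψ c hct).1 ((hψ c hct).2.trans (hUK c hc))
    obtain ⟨G, hGs, hGe⟩ := hG c hc h hh hhc hhK
    obtain ⟨V, hV, hV0⟩ := hasPowerLogExpansion_rpow_mul hν hGs
    refine ⟨V, hV.congr' ?_, hV0⟩
    filter_upwards [self_mem_nhdsWithin] with δ hδ
    rw [hint _ (hΦm δ), hGe δ hδ]
  choose! V hV hV0 using hterm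
  refine ⟨∑ c ∈ t, V c, ?_, fun h => Finset.sum_eq_zero fun c hc => hV0 c hc h⟩
  have hsumE := HasPowerLogExpansion.sum t hV
  rw [Finset.sum_const_zero] at hsumE
  refine hsumE.congr' ?_
  filter_upwards [Ioo_mem_nhdsGT_zero (show 0 < δ₀ / (2 * Real.exp b) by positivity)] with δ hδ
  rw [← integral_finsetSum _ fun c hc => hI δ hδ.1 (ψ c) (hψ c hc).1.continuous]
  refine integral_congr_ae (ae_of_all _ fun x => ?_)
  simp only [← Finset.mul_sum]
  by_cases hxΩ : x ∈ Ω
  · rcases lt_or_ge (s x) δ₀ with h | h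
    · rw [hsum x hxΩ h, mul_one]
    · have hδ' : δ * (2 * Real.exp b) < δ₀ := (lt_div_iff₀ (by positivity)).1 hδ.2
      have h0 := hΦ1 δ hδ.1 x hxΩ (by linarith)
      rw [h0, zero_mul]
      exact h0.symm
  · rw [hs.mem_iff, not_lt] at hxΩ
    have h0 := hΦ0 δ hδ.1 x (hxΩ.trans_lt (mul_pos hδ.1 (Real.exp_pos _)))
    rw [h0, zero_mul]
    exact h0.symm

lemma IsPositiveDefining.integrableOn_rpow [T2Space N] [IsLocallyFiniteMeasure μ]
    (hs : IsPositiveDefining n Ω s) (hs' : IsPositiveDefining n Ω s')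
    (hΩc : IsCompact (closure Ω)) (a : ℝ) {δ : ℝ} (hδ : 0 < δ) :
    IntegrableOn (fun x => s x ^ a) {x | δ < s' x} μ := by
  refine (hs'.integrableOn_of_continuousOn hΩc hδ fun x hx => ?_).mono_set
    fun x hx => show δ ≤ s' x from le_of_lt hx
  exact (hs.continuous.continuousAt.rpow_const (Or.inl ((hs.mem_iff x).1
    ((hs'.mem_iff x).2 (hδ.trans_le hx))).ne')).continuousWithinAt

/-- The coefficient of the logarithm in the expansion of the integral of `s^{-ν-1}` over the
superlevel sets of a defining function does not depend on this function; neither does the constant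
term, if `ν` is not an integer. -/
theorem IsPositiveDefining.expansion_unique [T2Space N] [SigmaCompactSpace N]
    [IsManifold 𝓘(ℝ, ModelE n) ∞ N] (hμ : HasChartDensity n μ κ)
    (hs : IsPositiveDefining n Ω s) (hs' : IsPositiveDefining n Ω s')
    (hΩc : IsCompact (closure Ω)) {ν : ℝ} {J : ℕ} (hJ : ∀ j < J, (j : ℝ) < ν) (hν : ν ≤ J)
    {β : N → ℝ} (hβ : ContMDiff 𝓘(ℝ, ModelE n) 𝓘(ℝ, ℝ) ∞ β)
    (hss' : ∀ x, s' x = s x * Real.exp (β x)) {L V L' V' : ℝ}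
    (h : HasPowerLogExpansion ν J (fun δ => ∫ x in {x | δ < s x}, s x ^ (-ν - 1) ∂μ) L V)
    (h' : HasPowerLogExpansion ν J (fun δ => ∫ x in {x | δ < s' x}, s x ^ (-ν - 1) ∂μ) L' V') :
    L' = L ∧ (ν < J → L = 0 → V' = V) := by
  have := hμ.isLocallyFiniteMeasure
  set w : N → ℝ≥0∞ := fun x => ENNReal.ofReal (s x ^ (-ν - 1))
  have hw : Measurable w := (hs.continuous.measurable.pow_const _).ennreal_ofReal
  set ρ := (μ.restrict Ω).withDensity w with hρ
  have happly : ∀ f : N → ℝ, IsPositiveDefining n Ω f → ∀ δ > 0,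
      ρ {x | δ < f x} = ∫⁻ x in {x | δ < f x}, w x ∂μ := by
    intro f hf δ hδ
    have hm : MeasurableSet {x | δ < f x} :=
      measurableSet_lt measurable_const hf.continuous.measurable
    rw [hρ, withDensity_apply _ hm, Measure.restrict_restrict hm,
      inter_eq_self_of_subset_left
        (show {x | δ < f x} ⊆ Ω from fun x hx => (hf.mem_iff x).2 (hδ.trans hx))]
  have hfin : ∀ f : N → ℝ, IsPositiveDefining n Ω f → ∀ δ > 0, ρ {x | δ < f x} < ⊤ := by
    intro f hf δ hδ
    rw [happly f hf δ hδ]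
    exact (hs.integrableOn_rpow hf hΩc _ hδ).lintegral_lt_top
  have hreal : ∀ f : N → ℝ, IsPositiveDefining n Ω f → ∀ δ > 0,
      ∫ x in {x | δ < f x}, s x ^ (-ν - 1) ∂μ = ρ.real {x | δ < f x} := by
    intro f hf δ hδ
    rw [measureReal_def, happly f hf δ hδ, integral_eq_lintegral_of_nonneg_ae]
    · refine (ae_restrict_iff' (measurableSet_lt measurable_const hf.continuous.measurable)).2
        (ae_of_all _ fun x hx => ?_)
      exact Real.rpow_nonneg ((hs.mem_iff x).1 ((hf.mem_iff x).2 (hδ.trans hx))).le _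
    · exact (hs.continuous.measurable.pow_const _).aestronglyMeasurable
  have havg : ∀ f : N → ℝ, IsPositiveDefining n Ω f → ∀ L V : ℝ,
      HasPowerLogExpansion ν J (fun δ => ∫ x in {x | δ < f x}, s x ^ (-ν - 1) ∂μ) L V →
      ∃ W, HasPowerLogExpansion ν J (fun δ => ∫ x, smoothCutoff (f x / δ) ∂ρ) L W ∧
        (L = 0 → W = V) := by
    intro f hf L V hf'
    obtain ⟨W, hW, hWV⟩ := (hf'.congr' (B := fun δ => ρ.real {x | δ < f x}) (by
      filter_upwards [self_mem_nhdsWithin] with δ hδ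
      exact hreal f hf δ hδ)).average (antitoneOn_measureReal_lt (hfin f hf))
        continuous_deriv_smoothCutoff (by
          rw [integral_deriv_smoothCutoff, smoothCutoff_of_ge le_rfl, smoothCutoff_of_le le_rfl,
            sub_zero])
    refine ⟨W, hW.congr' ?_, hWV⟩
    filter_upwards [self_mem_nhdsWithin] with δ hδ
    exact (integral_smoothCutoff_div hf.continuous.measurable (hfin f hf) hδ).symm
  obtain ⟨W, hW, hWV⟩ := havg s hs L V h
  obtain ⟨W', hW', hWV'⟩ := havg s' hs' L' V' h'
  obtain ⟨Z, hZ, hZ0⟩ := hs.exists_expansion_cutoff_difference hμ hΩc hν hβ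
  have hdiff := (hW'.sub hW).congr' (B := fun δ => ∫ x, (smoothCutoff (s x * Real.exp (β x) / δ)
      - smoothCutoff (s x / δ)) * s x ^ (-ν - 1) ∂μ) (by
    filter_upwards [self_mem_nhdsWithin] with δ hδ
    have hδ : 0 < δ := hδ
    rw [← integral_sub (integrable_smoothCutoff_div hs'.continuous.measurable (hfin s' hs') hδ)
      (integrable_smoothCutoff_div hs.continuous.measurable (hfin s hs) hδ), hρ,
      integral_withDensity_eq_integral_toReal_smul hw (ae_of_all _ fun _ => ENNReal.ofReal_lt_top),
      ← setIntegral_eq_integral_of_forall_compl_eq_zero (s := Ω)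
        (f := fun x => (smoothCutoff (s x * Real.exp (β x) / δ)
          - smoothCutoff (s x / δ)) * s x ^ (-ν - 1)) ?_]
    · refine setIntegral_congr_fun hs.isOpen.measurableSet fun x hx => ?_
      simp only [w]
      rw [ENNReal.toReal_ofReal (Real.rpow_nonneg ((hs.mem_iff x).1 hx).le _), smul_eq_mul,
        mul_comm, hss']
    · intro x hx
      rw [hs.mem_iff, not_lt] at hx
      rw [smoothCutoff_of_le ((div_nonpos_of_nonpos_of_nonneg hx hδ.le).trans zero_le_one),
        smoothCutoff_of_le ((div_nonpos_of_nonpos_of_nonneg (mul_nonpos_of_nonpos_of_nonneg hx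
          (Real.exp_pos _).le) hδ.le).trans zero_le_one), sub_self, zero_mul])
  obtain ⟨hL, hV⟩ := hdiff.unique hJ hZ
  have hLL : L' = L := by linarith
  refine ⟨hLL, fun hνJ hL0 => ?_⟩
  have h1 := hWV hL0
  have h2 := hWV' (hLL.trans hL0)
  have h3 := hZ0 hνJ
  linarith

end Comparison

/-! ### The volume expansion -/

lemma HasPowerLogExpansion.hasVolExpansion {n : ℕ} {A : ℝ → ℝ} {L V : ℝ}
    (h : HasPowerLogExpansion ((n : ℝ) / 2) ((n + 1) / 2) A L V) :
    ∃ c : ℕ → ℝ, HasVolExpansion n (fun ε => A (ε ^ 2)) c (2 * L) V := by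
  obtain ⟨c, hc⟩ := h
  have hsq : Tendsto (fun ε : ℝ => ε ^ 2) (𝓝[>] 0) (𝓝[>] 0) := by
    refine tendsto_nhdsWithin_iff.2 ⟨tendsto_nhdsWithin_of_tendsto_nhds ?_, ?_⟩
    · have := (continuous_pow 2).tendsto (0 : ℝ)
      rwa [zero_pow two_ne_zero] at this
    · filter_upwards [self_mem_nhdsWithin] with ε hε
      exact pow_pos (show 0 < ε from hε) 2
  refine ⟨c, (hc.comp hsq).congr' ?_⟩
  filter_upwards [self_mem_nhdsWithin] with ε hε
  have hε : 0 < ε := hε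
  have h1 : ∀ j : ℕ, (ε ^ 2) ^ ((j : ℝ) - (n : ℝ) / 2) = ε ^ (-(n : ℤ) + 2 * (j : ℤ)) := by
    intro j
    rw [← Real.rpow_natCast, ← Real.rpow_mul hε.le, ← Real.rpow_intCast]
    congr 1
    push_cast
    ring
  have h2 : Real.log (1 / ε ^ 2) = 2 * Real.log (1 / ε) := by
    rw [one_div, one_div, Real.log_inv, Real.log_inv, Real.log_pow]
    push_cast
    ring
  simp only [Function.comp_apply, h1, h2]
  ring

section VolumeExpansion

variable {n : ℕ} {N : Type*} [TopologicalSpace N] [ChartedSpace (ModelE n) N]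
  [IsManifold 𝓘(ℝ, ModelE n) ∞ N]
  {g : (x : N) → TangentSpace 𝓘(ℝ, ModelE n) x →L[ℝ] TangentSpace 𝓘(ℝ, ModelE n) x →L[ℝ] ℝ}
  {Ω : Set N} {r : ProjDensity n N 2} {σ τ : ProjDensity n N 1}

lemma IsDefiningDensity.isPositiveDefining (hr : IsDefiningDensity Ω r)
    (hτ : IsProjectiveScale τ) : IsPositiveDefining n Ω (scaledDefining r τ) where
  contMDiff := contMDiff_scaledDefining hr.1 hτ
  mem_iff _ := hr.mem_iff hτ
  fderiv_ne_zero x hx :=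
    fderiv_scaledDefining_ne_zero hr.1 hτ (hr.eq_zero_of_mem_frontier hτ hx) (hr.2.2 x hx)

lemma IsDefiningDensity.setOf_scaledU_lt (hr : IsDefiningDensity Ω r) (hτ : IsProjectiveScale τ)
    {ε : ℝ} (hε : 0 < ε) :
    {x | x ∈ Ω ∧ scaledU r τ x < -ε} = {x | ε ^ 2 < scaledDefining r τ x} := by
  ext x
  have h1 : scaledU r τ x < -ε ↔ ε ^ 2 < scaledDefining r τ x := by
    rw [scaledU, neg_div, neg_lt_neg_iff, scaledDefining, ← Real.lt_sqrt hε.le,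
      Real.sqrt_div' _ (sq_nonneg _), Real.sqrt_sq (hτ.val_pos x).le]
  exact ⟨fun h => h1.1 h.2, fun h => ⟨(hr.mem_iff hτ).2 ((pow_pos hε 2).trans h), h1.2 h⟩⟩

section Measure

variable [MeasurableSpace N] [BorelSpace N] {μ : Measure N}

lemma integrableOn_volumeRatio [T2Space N] [IsLocallyFiniteMeasure μ] (hr : IsDefiningDensity Ω r)
    (hΩc : IsCompact (closure Ω)) (hg : IsRiemannianMetricOn Ω g) (hσ : IsProjectiveScale σ)
    (hτ : IsProjectiveScale τ) {δ : ℝ} (hδ : 0 < δ) :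
    IntegrableOn (volumeRatio g σ) {x | δ < scaledDefining r τ x} μ := by
  refine ((hr.isPositiveDefining hτ).integrableOn_of_continuousOn hΩc hδ
    ((continuousOn_volumeRatio (hr.isOpen hτ) hg hσ).mono fun x hx =>
      (hr.mem_iff hτ).2 (hδ.trans_le hx))).mono_set fun x hx => ?_
  exact show δ ≤ scaledDefining r τ x from le_of_lt hx

lemma sublevelVol_eq (hr : IsDefiningDensity Ω r) (hΩc : IsCompact (closure Ω))
    (hg : IsRiemannianMetricOn Ω g) (hσ : IsProjectiveScale σ)
    (hμ : HasChartDensity n μ (scaleDensity σ)) (hτ : IsProjectiveScale τ) {ε : ℝ} (hε : 0 < ε) :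
    sublevelVol g Ω r τ ε
      = ∫⁻ x in {x | ε ^ 2 < scaledDefining r τ x}, ENNReal.ofReal (volumeRatio g σ x) ∂μ := by
  have hs := hr.isPositiveDefining hτ
  rw [sublevelVol, hr.setOf_scaledU_lt hτ hε]
  exact riemVol_eq_setLIntegral hs.isOpen hΩc hg hσ hμ
    (measurableSet_lt measurable_const hs.continuous.measurable)
    fun x hx => (hs.mem_iff x).2 ((pow_pos hε 2).trans hx)

lemma sublevelVol_lt_top [T2Space N] (hr : IsDefiningDensity Ω r) (hΩc : IsCompact (closure Ω))
    (hg : IsRiemannianMetricOn Ω g) (hσ : IsProjectiveScale σ)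
    (hμ : HasChartDensity n μ (scaleDensity σ)) (hτ : IsProjectiveScale τ) {ε : ℝ} (hε : 0 < ε) :
    sublevelVol g Ω r τ ε < ⊤ := by
  have := hμ.isLocallyFiniteMeasure
  rw [sublevelVol_eq hr hΩc hg hσ hμ hτ hε]
  exact (integrableOn_volumeRatio hr hΩc hg hσ hτ (pow_pos hε 2)).lintegral_lt_top

lemma toReal_sublevelVol [T2Space N] (hr : IsDefiningDensity Ω r) (hΩc : IsCompact (closure Ω))
    (hg : IsRiemannianMetricOn Ω g) (hσ : IsProjectiveScale σ)
    (hμ : HasChartDensity n μ (scaleDensity σ)) (hτ : IsProjectiveScale τ) {ε : ℝ} (hε : 0 < ε) :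
    (sublevelVol g Ω r τ ε).toReal
      = ∫ x in {x | ε ^ 2 < scaledDefining r τ x}, volumeRatio g σ x ∂μ := by
  have := hμ.isLocallyFiniteMeasure
  rw [sublevelVol_eq hr hΩc hg hσ hμ hτ hε, integral_eq_lintegral_of_nonneg_ae
    (ae_of_all _ fun x => volumeRatio_nonneg hσ x)
    (integrableOn_volumeRatio hr hΩc hg hσ hτ (pow_pos hε 2)).aestronglyMeasurable]

omit [IsManifold 𝓘(ℝ, ModelE n) ∞ N] in
lemma IsPositiveDefining.tendsto_setIntegral {s : N → ℝ} (hs : IsPositiveDefining n Ω s)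
    {f : N → ℝ} (hf : IntegrableOn f Ω μ) :
    Tendsto (fun δ => ∫ x in {x | δ < s x}, f x ∂μ) (𝓝[>] 0) (𝓝 (∫ x in Ω, f x ∂μ)) := by
  have hm : ∀ δ, MeasurableSet {x | δ < s x} := fun δ =>
    measurableSet_lt measurable_const hs.continuous.measurable
  have hlim : Tendsto (fun δ => ∫ x in Ω, {x | δ < s x}.indicator f x ∂μ) (𝓝[>] 0)
      (𝓝 (∫ x in Ω, f x ∂μ)) := by
    refine tendsto_integral_filter_of_dominated_convergence (fun x => ‖f x‖)
      (Eventually.of_forall fun δ => hf.aestronglyMeasurable.indicator (hm δ))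
      (Eventually.of_forall fun δ => ae_of_all _ fun x => norm_indicator_le_norm_self f x) hf.norm
      ((ae_restrict_iff' hs.isOpen.measurableSet).2 (ae_of_all _ fun x hx => ?_))
    refine tendsto_const_nhds.congr' ?_
    filter_upwards [Ioo_mem_nhdsGT_zero ((hs.mem_iff x).1 hx)] with δ hδ
    exact (indicator_of_mem (show x ∈ {x | δ < s x} from hδ.2) f).symm
  refine hlim.congr' ?_
  filter_upwards [self_mem_nhdsWithin] with δ hδ
  have hδ : 0 < δ := hδ
  rw [integral_indicator (hm δ), Measure.restrict_restrict (hm δ), inter_eq_self_of_subset_left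
    (show {x | δ < s x} ⊆ Ω from fun x hx => (hs.mem_iff x).2 (hδ.trans hx))]

/-- The expansion of the volume in terms of `δ = ε²`. -/
theorem exists_expansion_volumeRatio [T2Space N] [SigmaCompactSpace N] {D : AffineConn n N}
    (hΩc : IsCompact (closure Ω)) (hr : IsFeffermanDensity D Ω r) (hg : IsBlaschkeMetric D Ω r g)
    (hσ : IsProjectiveScale σ) (hμ : HasChartDensity n μ (scaleDensity σ)) :
    ∃ L V, (Odd n → L = 0) ∧ ∀ τ : ProjDensity n N 1, IsProjectiveScale τ →
      ∃ W, HasPowerLogExpansion ((n : ℝ) / 2) ((n + 1) / 2)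
        (fun δ => ∫ x in {x | δ < scaledDefining r τ x}, volumeRatio g σ x ∂μ) L W ∧
        (Odd n → W = V) := by
  have := hμ.isLocallyFiniteMeasure
  have hJ : ∀ j < (n + 1) / 2, (j : ℝ) < (n : ℝ) / 2 := by
    intro j hj
    have : 2 * j < n := by omega
    have : ((2 * j : ℕ) : ℝ) < n := by exact_mod_cast this
    push_cast at this
    linarith
  have hν : (n : ℝ) / 2 ≤ ((n + 1) / 2 : ℕ) := by
    have : n ≤ 2 * ((n + 1) / 2) := by omega
    have : (n : ℝ) ≤ ((2 * ((n + 1) / 2) : ℕ) : ℝ) := by exact_mod_cast this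
    push_cast at this
    linarith
  have hodd : Odd n → (n : ℝ) / 2 < ((n + 1) / 2 : ℕ) := by
    rintro ⟨k, rfl⟩
    rw [show (2 * k + 1 + 1) / 2 = k + 1 by omega]
    push_cast
    linarith
  have hν0 : (0 : ℝ) ≤ (n : ℝ) / 2 := by positivity
  have hs := hr.1.isPositiveDefining hσ
  obtain ⟨L, V, hLV, hL⟩ := hs.exists_expansion hμ hΩc hJ hν hν0
    (m := fun _ => 1) contMDiff_const
  simp only [mul_one] at hLV
  set E : N → ℝ := fun x => volumeRatio g σ x - scaledDefining r σ x ^ (-((n : ℝ) / 2) - 1) with hE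
  have hEi : IntegrableOn E Ω μ := by
    obtain ⟨C, hC⟩ := exists_bound_volumeRatio_sub hΩc hr hg hσ
    refine (integrableOn_const (C := C)
      ((measure_mono subset_closure).trans_lt hΩc.measure_lt_top).ne).mono'
      (ContinuousOn.aestronglyMeasurable ?_ hs.isOpen.measurableSet)
      ((ae_restrict_iff' hs.isOpen.measurableSet).2 (ae_of_all _ fun x hx => hC x hx))
    exact (continuousOn_volumeRatio hs.isOpen hg.1 hσ).sub fun x hx =>
      (hs.continuous.continuousAt.rpow_const
        (Or.inl ((hs.mem_iff x).1 hx).ne')).continuousWithinAt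
  refine ⟨L, V + ∫ x in Ω, E x ∂μ, fun h => hL (hodd h), fun τ hτ => ?_⟩
  have hs' := hr.1.isPositiveDefining hτ
  have hβ := contMDiff_logScaleRatio hσ hτ
  have hss' := scaledDefining_eq_mul_exp r hσ hτ
  obtain ⟨L', V', hLV', -⟩ := hs'.exists_expansion hμ hΩc hJ hν hν0
    (m := fun x => Real.exp (((n : ℝ) / 2 + 1) * logScaleRatio σ τ x))
    (Real.contDiff_exp.contMDiff.comp (contMDiff_const.mul hβ))
  have hLV'' := hLV'.congr' (B := fun δ => ∫ x in {x | δ < scaledDefining r τ x},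
      scaledDefining r σ x ^ (-((n : ℝ) / 2) - 1) ∂μ) (by
    filter_upwards [self_mem_nhdsWithin] with δ hδ
    have hδ : 0 < δ := hδ
    refine setIntegral_congr_fun (measurableSet_lt measurable_const
      hs'.continuous.measurable) fun x hx => ?_
    have hx0 : 0 < scaledDefining r σ x := (hs.mem_iff x).1 ((hs'.mem_iff x).2 (hδ.trans hx))
    simp only [hss']
    rw [Real.mul_rpow hx0.le (Real.exp_pos _).le, mul_assoc, ← Real.exp_mul, ← Real.exp_add]
    have : logScaleRatio σ τ x * (-((n : ℝ) / 2) - 1)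
        + ((n : ℝ) / 2 + 1) * logScaleRatio σ τ x = 0 := by ring
    rw [this, Real.exp_zero, mul_one])
  obtain ⟨hLL, hVV⟩ := hs.expansion_unique hμ hs' hΩc hJ hν hβ hss' hLV hLV''
  rw [hLL] at hLV''
  refine ⟨V' + ∫ x in Ω, E x ∂μ, ?_, fun h => by rw [hVV (hodd h) (hL (hodd h))]⟩
  have hsum := hLV''.add (HasPowerLogExpansion.of_tendsto (hs'.tendsto_setIntegral hEi))
  rw [add_zero] at hsum
  refine hsum.congr' ?_
  filter_upwards [self_mem_nhdsWithin] with δ hδ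
  have h1 : IntegrableOn _ {x | δ < scaledDefining r τ x} μ :=
    hs.integrableOn_rpow hs' hΩc (-((n : ℝ) / 2) - 1) hδ
  have h2 : IntegrableOn E {x | δ < scaledDefining r τ x} μ :=
    (integrableOn_volumeRatio hr.1 hΩc hg.1 hσ hτ hδ).sub h1
  rw [← integral_add h1 h2]
  refine integral_congr_ae (ae_of_all _ fun x => ?_)
  simp only [hE]
  ring

end Measure

end VolumeExpansion

end

theorem theorem3p3 {n : ℕ} (hn : 2 ≤ n)
    {N : Type*} [TopologicalSpace N] [T2Space N] [SigmaCompactSpace N]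
    [ChartedSpace (ModelE n) N] [IsManifold 𝓘(ℝ, ModelE n) ∞ N]
    (P : ProjectiveStructure n N)
    -- a representative connection of the class, preserving an auxiliary projective scale
    (D : AffineConn n N) (hD : D ∈ P.carrier)
    (σ : ProjDensity n N 1) (hσ : IsProjectiveScale σ) (hDσ : IsParallel D σ)
    (Ω : Set N) (hΩ : IsStrictlyConvexDomain P Ω)
    (r : ProjDensity n N 2) (hr : IsFeffermanDensity D Ω r)
    (g : (x : N) → TangentSpace 𝓘(ℝ, ModelE n) x →L[ℝ] TangentSpace 𝓘(ℝ, ModelE n) x →L[ℝ] ℝ)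
    (hg : IsBlaschkeMetric D Ω r g) :
    (∀ τ : ProjDensity n N 1, IsProjectiveScale τ → ∀ ε : ℝ, 0 < ε →
      sublevelVol g Ω r τ ε < ⊤) ∧
    (Odd n → ∃ V : ℝ, ∀ τ : ProjDensity n N 1, IsProjectiveScale τ →
      ∃ c : ℕ → ℝ, HasVolExpansion n (fun ε => (sublevelVol g Ω r τ ε).toReal) c 0 V) ∧
    (Even n → ∃ L : ℝ, ∀ τ : ProjDensity n N 1, IsProjectiveScale τ →
      ∃ (c : ℕ → ℝ) (V : ℝ),
        HasVolExpansion n (fun ε => (sublevelVol g Ω r τ ε).toReal) c L V) := by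
  borelize N
  have hΩc := hΩ.2.2.1
  have : Nonempty N := hΩ.2.1.nonempty.to_type
  obtain ⟨μ, hμ⟩ := exists_measure_restrict_source (isChartDensity_scaleDensity σ)
  replace hμ := hasChartDensity_scaleDensity hσ hμ
  obtain ⟨L, V, hL, hLV⟩ := exists_expansion_volumeRatio hΩc hr hg hσ hμ
  have hexp : ∀ τ : ProjDensity n N 1, IsProjectiveScale τ → ∃ (c : ℕ → ℝ) (W : ℝ),
      HasVolExpansion n (fun ε => (sublevelVol g Ω r τ ε).toReal) c (2 * L) W ∧
        (Odd n → W = V) := by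
    intro τ hτ
    obtain ⟨W, hW, hWV⟩ := hLV τ hτ
    obtain ⟨c, hc⟩ := hW.hasVolExpansion
    refine ⟨c, W, Tendsto.congr' ?_ hc, hWV⟩
    filter_upwards [self_mem_nhdsWithin] with ε hε
    rw [toReal_sublevelVol hr.1 hΩc hg.1 hσ hμ hτ hε]
  refine ⟨fun τ hτ ε hε => sublevelVol_lt_top hr.1 hΩc hg.1 hσ hμ hτ hε,
    fun hodd => ⟨V, fun τ hτ => ?_⟩, fun _ => ⟨2 * L, fun τ hτ => ?_⟩⟩
  · obtain ⟨c, W, hc, hWV⟩ := hexp τ hτ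
    rw [hL hodd, mul_zero, hWV hodd] at hc
    exact ⟨c, hc⟩
  · obtain ⟨c, W, hc, -⟩ := hexp τ hτ
    exact ⟨c, W, hc⟩
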